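/- **Setting.** Let $M$ be a smooth manifold of dimension $d+1\ge 2$ (spacetime) and $\iota:\mathcal N\to M$ a smooth immersed hypersurface (of dimension $d$, possibly with several components). The dynamical fields $\phi$ are a Lorentzian metric and finitely many tensor fields on $M$; let $\mathscr F$ be a set of smooth configurations. Consider smooth differential forms on the field space $\mathscr F$ with values in differential forms on $M$ or on $\mathcal N$, with field-space exterior derivative $\delta$, spacetime exterior derivative $d$, contractions $i_\xi$ and $I_V$, and Lie derivatives $\pounds_\xi$ and $L_V=I_V\delta+\delta I_V$; an underline denotes the pull-back $\iota^*$ to $\mathcal N$. All equalities of forms are on $\mathscr F$, evaluated on tangent vectors of $\mathscr F$. A generator is a smooth, possibly field-dependent, vector field $\xi$ on $M$ such that the field-space vector field $\hat\xi$, $I_{\hat\xi}\delta\phi=\pounds_\xi\phi$, is tangent to $\mathscr F$. The anomaly operator is $\Delta_{\hat\xi}=L_{\hat\xi}-\pounds_\xi-I_{\widehat{\delta\xi}}$, where $I_{\widehat{\delta\xi}}$ is the degree-$0$ derivation with $I_{\widehat{\delta\xi}}\delta\phi=\pounds_{\delta\xi}\phi$. For forms on $\mathcal N$ and $\xi$ tangent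 to $\mathcal N$, the operations use the vector field induced by $\xi$ on $\mathcal N$. Let $L',\theta',b',\lambda'$ (on $M$) and $\ell',\beta',\mathcal E$ (on $\mathcal N$) be such forms, of (field space, spacetime) degrees $(0,d+1)$, $(1,d)$, $(0,d)$, $(1,d-1)$, $(0,d)$, $(1,d-1)$, $(1,d)$, and let $E$ be the equations of motion, such that for every generator $\xi$ $$\delta L'=E\cdot\delta\phi+d\theta',\qquad \Delta_{\hat\xi}L'=d\Delta_{\hat\xi}b',\qquad \Delta_{\hat\xi}\theta'=\Delta_{\hat\xi}\delta b'+d\Delta_{\hat\xi}\lambda',\qquad \underline{\theta'}=-\delta\ell'+d\beta'+\mathcal E .$$ Let $\mathsf Q_\xi$ be a smooth potential, linear in $\xi$ and covariant (for field-independent $\xi,\zeta$: $\Delta_{\hat\zeta}\mathsf Q_\xi=-\mathsf Q_{[\zeta,\xi]}$), of the covariant Noether current: on solutions of $E=0$, $d\mathsf Q_\xi=I_{\hat\xi}(\theta'-\delta b'-d\lambda')-i_\xi(L'-db')$. Put $$\omega'=\delta\theta',\qquad J'_\xi=I_{\hat\xi}\theta'-i_\xi L'-\Delta_{\hat\xi}b',\qquad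 Q'_\xi=\mathsf Q_\xi+i_\xi b'+I_{\hat\xi}\lambda'.$$ Let $\mathcal U$ be a subregion with oriented boundary $\partial\mathcal U=\mathcal N_{\mathcal U}+P$, where $\mathcal N_{\mathcal U}$ lies in $\mathcal N$ and $P$ is the remaining (past and future) part, and let $\Sigma$ be a slice whose boundary $\partial\Sigma$ is a cut of $\mathcal N$; these oriented domains of integration are given by smooth singular chains in $M$ and in $\mathcal N$, equality of chains meaning equality of the integrals of all smooth forms. Define $$S=\int_{\mathcal U}L'+\int_{\mathcal N_{\mathcal U}}\ell',\qquad \Omega=\int_\Sigma\omega'-\int_{\partial\Sigma}\delta\beta',$$ and, for generators $\xi$ tangent to $\mathcal N$, $$h_\xi=\underline{Q'_\xi}+i_\xi\ell'-I_{\hat\xi}\beta',\qquad \mathcal F_{\hat\xi}=\int_{\partial\Sigma}\bigl(i_\xi\mathcal E-\Delta_{\hat\xi}(\beta'-\underline{\lambda'})+h_{\delta\xi}\bigr).$$ **(i) JKM transformations.** Let $a$ and $\nu$ be arbitrary smooth (possibly noncovariant) forms on $M$ of degrees $(0,d)$ and $(1,d-1)$, and let $$L'\to L'+da,\qquad \theta'\to\theta'+\delta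 a+d\nu,\qquad \mathcal E\to\mathcal E,$$ $$b'\to b'+a,\qquad \lambda'\to\lambda'+\nu,\qquad \ell'\to\ell'-\underline a,\qquad \beta'\to\beta'+\underline\nu,$$ with $E$ and $\mathsf Q_\xi$ unchanged. Then the new quantities again satisfy all the relations above; for all generators $\xi$, $$\omega'\to\omega'+d\delta\nu,\qquad J'_\xi\to J'_\xi+d(i_\xi a+I_{\hat\xi}\nu),\qquad Q'_\xi\to Q'_\xi+i_\xi a+I_{\hat\xi}\nu;$$ and the symplectic form $\Omega$, the combination $\ell'+\underline{b'}$ and, for all generators $\xi$ tangent to $\mathcal N$, the charge density $h_\xi$ and the flux $\mathcal F_{\hat\xi}$ are invariant. The subregion action changes only by the contribution of the past and future boundaries, $S\to S+\int_P a$; it is invariant when this contribution is absent ($P=0$, or more generally $\int_P a=0$). **(ii) Boundary canonical transformations.** Let $B$ and $\Lambda$ be arbitrary smooth forms on $\mathcal N$ of degrees $(0,d)$ and $(1,d-1)$, and let $$\mathcal E\to\mathcal E+\delta B-d\Lambda,\qquad \ell'\to\ell'+B,\qquad \beta'\to\beta'+\Lambda,$$ with $L',\theta',b',\lambda',E,\mathsf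 Q_\xi$ unchanged. Then the new quantities again satisfy all the relations above, and, for all generators $\xi$ tangent to $\mathcal N$, $$S\to S+\int_{\mathcal N_{\mathcal U}}B,\qquad \Omega\to\Omega-\int_{\partial\Sigma}\delta\Lambda,\qquad h_\xi\to h_\xi+i_\xi B-I_{\hat\xi}\Lambda .$$ -/

import Mathlib

open scoped Manifold ContDiff Topology

noncomputable section

namespace CovPhase

/-! ### Exterior calculus on manifolds

`TangentSpace (𝓡 m) x` is by definition the model space `E m`, so a field of tangent tensors on a
manifold is a function with values in tensors over `E m`; the value at `x` refers to the tangent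
space at `x` exactly as Mathlib's `mfderiv` does. -/

/-- The model space of an `m`-dimensional manifold. -/
abbrev E (m : ℕ) := EuclideanSpace ℝ (Fin m)

/-- Vector fields on an `m`-manifold `X` (no regularity). -/
abbrev VF (m : ℕ) (X : Type*) := X → E m

/-- Differential `q`-forms on an `m`-manifold `X` (no regularity). -/
abbrev Form (m q : ℕ) (X : Type*) := X → E m [⋀^Fin q]→L[ℝ] ℝ

/-- Tensors with `r` contravariant and `s` covariant indices:
`T (α₁, …, α_r) (v₁, …, v_s)`. -/
abbrev Tensor (m r s : ℕ) := (E m →L[ℝ] ℝ) [×r]→L[ℝ] ((E m) [×s]→L[ℝ] ℝ)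

section Calculus

variable {m : ℕ} {X : Type*} [TopologicalSpace X] [ChartedSpace (E m) X]

/-- Derivative at `y` of the chart around `x`. -/
def dChart (x y : X) : E m →L[ℝ] E m :=
  mfderiv (𝓡 m) 𝓘(ℝ, E m) (extChartAt (𝓡 m) x) y

/-- Derivative at `y` of the inverse of the chart around `x`. -/
def dChartSymm (x : X) (y : E m) : E m →L[ℝ] E m :=
  mfderiv 𝓘(ℝ, E m) (𝓡 m) (extChartAt (𝓡 m) x).symm y

/-- The form `η` written in the chart around `x`. -/
def formRep {q : ℕ} (x : X) (η : Form m q X) (y : E m) : E m [⋀^Fin q]→L[ℝ] ℝ :=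
  (η ((extChartAt (𝓡 m) x).symm y)).compContinuousLinearMap (dChartSymm x y)

/-- The vector field `ξ` written in the chart around `x`. -/
def vecRep (x : X) (ξ : VF m X) (y : E m) : E m :=
  dChart x ((extChartAt (𝓡 m) x).symm y) (ξ ((extChartAt (𝓡 m) x).symm y))

/-- The covector map `α ↦ α ∘ A`. -/
def precomp (A : E m →L[ℝ] E m) : (E m →L[ℝ] ℝ) →L[ℝ] (E m →L[ℝ] ℝ) :=
  (ContinuousLinearMap.compL ℝ (E m) (E m) ℝ).flip A

/-- Pull-back of a tensor along a linear isomorphism `A` with inverse `A'`: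
`(α, v) ↦ T (α ∘ A') (A v)`. -/
def Tensor.pull {r s : ℕ} (A A' : E m →L[ℝ] E m) (T : Tensor m r s) : Tensor m r s :=
  (ContinuousMultilinearMap.compContinuousLinearMapL
      (fun _ : Fin s => A)).compContinuousMultilinearMap
    (T.compContinuousLinearMap fun _ => precomp A')

/-- The tensor field `T` written in the chart around `x`. -/
def tensorRep {r s : ℕ} (x : X) (T : X → Tensor m r s) (y : E m) : Tensor m r s :=
  Tensor.pull (dChartSymm x y) (dChart x ((extChartAt (𝓡 m) x).symm y))
    (T ((extChartAt (𝓡 m) x).symm y))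

/-- Exterior derivative of a form on a manifold, computed at `x` in the chart around `x`. -/
def dForm {q : ℕ} (η : Form m q X) : Form m (q + 1) X := fun x =>
  (extDeriv (formRep x η) (extChartAt (𝓡 m) x x)).compContinuousLinearMap (dChart x x)

/-- Contraction `i_ξ` of a vector field into the first slot of a form. -/
def iForm {q : ℕ} (ξ : VF m X) (η : Form m (q + 1) X) : Form m q X := fun x =>
  (η x).curryLeft (ξ x)

/-- Lie derivative of forms, `£_ξ = i_ξ d + d i_ξ` (with `i_ξ = 0` on functions). -/
def lieForm (ξ : VF m X) : {q : ℕ} → Form m q X → Form m q X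
  | 0, η => iForm ξ (dForm η)
  | _ + 1, η => iForm ξ (dForm η) + dForm (iForm ξ η)

/-- Lie derivative of a tensor field on the model space:
`(£_ξ T)(α)(v) = (D_ξ T)(α)(v) + ∑ᵢ T(α)(.., Dξ vᵢ, ..) - ∑ⱼ T(.., αⱼ ∘ Dξ, ..)(v)`. -/
def flatLie {r s : ℕ} (ξ : E m → E m) (T : E m → Tensor m r s) (y : E m) : Tensor m r s :=
  fderiv ℝ T y (ξ y)
  + ∑ i : Fin s, (ContinuousMultilinearMap.compContinuousLinearMapL
      (Function.update (fun _ => ContinuousLinearMap.id ℝ (E m)) i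
        (fderiv ℝ ξ y))).compContinuousMultilinearMap (T y)
  - ∑ j : Fin r, (T y).compContinuousLinearMap
      (Function.update (fun _ => ContinuousLinearMap.id ℝ (E m →L[ℝ] ℝ)) j
        (precomp (fderiv ℝ ξ y)))

/-- Lie derivative of a tensor field on a manifold, computed at `x` in the chart around `x`. -/
def lieTensor {r s : ℕ} (ξ : VF m X) (T : X → Tensor m r s) : X → Tensor m r s := fun x =>
  Tensor.pull (dChart x x) (dChartSymm x (extChartAt (𝓡 m) x x))
    (flatLie (vecRep x ξ) (tensorRep x T) (extChartAt (𝓡 m) x x))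

/-- Smoothness of a form. -/
def SmoothForm {q : ℕ} (η : Form m q X) : Prop :=
  ∀ x, ContDiffAt ℝ ∞ (formRep x η) (extChartAt (𝓡 m) x x)

/-- Smoothness of a vector field. -/
def SmoothVF (ξ : VF m X) : Prop :=
  ∀ x, ContDiffAt ℝ ∞ (vecRep x ξ) (extChartAt (𝓡 m) x x)

/-- Smoothness of a tensor field. -/
def SmoothTensor {r s : ℕ} (T : X → Tensor m r s) : Prop :=
  ∀ x, ContDiffAt ℝ ∞ (tensorRep x T) (extChartAt (𝓡 m) x x)

/-- Joint smoothness at `(s, x)` of a `k`-parameter family of forms. -/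
def SmoothFormAt {k q : ℕ} (F : (Fin k → ℝ) → Form m q X) (s : Fin k → ℝ) (x : X) : Prop :=
  ContDiffAt ℝ ∞ (fun p : (Fin k → ℝ) × E m => formRep x (F p.1) p.2) (s, extChartAt (𝓡 m) x x)

/-- Joint smoothness at `(s, x)` of a `k`-parameter family of vector fields. -/
def SmoothVFAt {k : ℕ} (F : (Fin k → ℝ) → VF m X) (s : Fin k → ℝ) (x : X) : Prop :=
  ContDiffAt ℝ ∞ (fun p : (Fin k → ℝ) × E m => vecRep x (F p.1) p.2) (s, extChartAt (𝓡 m) x x)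

/-- Joint smoothness at `(s, x)` of a `k`-parameter family of tensor fields. -/
def SmoothTensorAt {k r t : ℕ} (F : (Fin k → ℝ) → X → Tensor m r t) (s : Fin k → ℝ) (x : X) :
    Prop :=
  ContDiffAt ℝ ∞ (fun p : (Fin k → ℝ) × E m => tensorRep x (F p.1) p.2)
    (s, extChartAt (𝓡 m) x x)

end Calculus

/-! ### Integration over smooth singular (cubical) chains -/

section Chains

variable {m m' : ℕ} {X Y : Type*} [TopologicalSpace X] [ChartedSpace (E m) X]
  [TopologicalSpace Y] [ChartedSpace (E m') Y]

/-- Smooth singular `k`-cubes; only the restriction to `[0,1]^k` enters integrals. -/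
structure Cube (m k : ℕ) (X : Type*) [TopologicalSpace X] [ChartedSpace (E m) X] where
  toFun : (Fin k → ℝ) → X
  smooth : ContMDiff 𝓘(ℝ, Fin k → ℝ) (𝓡 m) ∞ toFun

/-- Smooth singular cubical `k`-chains with integer coefficients. -/
abbrev Chain (m k : ℕ) (X : Type*) [TopologicalSpace X] [ChartedSpace (E m) X] :=
  Cube m k X →₀ ℤ

theorem contDiff_insertNth {k : ℕ} (i : Fin (k + 1)) (e : ℝ) :
    ContDiff ℝ ∞ (fun t : Fin k → ℝ => (i.insertNth e t : Fin (k + 1) → ℝ)) := by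
  rw [contDiff_pi]
  intro j
  refine Fin.succAboveCases i ?_ (fun l => ?_) j
  · simpa using contDiff_const
  · simpa using contDiff_apply ℝ ℝ l

/-- The face `t_i = e` of a cube. -/
def Cube.face {k : ℕ} (c : Cube m (k + 1) X) (i : Fin (k + 1)) (e : ℝ) : Cube m k X where
  toFun t := c.toFun (i.insertNth e t)
  smooth := c.smooth.comp (contDiff_insertNth i e).contMDiff

/-- The boundary `∂c = ∑ᵢ (-1)ⁱ (c|_{tᵢ = 1} - c|_{tᵢ = 0})`, `i = 0, …, k`, extended linearly. -/
def Chain.boundary {k : ℕ} (C : Chain m (k + 1) X) : Chain m k X :=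
  C.sum fun c z => ∑ i : Fin (k + 1),
    ((-1) ^ (i : ℕ) * z) • (Finsupp.single (c.face i 1) 1 - Finsupp.single (c.face i 0) 1)

/-- Image of a cube under a smooth map. -/
def Cube.push {k : ℕ} (f : X → Y) (hf : ContMDiff (𝓡 m) (𝓡 m') ∞ f) (c : Cube m k X) :
    Cube m' k Y where
  toFun t := f (c.toFun t)
  smooth := hf.comp c.smooth

/-- Image of a chain under a smooth map. -/
def Chain.push {k : ℕ} (f : X → Y) (hf : ContMDiff (𝓡 m) (𝓡 m') ∞ f) (C : Chain m k X) :
    Chain m' k Y :=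
  C.mapDomain (Cube.push f hf)

/-- Integral of a form over a cube: `∫_{[0,1]^k} η(∂₁c, …, ∂_k c) dt`. -/
def Cube.integral {k : ℕ} (c : Cube m k X) (η : Form m k X) : ℝ :=
  ∫ t in Set.Icc (0 : Fin k → ℝ) 1, η (c.toFun t)
    (fun i => (mfderiv 𝓘(ℝ, Fin k → ℝ) (𝓡 m) c.toFun t (Pi.single i 1 : Fin k → ℝ) : E m))

/-- Integral of a form over a chain. -/
def Chain.integral {k : ℕ} (C : Chain m k X) (η : Form m k X) : ℝ :=
  C.sum fun c z => (z : ℝ) * c.integral η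

/-- Two chains represent the same oriented domain of integration (they agree as currents). In
particular parametrizations may be changed and degenerate cubes may be dropped. -/
def Chain.Equiv {k : ℕ} (C C' : Chain m k X) : Prop :=
  ∀ η : Form m k X, SmoothForm η → C.integral η = C'.integral η

/-- Pull-back of a form along a map. -/
def pullForm {q : ℕ} (f : X → Y) (η : Form m' q Y) : Form m q X := fun x =>
  (η (f x)).compContinuousLinearMap (mfderiv (𝓡 m) (𝓡 m') f x : E m →L[ℝ] E m')

end Chains

/-! ### Dynamical fields: a Lorentzian metric and finitely many tensor fields -/

section Fields

variable {m N : ℕ} {ty : Fin N → ℕ × ℕ} {M : Type*}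

/-- Fibre of the bundle of dynamical fields: a covariant 2-tensor and, for each `j`, a matter
tensor with `(ty j).1` contravariant and `(ty j).2` covariant indices. -/
abbrev Fiber (m : ℕ) {N : ℕ} (ty : Fin N → ℕ × ℕ) :=
  Tensor m 0 2 × ((j : Fin N) → Tensor m (ty j).1 (ty j).2)

/-- Sections of the bundle of dynamical fields (no regularity). -/
abbrev Fields (m : ℕ) {N : ℕ} (ty : Fin N → ℕ × ℕ) (M : Type*) :=
  (M → Tensor m 0 2) × ((j : Fin N) → M → Tensor m (ty j).1 (ty j).2)

/-- Value of a section at a point. -/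
def Fields.at (φ : Fields m ty M) (x : M) : Fiber m ty := (φ.1 x, fun j => φ.2 j x)

/-- Symmetry of a covariant 2-tensor. -/
def IsSym (g : Tensor m 0 2) : Prop := ∀ u v : E m, g ![] ![u, v] = g ![] ![v, u]

/-- Signature `(-, +, …, +)`. -/
def IsLorentz (g : Tensor m 0 2) : Prop :=
  ∃ b : Module.Basis (Fin m) ℝ (E m), ∀ i j,
    g ![] ![b i, b j] = if i = j then (if (i : ℕ) = 0 then -1 else 1) else 0

variable [TopologicalSpace M] [ChartedSpace (E m) M]

/-- Field variations `δφ`: smooth sections with symmetric metric part. -/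
def IsVariation (χ : Fields m ty M) : Prop :=
  (∀ x, IsSym (χ.1 x)) ∧ SmoothTensor χ.1 ∧ ∀ j, SmoothTensor (χ.2 j)

/-- Field configurations: smooth Lorentzian metrics with smooth matter fields. -/
def IsConfig (φ : Fields m ty M) : Prop := IsVariation φ ∧ ∀ x, IsLorentz (φ.1 x)

/-- `k`-parameter families of sections, jointly smooth near `{s} × M`. -/
def IsFamilyAt {k : ℕ} (Φ : (Fin k → ℝ) → Fields m ty M) (s : Fin k → ℝ) : Prop :=
  (∀ s' x, IsSym ((Φ s').1 x)) ∧
    ∀ x, SmoothTensorAt (fun s' => (Φ s').1) s x ∧ ∀ j, SmoothTensorAt (fun s' => (Φ s').2 j) s x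

/-- The Lie derivative `£_ξ φ` of the dynamical fields. -/
def lieFields (ξ : VF m M) (φ : Fields m ty M) : Fields m ty M :=
  (lieTensor ξ φ.1, fun j => lieTensor ξ (φ.2 j))

/-- The field-space vector field `ξ̂`, defined by `I_ξ̂ δφ = £_ξ φ`. -/
def hat (ξ : Fields m ty M → VF m M) (φ : Fields m ty M) : Fields m ty M := lieFields (ξ φ) φ

/-- Tangent vectors to a field space `𝓕` (a set of configurations) at `φ`: smooth variations that
are velocities of smooth curves in `𝓕`. -/
def IsTangent (𝓕 : Set (Fields m ty M)) (φ χ : Fields m ty M) : Prop :=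
  IsVariation χ ∧ ∃ Φ : (Fin 1 → ℝ) → Fields m ty M, IsFamilyAt Φ 0 ∧ (∀ s, Φ s ∈ 𝓕) ∧ Φ 0 = φ ∧
    ∀ x, HasDerivAt (fun t : ℝ => (Φ fun _ => t).1 x) (χ.1 x) 0 ∧
      ∀ j, HasDerivAt (fun t : ℝ => (Φ fun _ => t).2 j x) (χ.2 j x) 0

/-- Generators: smooth, possibly field-dependent, vector fields `ξ^a` on spacetime for which `ξ̂` is
tangent to the field space. As for field-space forms below, `ξ` is defined on all sections and is
smooth along ambient families through points of `𝓕`. -/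
structure IsSmoothGen (𝓕 : Set (Fields m ty M)) (ξ : Fields m ty M → VF m M) : Prop where
  smooth : ∀ (k : ℕ) (Φ : (Fin k → ℝ) → Fields m ty M) (s : Fin k → ℝ),
    IsFamilyAt Φ s → Φ s ∈ 𝓕 → ∀ x, SmoothVFAt (fun s' => ξ (Φ s')) s x
  tangent : ∀ φ ∈ 𝓕, IsTangent 𝓕 φ (hat ξ φ)

end Fields

/-! ### Forms on field space with values in spacetime forms -/

section FieldForms

variable {m m' N p q : ℕ} {ty : Fin N → ℕ × ℕ} {M X : Type*}

/-- Field-space `p`-forms with values in `V`: functions of the field configuration and of `p`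
variations, on a field space `𝓕` given by an extension to all sections; only the restriction of a
form to points of `𝓕` and vectors tangent to `𝓕` matters. -/
abbrev FieldForm (m : ℕ) {N : ℕ} (ty : Fin N → ℕ × ℕ) (M : Type*) (p : ℕ) (V : Type*) :=
  Fields m ty M → (Fin p → Fields m ty M) → V

/-- Field-space exterior derivative `δ`,
`(δα)(χ₀, …, χ_p) = ∑ᵢ (-1)ⁱ D_{χᵢ} α (χ₀, …, χ̂ᵢ, …, χ_p)`, with the directional derivatives taken
at each point of `X`. -/
def delta (α : FieldForm m ty M p (Form m' q X)) : FieldForm m ty M (p + 1) (Form m' q X) :=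
  fun φ χ x => ∑ i : Fin (p + 1),
    (-1 : ℝ) ^ (i : ℕ) • deriv (fun t : ℝ => α (φ + t • χ i) (i.removeNth χ) x) 0

/-- The variation `δξ` of a field-dependent vector field, along `χ`. -/
def deltaVF (ξ : Fields m ty M → VF m' X) (φ χ : Fields m ty M) : VF m' X :=
  fun x => deriv (fun t : ℝ => ξ (φ + t • χ) x) 0

/-- Contraction `I_V` with a vector field on field space. -/
def fI {V : Type*} (v : Fields m ty M → Fields m ty M) (α : FieldForm m ty M (p + 1) V) :
    FieldForm m ty M p V :=
  fun φ χ => α φ (Fin.cons (v φ) χ)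

/-- The degree-0 derivation `I_ρ` of a vector-valued field-space one-form `ρ`:
`(I_ρ α)(χ₁, …, χ_p) = ∑ᵢ α(χ₁, …, ρ(χᵢ), …, χ_p)`. -/
def fIone (ρ : Fields m ty M → Fields m ty M → Fields m ty M)
    (α : FieldForm m ty M p (Form m' q X)) : FieldForm m ty M p (Form m' q X) :=
  fun φ χ => ∑ i : Fin p, α φ (Function.update χ i (ρ φ (χ i)))

/-- Field-space Lie derivative `L_V = I_V δ + δ I_V` (with `I_V = 0` on functions). -/
def fL (v : Fields m ty M → Fields m ty M) :
    {p : ℕ} → FieldForm m ty M p (Form m' q X) → FieldForm m ty M p (Form m' q X)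
  | 0, α => fI v (delta α)
  | _ + 1, α => fI v (delta α) + delta (fI v α)

variable [TopologicalSpace M] [ChartedSpace (E m) M] [TopologicalSpace X] [ChartedSpace (E m') X]

/-- Spacetime exterior derivative of a field-space form. -/
def fd (α : FieldForm m ty M p (Form m' q X)) : FieldForm m ty M p (Form m' (q + 1) X) :=
  fun φ χ => dForm (α φ χ)

/-- Contraction with a (field-dependent) vector field. -/
def fi (ξ : Fields m ty M → VF m' X) (α : FieldForm m ty M p (Form m' (q + 1) X)) :
    FieldForm m ty M p (Form m' q X) :=
  fun φ χ => iForm (ξ φ) (α φ χ)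

/-- Lie derivative along a (field-dependent) vector field. -/
def flie (ξ : Fields m ty M → VF m' X) (α : FieldForm m ty M p (Form m' q X)) :
    FieldForm m ty M p (Form m' q X) :=
  fun φ χ => lieForm (ξ φ) (α φ χ)

/-- Pull-back along a map `f : X → M`. -/
def fpull (f : X → M) (α : FieldForm m ty M p (Form m q M)) : FieldForm m ty M p (Form m' q X) :=
  fun φ χ => pullForm f (α φ χ)

/-- Integral over a chain. -/
def fint (C : Chain m' q X) (α : FieldForm m ty M p (Form m' q X)) : FieldForm m ty M p ℝ :=
  fun φ χ => C.integral (α φ χ)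

/-- The anomaly operator `Δ_ξ̂ = L_ξ̂ - £_ξ - I_{δξ^}` on forms on `X`, where `ξ` is the vector field
on spacetime and `ξX` is the vector field on `X` induced by it (`ξX = ξ` if `X` is spacetime). -/
def anomaly (ξ : Fields m ty M → VF m M) (ξX : Fields m ty M → VF m' X)
    (α : FieldForm m ty M p (Form m' q X)) : FieldForm m ty M p (Form m' q X) :=
  fL (hat ξ) α - flie ξX α - fIone (fun φ χ => lieFields (deltaVF ξ φ χ) φ) α

/-- Equality of field-space forms on the field space `𝓕`. -/
def FEq {V : Type*} (𝓕 : Set (Fields m ty M)) (α β : FieldForm m ty M p V) : Prop :=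
  ∀ φ ∈ 𝓕, ∀ χ, (∀ i, IsTangent 𝓕 φ (χ i)) → α φ χ = β φ χ

/-- Smooth field-space `p`-forms with values in forms on `X`: alternating, multilinear in the
variations, and taking jointly smooth families of fields and variations to jointly smooth families
of forms. The families are only required to meet `𝓕` at the base point, because `φ + t χ` may leave
`𝓕` for arbitrarily small `t` (for instance, stop being a Lorentzian metric far away on `M`); the
forms of interest are local in the fields. -/
structure IsFieldForm (𝓕 : Set (Fields m ty M)) (α : FieldForm m ty M p (Form m' q X)) :
    Prop where
  map_add : ∀ φ ∈ 𝓕, ∀ χ, (∀ j, IsVariation (χ j)) → ∀ i u v,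
    IsVariation u → IsVariation v →
    α φ (Function.update χ i (u + v))
      = α φ (Function.update χ i u) + α φ (Function.update χ i v)
  map_smul : ∀ φ ∈ 𝓕, ∀ χ, (∀ j, IsVariation (χ j)) → ∀ i u (c : ℝ), IsVariation u →
    α φ (Function.update χ i (c • u)) = c • α φ (Function.update χ i u)
  map_eq_zero : ∀ φ ∈ 𝓕, ∀ χ, (∀ j, IsVariation (χ j)) → ∀ i j, i ≠ j → χ i = χ j →
    α φ χ = 0
  smooth : ∀ (k : ℕ) (Φ : (Fin k → ℝ) → Fields m ty M) (Ψ : Fin p → (Fin k → ℝ) → Fields m ty M)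
    (s : Fin k → ℝ), IsFamilyAt Φ s → (∀ i, IsFamilyAt (Ψ i) s) → Φ s ∈ 𝓕 →
    ∀ x, SmoothFormAt (fun s' => α (Φ s') (fun i => Ψ i s')) s x

end FieldForms

scoped notation:50 α:51 " ≐[" 𝓕 "] " β:51 => FEq 𝓕 α β

/-! ### The covariant phase space formalism with a boundary

Spacetime `M` has dimension `d + 1 = n + 2` and the hypersurface `𝒩` has dimension `d = n + 1`. -/

/-- An immersed hypersurface of `M`. -/
structure Hypersurface (n : ℕ) (M 𝒩 : Type*) [TopologicalSpace M] [ChartedSpace (E (n + 2)) M]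
    [TopologicalSpace 𝒩] [ChartedSpace (E (n + 1)) 𝒩] where
  ι : 𝒩 → M
  smooth : ContMDiff (𝓡 (n + 1)) (𝓡 (n + 2)) ∞ ι
  immersive : ∀ y, Function.Injective (mfderiv (𝓡 (n + 1)) (𝓡 (n + 2)) ι y)

/-- The quantities entering the formalism: the Lagrangian `L'`, the equations of motion `E` (so that
`E · δφ` is linear in the value of `δφ`), the symplectic potential `θ'`, the noncovariances `b'`,
`λ'`, the covariant Noether potential `Q_ξ` of the covariant Noether current, and, on the
hypersurface, the boundary term `ℓ'`, the corner term `β'` and the flux `ℰ`. -/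
structure PhaseData (n : ℕ) {N : ℕ} (ty : Fin N → ℕ × ℕ) (M 𝒩 : Type*) where
  L : FieldForm (n + 2) ty M 0 (Form (n + 2) (n + 2) M)
  eom : Fields (n + 2) ty M → (x : M) →
    Fiber (n + 2) ty →L[ℝ] (E (n + 2) [⋀^Fin (n + 2)]→L[ℝ] ℝ)
  θ : FieldForm (n + 2) ty M 1 (Form (n + 2) (n + 1) M)
  b : FieldForm (n + 2) ty M 0 (Form (n + 2) (n + 1) M)
  lam : FieldForm (n + 2) ty M 1 (Form (n + 2) n M)
  Qcov : VF (n + 2) M → FieldForm (n + 2) ty M 0 (Form (n + 2) n M)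
  ell : FieldForm (n + 2) ty M 0 (Form (n + 1) (n + 1) 𝒩)
  β : FieldForm (n + 2) ty M 1 (Form (n + 1) n 𝒩)
  flux : FieldForm (n + 2) ty M 1 (Form (n + 1) (n + 1) 𝒩)

section Formalism

variable {n N : ℕ} {ty : Fin N → ℕ × ℕ} {M 𝒩 : Type*}
  [TopologicalSpace M] [ChartedSpace (E (n + 2)) M]
  [TopologicalSpace 𝒩] [ChartedSpace (E (n + 1)) 𝒩]

/-- A smooth, possibly field-dependent generator `ξ^a` tangent to the hypersurface, with the vector
field that it induces on the hypersurface. -/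
structure Generator (𝓕 : Set (Fields (n + 2) ty M)) (H : Hypersurface n M 𝒩) where
  ξ : Fields (n + 2) ty M → VF (n + 2) M
  ξN : Fields (n + 2) ty M → VF (n + 1) 𝒩
  isGen : IsSmoothGen 𝓕 ξ
  tangent : ∀ φ y,
    (mfderiv (𝓡 (n + 1)) (𝓡 (n + 2)) H.ι y : E (n + 1) →L[ℝ] E (n + 2)) (ξN φ y) = ξ φ (H.ι y)

/-- The subregion, its boundary and a cut, as oriented domains of integration, given by smooth
singular chains (a compact oriented region is represented by any fundamental chain of it, obtained
from a smooth triangulation, and integrals over the two agree): `U` is the subregion,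
`bdry` (in `𝒩`) is the part of its boundary in the hypersurface, `rest` is the remaining (past and
future) part of its boundary; `slice` is the slice `Σ`, whose boundary is the cut `cut` of `𝒩`. -/
structure Subregion (H : Hypersurface n M 𝒩) where
  U : Chain (n + 2) (n + 2) M
  bdry : Chain (n + 1) (n + 1) 𝒩
  rest : Chain (n + 2) (n + 1) M
  boundary_U : U.boundary.Equiv (bdry.push H.ι H.smooth + rest)
  slice : Chain (n + 2) (n + 1) M
  cut : Chain (n + 1) n 𝒩
  boundary_slice : slice.boundary.Equiv (cut.push H.ι H.smooth)

namespace PhaseData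

variable (D : PhaseData n ty M 𝒩)

/-- `E · δφ`. -/
def eomForm : FieldForm (n + 2) ty M 1 (Form (n + 2) (n + 2) M) :=
  fun φ χ x => D.eom φ x ((χ 0).at x)

/-- The solution space `𝒮`: configurations in `𝓕` with `E = 0`. -/
def OnShell (𝓕 : Set (Fields (n + 2) ty M)) (φ : Fields (n + 2) ty M) : Prop :=
  φ ∈ 𝓕 ∧ ∀ x, ∀ w : Fiber (n + 2) ty, IsSym w.1 → D.eom φ x w = 0

/-- The covariant Lagrangian `L' - d b'`. -/
def Lcov : FieldForm (n + 2) ty M 0 (Form (n + 2) (n + 2) M) := D.L - fd D.b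

/-- The covariant symplectic potential `θ' - δ b' - d λ'`. -/
def θcov : FieldForm (n + 2) ty M 1 (Form (n + 2) (n + 1) M) := D.θ - delta D.b - fd D.lam

/-- The covariant Noether current `I_ξ̂ θ - i_ξ L` of the covariant `L`, `θ`. -/
def Jcov (ξ : Fields (n + 2) ty M → VF (n + 2) M) :
    FieldForm (n + 2) ty M 0 (Form (n + 2) (n + 1) M) :=
  fI (hat ξ) D.θcov - fi ξ D.Lcov

/-- The defining relations of the formalism. -/
structure IsValid (𝓕 : Set (Fields (n + 2) ty M)) (H : Hypersurface n M 𝒩) : Prop where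
  hL : IsFieldForm 𝓕 D.L
  hθ : IsFieldForm 𝓕 D.θ
  hb : IsFieldForm 𝓕 D.b
  hlam : IsFieldForm 𝓕 D.lam
  hell : IsFieldForm 𝓕 D.ell
  hβ : IsFieldForm 𝓕 D.β
  hflux : IsFieldForm 𝓕 D.flux
  /-- `δ L' = E · δφ + d θ'` -/
  delta_L : delta D.L ≐[𝓕] D.eomForm + fd D.θ
  /-- `Δ_ξ̂ L' = d Δ_ξ̂ b'` -/
  anomaly_L : ∀ ξ, IsSmoothGen 𝓕 ξ → anomaly ξ ξ D.L ≐[𝓕] fd (anomaly ξ ξ D.b)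
  /-- `Δ_ξ̂ θ' = Δ_ξ̂ δ b' + d Δ_ξ̂ λ'` -/
  anomaly_θ : ∀ ξ, IsSmoothGen 𝓕 ξ →
    anomaly ξ ξ D.θ ≐[𝓕] anomaly ξ ξ (delta D.b) + fd (anomaly ξ ξ D.lam)
  /-- `θ' = - δ ℓ' + d β' + ℰ` pulled back to the hypersurface -/
  decomposition : fpull H.ι D.θ ≐[𝓕] - delta D.ell + fd D.β + D.flux
  Q_add : ∀ ξ ζ, SmoothVF ξ → SmoothVF ζ → D.Qcov (ξ + ζ) ≐[𝓕] D.Qcov ξ + D.Qcov ζ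
  Q_smul : ∀ (c : ℝ) ξ, SmoothVF ξ → D.Qcov (c • ξ) ≐[𝓕] c • D.Qcov ξ
  Q_smooth : ∀ (k : ℕ) (Φ : (Fin k → ℝ) → Fields (n + 2) ty M) (Z : (Fin k → ℝ) → VF (n + 2) M)
    (s : Fin k → ℝ), IsFamilyAt Φ s → Φ s ∈ 𝓕 → (∀ x, SmoothVFAt Z s x) →
    ∀ χ x, SmoothFormAt (fun s' => D.Qcov (Z s') (Φ s') χ) s x
  /-- covariance: the only noncovariance of `Q_ξ` comes from `ξ`, `Δ_ζ̂ Q_ξ = - Q_{[ζ, ξ]}` -/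
  Q_covariant : ∀ ζ ξ, IsSmoothGen 𝓕 (fun _ => ζ) → SmoothVF ξ →
    anomaly (fun _ => ζ) (fun _ => ζ) (D.Qcov ξ)
      ≐[𝓕] - D.Qcov (VectorField.mlieBracket (𝓡 (n + 2)) ζ ξ)
  /-- `d Q_ξ` is the covariant Noether current on shell -/
  Q_potential : ∀ ξ, SmoothVF ξ → ∀ φ, D.OnShell 𝓕 φ → IsTangent 𝓕 φ (lieFields ξ φ) → ∀ χ,
    fd (D.Qcov ξ) φ χ = D.Jcov (fun _ => ξ) φ χ

/-- The symplectic current `η' = δ θ'`. -/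
def sympCurrent : FieldForm (n + 2) ty M 2 (Form (n + 2) (n + 1) M) := delta D.θ

/-- The Noether current `J'_ξ = I_ξ̂ θ' - i_ξ L' - Δ_ξ̂ b'`. -/
def J (ξ : Fields (n + 2) ty M → VF (n + 2) M) :
    FieldForm (n + 2) ty M 0 (Form (n + 2) (n + 1) M) :=
  fI (hat ξ) D.θ - fi ξ D.L - anomaly ξ ξ D.b

/-- The Noether potential `Q'_ξ = Q_ξ + i_ξ b' + I_ξ̂ λ'`. -/
def Q (ξ : Fields (n + 2) ty M → VF (n + 2) M) :
    FieldForm (n + 2) ty M 0 (Form (n + 2) n M) :=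
  (fun φ χ => D.Qcov (ξ φ) φ χ) + fi ξ D.b + fI (hat ξ) D.lam

/-- The charge density `Q'_ξ + i_ξ ℓ' - I_ξ̂ β'` on the hypersurface, for a vector field `ξ` that
induces `ξN` on it. -/
def density (H : Hypersurface n M 𝒩) (ξ : Fields (n + 2) ty M → VF (n + 2) M)
    (ξN : Fields (n + 2) ty M → VF (n + 1) 𝒩) : FieldForm (n + 2) ty M 0 (Form (n + 1) n 𝒩) :=
  fpull H.ι (D.Q ξ) + fi ξN D.ell - fI (hat ξ) D.β

variable {𝓕 : Set (Fields (n + 2) ty M)} {H : Hypersurface n M 𝒩}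

/-- The localized charge density `h_ξ`. -/
def h (G : Generator 𝓕 H) : FieldForm (n + 2) ty M 0 (Form (n + 1) n 𝒩) := D.density H G.ξ G.ξN

/-- The field-space one-form `h_{δξ}`: the charge density of the vector field `δξ`. -/
def hδ (G : Generator 𝓕 H) : FieldForm (n + 2) ty M 1 (Form (n + 1) n 𝒩) := fun φ χ =>
  D.density H (fun _ => deltaVF G.ξ φ (χ 0)) (fun _ => deltaVF G.ξN φ (χ 0)) φ Fin.elim0

/-- The symplectic form `Ω = ∫_Σ η' - ∫_{∂Σ} δ β'`. -/
def Ω (R : Subregion H) : FieldForm (n + 2) ty M 2 ℝ :=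
  fint R.slice D.sympCurrent - fint R.cut (delta D.β)

/-- The subregion action `S = ∫_U L' + ∫_𝒩 ℓ'`. -/
def S (R : Subregion H) : FieldForm (n + 2) ty M 0 ℝ := fint R.U D.L + fint R.bdry D.ell

/-- The flux `𝓕_ξ̂ = ∫_{∂Σ} (i_ξ ℰ - Δ_ξ̂ (β' - λ') + h_{δξ})`. -/
def F (G : Generator 𝓕 H) (R : Subregion H) : FieldForm (n + 2) ty M 1 ℝ :=
  fint R.cut (fi G.ξN D.flux - anomaly G.ξ G.ξN (D.β - fpull H.ι D.lam) + D.hδ G)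

/-- The combination `ℓ' + b'` on the hypersurface. -/
def ellb (H : Hypersurface n M 𝒩) : FieldForm (n + 2) ty M 0 (Form (n + 1) (n + 1) 𝒩) :=
  D.ell + fpull H.ι D.b

/-- JKM transformation: `L' → L' + da`, `θ' → θ' + δa + dν` at fixed flux, with
`b' → b' + a`, `λ' → λ' + ν`, `ℓ' → ℓ' - a`, `β' → β' + ν`. -/
def jkm (H : Hypersurface n M 𝒩) (a : FieldForm (n + 2) ty M 0 (Form (n + 2) (n + 1) M))
    (ν : FieldForm (n + 2) ty M 1 (Form (n + 2) n M)) : PhaseData n ty M 𝒩 where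
  L := D.L + fd a
  eom := D.eom
  θ := D.θ + delta a + fd ν
  b := D.b + a
  lam := D.lam + ν
  Qcov := D.Qcov
  ell := D.ell - fpull H.ι a
  β := D.β + fpull H.ι ν
  flux := D.flux

/-- Boundary canonical transformation: `ℰ → ℰ + δB - dΛ`, `ℓ' → ℓ' + B`, `β' → β' + Λ`. -/
def bct (B : FieldForm (n + 2) ty M 0 (Form (n + 1) (n + 1) 𝒩))
    (Λ : FieldForm (n + 2) ty M 1 (Form (n + 1) n 𝒩)) : PhaseData n ty M 𝒩 where
  L := D.L
  eom := D.eom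
  θ := D.θ
  b := D.b
  lam := D.lam
  Qcov := D.Qcov
  ell := D.ell + B
  β := D.β + Λ
  flux := D.flux + delta B - fd Λ

end PhaseData

end Formalism

end CovPhase

end

open scoped CovPhase
open CovPhase

set_option linter.unusedSectionVars false

noncomputable section

namespace CovPhase

/-! ### Smooth dependence of multilinear algebra -/

section Flat

variable {F V W : Type*} [NormedAddCommGroup F] [NormedSpace ℝ F] [NormedAddCommGroup V]
  [NormedSpace ℝ V] [NormedAddCommGroup W] [NormedSpace ℝ W]

/-! Both transformations shift the data by terms that cancel against each other or reduce to
boundary integrals. Formally only a few identities are used: d² = 0, δ² = 0, δd = dδ, commutation of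
d and δ with ι*, i_{ξN} ι* = ι* i_ξ for tangent ξ, Cartan's formula, additivity of Δ_ξ̂ and its
commutation with d, and Stokes' theorem. Thus ω' changes by δ(δa + dν) = dδν, whose integral over Σ
is the integral of δν over the cut, and the shift of β' removes it. Since Δ_ξ̂ a = I_ξ̂ δa − £_ξ a
on field-space functions, the change of J'_ξ collapses to d(i_ξ a + I_ξ̂ ν). The combinations L' −
db' and θ' − δb' − dλ' do not move, so Q_ξ stays a potential of the covariant current. In h_ξ the
shifts of ℓ' and β' undo that of Q'_ξ, and the same holds for δξ, which is again tangent to the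
hypersurface.

The work lies in proving these identities for forms that are bare functions, differentiated by
`deriv`, and smooth only along families at parameter values where the family meets 𝓕. A line φ + tχ
may leave 𝓕, so equality on 𝓕 does not survive δ. Three notions handle this: `SmoothOn` (smoothness
along families), `GermEq` (equality near the base point, the relation δ respects) and `VEq`
(equality at points of 𝓕 on all variations, since Δ_ξ̂ inserts £_{δξ} φ, which is not known to be
tangent to 𝓕).

A directional derivative on field space becomes a derivative in one extra parameter of a family
(`IsFamilyAt.line`). Hence δ preserves `SmoothOn`, and its commutation with d is symmetry of second
derivatives (`hasDerivAt_fderiv_param`). Contraction with ξ̂ preserves smooth families because Lie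
derivatives of tensors can be computed in any chart (`flatLie_pull`, `tensorRep_lieTensor`). Stokes'
theorem for cubes is the divergence theorem (`Cube.integral_dForm`). The transformation laws then
follow by algebra. -/

theorem two_le_infty : (1 + 1 : WithTop ℕ∞) ≤ ∞ := by
  rw [one_add_one_eq_two]
  exact WithTop.coe_le_coe.2 le_top

/-- An injective linear map into a finite-dimensional space has a continuous left inverse, so
smoothness may be tested after the embedding. This lets alternating maps be treated as multilinear
ones. -/
theorem contDiffAt_of_injective_comp [FiniteDimensional ℝ W] (L : V →L[ℝ] W)
    (hL : Function.Injective L) {f : F → V} {x : F} {r : WithTop ℕ∞}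
    (h : ContDiffAt ℝ r (fun y => L (f y)) x) : ContDiffAt ℝ r f x := by
  obtain ⟨g, hg⟩ := (L : V →ₗ[ℝ] W).exists_leftInverse_of_injective (LinearMap.ker_eq_bot.2 hL)
  have h1 := (LinearMap.toContinuousLinearMap g).contDiff.contDiffAt.comp x h
  refine h1.congr_of_eventuallyEq (Filter.Eventually.of_forall fun y => ?_)
  exact (LinearMap.congr_fun hg (f y)).symm

/-- Supplies the finite dimensionality that `contDiffAt_of_injective_comp` asks of the space of
multilinear maps. -/
instance finiteDimensional_continuousMultilinearMap {q : ℕ} {X Y : Type*} [NormedAddCommGroup X]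
    [NormedSpace ℝ X] [FiniteDimensional ℝ X] [NormedAddCommGroup Y] [NormedSpace ℝ Y]
    [FiniteDimensional ℝ Y] : FiniteDimensional ℝ (X [×q]→L[ℝ] Y) :=
  Module.Finite.of_injective
    (ContinuousMultilinearMap.toMultilinearMapLinear :
      (X [×q]→L[ℝ] Y) →ₗ[ℝ] MultilinearMap ℝ (fun _ : Fin q => X) Y)
    ContinuousMultilinearMap.toMultilinearMap_injective

theorem contDiffAt_multilinear_comp {ι : Type*} [Fintype ι] {G H : ι → Type*}
    [∀ i, NormedAddCommGroup (G i)] [∀ i, NormedSpace ℝ (G i)]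
    [∀ i, NormedAddCommGroup (H i)] [∀ i, NormedSpace ℝ (H i)] {x : F} {r : WithTop ℕ∞}
    {T : F → ContinuousMultilinearMap ℝ H V} {A : ∀ i, F → G i →L[ℝ] H i}
    (hT : ContDiffAt ℝ r T x) (hA : ∀ i, ContDiffAt ℝ r (A i) x) :
    ContDiffAt ℝ r (fun y => (T y).compContinuousLinearMap (fun i => A i y)) x := by
  have h1 := (ContinuousMultilinearMap.compContinuousLinearMapContinuousMultilinear ℝ G H
    V).contDiff.contDiffAt.comp x (contDiffAt_pi.2 hA)
  exact h1.clm_apply hT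

theorem contDiffAt_alternating_comp {m' q : ℕ} {x : F} {r : WithTop ℕ∞}
    {T : F → (E m') [⋀^Fin q]→L[ℝ] ℝ} {G : Type*} [NormedAddCommGroup G] [NormedSpace ℝ G]
    [FiniteDimensional ℝ G] {A : F → G →L[ℝ] E m'}
    (hT : ContDiffAt ℝ r T x) (hA : ContDiffAt ℝ r A x) :
    ContDiffAt ℝ r (fun y => (T y).compContinuousLinearMap (A y)) x := by
  refine contDiffAt_of_injective_comp
    (ContinuousAlternatingMap.toContinuousMultilinearMapCLM ℝ)
    ContinuousAlternatingMap.toContinuousMultilinearMap_injective ?_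
  have h1 : ContDiffAt ℝ r (fun y => (T y).toContinuousMultilinearMap) x :=
    ContDiffAt.comp x (ContinuousLinearMap.contDiff (𝕜 := ℝ)
      (ContinuousAlternatingMap.toContinuousMultilinearMapCLM ℝ :
        ((E m') [⋀^Fin q]→L[ℝ] ℝ) →L[ℝ] _)).contDiffAt hT
  exact contDiffAt_multilinear_comp h1 (fun _ => hA)

end Flat

/-! ### Charts -/

section Charts

variable {m : ℕ} {X : Type*} [TopologicalSpace X] [ChartedSpace (E m) X]
  [IsManifold (𝓡 m) ∞ X]

instance isManifold_one : IsManifold (𝓡 m) 1 X := IsManifold.of_le (n := ∞) (by norm_num)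

theorem dChart_comp_dChartSymm {x : X} {y : E m} (hy : y ∈ (extChartAt (𝓡 m) x).target) :
    (dChart x ((extChartAt (𝓡 m) x).symm y)).comp (dChartSymm x y) = .id ℝ (E m) := by
  have h := mfderiv_extChartAt_comp_mfderivWithin_extChartAt_symm (I := 𝓡 m) hy
  rw [ModelWithCorners.range_eq_univ, mfderivWithin_univ] at h
  exact h

theorem dChartSymm_comp_dChart {x : X} {y : E m} (hy : y ∈ (extChartAt (𝓡 m) x).target) :
    (dChartSymm x y).comp (dChart x ((extChartAt (𝓡 m) x).symm y)) = .id ℝ (E m) := by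
  have h := mfderivWithin_extChartAt_symm_comp_mfderiv_extChartAt (I := 𝓡 m) hy
  rw [ModelWithCorners.range_eq_univ, mfderivWithin_univ] at h
  exact h

/-- The tangent space at `x` is identified with the model space through the preferred chart at `x`,
so this chart has identity derivative there. -/
theorem dChart_self (x : X) : dChart x x = .id ℝ (E m) :=
  mfderiv_extChartAt_self (I := 𝓡 m)

theorem dChartSymm_self (x : X) : dChartSymm x (extChartAt (𝓡 m) x x) = .id ℝ (E m) := by
  have h := mfderivWithin_range_extChartAt_symm (I := 𝓡 m) (x := x)
  rw [ModelWithCorners.range_eq_univ, mfderivWithin_univ] at h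
  exact h

theorem contMDiffAt_extChartAt_symm {x : X} {y : E m} (hy : y ∈ (extChartAt (𝓡 m) x).target) :
    ContMDiffAt 𝓘(ℝ, E m) (𝓡 m) ∞ (extChartAt (𝓡 m) x).symm y :=
  (contMDiffOn_extChartAt_symm x).contMDiffAt ((isOpen_extChartAt_target x).mem_nhds hy)

theorem eventually_mem_target (x : X) :
    ∀ᶠ y in 𝓝 (extChartAt (𝓡 m) x x), y ∈ (extChartAt (𝓡 m) x).target :=
  extChartAt_target_mem_nhds x

theorem dForm_apply {q : ℕ} (η : Form m q X) (x : X) :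
    dForm η x = extDeriv (formRep x η) (extChartAt (𝓡 m) x x) := by
  rw [dForm, dChart_self]
  rfl

variable {F : Type*} [NormedAddCommGroup F] [NormedSpace ℝ F]

/-- Derivative of a map from a vector space to a manifold. -/
def dMap (f : F → X) (y : F) : F →L[ℝ] E m := mfderiv 𝓘(ℝ, F) (𝓡 m) f y

/-- Pull-back of a form along a map from a vector space. -/
def pullFlat {q : ℕ} (f : F → X) (η : Form m q X) (y : F) : F [⋀^Fin q]→L[ℝ] ℝ :=
  (η (f y)).compContinuousLinearMap (dMap f y)

theorem formRep_eq_pullFlat {q : ℕ} (x : X) (η : Form m q X) :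
    formRep x η = pullFlat (extChartAt (𝓡 m) x).symm η := rfl

theorem contDiffAt_extChartAt_comp {f : F → X} {x : X} {y : F}
    (hf : ContMDiffAt 𝓘(ℝ, F) (𝓡 m) ∞ f y) (hy : f y ∈ (extChartAt (𝓡 m) x).source) :
    ContDiffAt ℝ ∞ (fun y => extChartAt (𝓡 m) x (f y)) y := by
  rw [← contMDiffAt_iff_contDiffAt]
  exact (contMDiffAt_extChartAt' (by rwa [extChartAt_source] at hy)).comp y hf

theorem fderiv_extChartAt_comp {f : F → X} {x : X} {y : F}
    (hf : MDifferentiableAt 𝓘(ℝ, F) (𝓡 m) f y) (hy : f y ∈ (extChartAt (𝓡 m) x).source) :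
    fderiv ℝ (fun y => extChartAt (𝓡 m) x (f y)) y = (dChart x (f y)).comp (dMap f y) := by
  rw [← mfderiv_eq_fderiv]
  exact mfderiv_comp y (mdifferentiableAt_extChartAt (by rwa [extChartAt_source] at hy)) hf

theorem dMap_eq_dChartSymm_comp {f : F → X} {x : X} {y : F}
    (hf : MDifferentiableAt 𝓘(ℝ, F) (𝓡 m) f y) (hy : f y ∈ (extChartAt (𝓡 m) x).source) :
    dMap f y = (dChartSymm x (extChartAt (𝓡 m) x (f y))).comp
      (fderiv ℝ (fun y => extChartAt (𝓡 m) x (f y)) y) := by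
  have h := dChartSymm_comp_dChart ((extChartAt (𝓡 m) x).map_source hy)
  rw [(extChartAt (𝓡 m) x).left_inv hy] at h
  rw [fderiv_extChartAt_comp hf hy, ← ContinuousLinearMap.comp_assoc, h,
    ContinuousLinearMap.id_comp]

theorem eventually_mdifferentiableAt {f : F → X} {y : F}
    (hf : ContMDiffAt 𝓘(ℝ, F) (𝓡 m) ∞ f y) :
    ∀ᶠ y' in 𝓝 y, MDifferentiableAt 𝓘(ℝ, F) (𝓡 m) f y' := by
  have h1 : ContMDiffAt 𝓘(ℝ, F) (𝓡 m) 1 f y := hf.of_le (by norm_num)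
  filter_upwards [(contMDiffAt_iff_contMDiffAt_nhds (by norm_num)).1 h1] with y' hy'
  exact hy'.mdifferentiableAt (by norm_num)

theorem pullFlat_eq {q : ℕ} {f : F → X} {x : X} {y : F} (η : Form m q X)
    (hf : MDifferentiableAt 𝓘(ℝ, F) (𝓡 m) f y) (hy : f y ∈ (extChartAt (𝓡 m) x).source) :
    pullFlat f η y = (formRep x η (extChartAt (𝓡 m) x (f y))).compContinuousLinearMap
      (fderiv ℝ (fun y => extChartAt (𝓡 m) x (f y)) y) := by
  rw [pullFlat, dMap_eq_dChartSymm_comp hf hy, formRep, (extChartAt (𝓡 m) x).left_inv hy]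
  rfl

theorem eventually_mem_source {f : F → X} {x : X} {y : F} (hf : ContinuousAt f y)
    (hy : f y ∈ (extChartAt (𝓡 m) x).source) :
    ∀ᶠ y' in 𝓝 y, f y' ∈ (extChartAt (𝓡 m) x).source :=
  hf.eventually ((isOpen_extChartAt_source x).mem_nhds hy)

theorem pullFlat_eventuallyEq {q : ℕ} {f : F → X} {x : X} {y : F} (η : Form m q X)
    (hf : ContMDiffAt 𝓘(ℝ, F) (𝓡 m) ∞ f y) (hy : f y ∈ (extChartAt (𝓡 m) x).source) :
    pullFlat f η =ᶠ[𝓝 y] fun y' =>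
      (formRep x η (extChartAt (𝓡 m) x (f y'))).compContinuousLinearMap
        (fderiv ℝ (fun y => extChartAt (𝓡 m) x (f y)) y') := by
  filter_upwards [eventually_mdifferentiableAt hf, eventually_mem_source hf.continuousAt hy] with y' h h'
  exact pullFlat_eq η h h'

theorem differentiableAt_pullFlat {q : ℕ} {f : F → X} {x : X} {y : F} {η : Form m q X}
    (hf : ContMDiffAt 𝓘(ℝ, F) (𝓡 m) ∞ f y) (hy : f y ∈ (extChartAt (𝓡 m) x).source)
    (hη : DifferentiableAt ℝ (formRep x η) (extChartAt (𝓡 m) x (f y))) :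
    DifferentiableAt ℝ (pullFlat f η) y := by
  have hg := contDiffAt_extChartAt_comp hf hy
  refine DifferentiableAt.congr_of_eventuallyEq ?_ (pullFlat_eventuallyEq η hf hy)
  refine DifferentiableAt.continuousAlternatingMapCompContinuousLinearMap ?_ ?_
  · exact DifferentiableAt.comp y hη (hg.differentiableAt (by norm_num))
  · exact (hg.fderiv_right (m := 1) two_le_infty).differentiableAt (by norm_num)

/-- Naturality of d under maps from a vector space. The value of `dForm η` at `f y` is taken in the
chart around `f y`; reading `f` in that chart reduces the claim to `extDeriv_pullback`. The
hypothesis lives in an arbitrary chart around `x` and is transported first. -/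
theorem extDeriv_pullFlat {q : ℕ} {f : F → X} {x : X} {y : F} {η : Form m q X}
    (hf : ContMDiffAt 𝓘(ℝ, F) (𝓡 m) ∞ f y) (hy : f y ∈ (extChartAt (𝓡 m) x).source)
    (hη : DifferentiableAt ℝ (formRep x η) (extChartAt (𝓡 m) x (f y))) :
    extDeriv (pullFlat f η) y = pullFlat f (dForm η) y := by
  have hs := mem_extChartAt_source (I := 𝓡 m) (f y)
  have ht := (extChartAt (𝓡 m) (f y)).map_source hs
  have h1 : DifferentiableAt ℝ (formRep (f y) η) (extChartAt (𝓡 m) (f y) (f y)) := by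
    rw [formRep_eq_pullFlat]
    have hl := (extChartAt (𝓡 m) (f y)).left_inv hs
    refine differentiableAt_pullFlat (x := x) (contMDiffAt_extChartAt_symm ht) ?_ ?_
    · rwa [hl]
    · rwa [hl]
  rw [(pullFlat_eventuallyEq η hf hs).extDeriv_eq]
  refine (extDeriv_pullback (f := fun y' => extChartAt (𝓡 m) (f y) (f y')) h1
    (contDiffAt_extChartAt_comp hf hs) (r := ∞)
    (by rw [minSmoothness_of_isRCLikeNormedField]; exact two_le_infty)).trans ?_
  rw [fderiv_extChartAt_comp (hf.mdifferentiableAt (by norm_num)) hs, pullFlat, dForm_apply,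
    dChart_self]
  rfl

/-- `dForm` uses a different chart at every point. Naturality for an inverse chart shows that one
fixed chart computes it throughout its domain, which is what smoothness of `dForm η` and d² = 0
require. -/
theorem formRep_dForm {q : ℕ} {x : X} {y : E m} {η : Form m q X}
    (hy : y ∈ (extChartAt (𝓡 m) x).target) (hη : DifferentiableAt ℝ (formRep x η) y) :
    formRep x (dForm η) y = extDeriv (formRep x η) y := by
  rw [formRep_eq_pullFlat, formRep_eq_pullFlat]
  refine (extDeriv_pullFlat (contMDiffAt_extChartAt_symm hy) (x := x)
    ((extChartAt (𝓡 m) x).map_target hy) ?_).symm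
  rwa [(extChartAt (𝓡 m) x).right_inv hy]

end Charts

/-! ### Lie derivatives of tensor fields -/

section Generic

variable {F X Y Z : Type*} [NormedAddCommGroup F] [NormedSpace ℝ F] [NormedAddCommGroup X]
  [NormedSpace ℝ X] [NormedAddCommGroup Y] [NormedSpace ℝ Y] [NormedAddCommGroup Z]
  [NormedSpace ℝ Z] {x : F} {k : WithTop ℕ∞}

theorem contDiffAt_compL_flip {A : F → X →L[ℝ] Y} (hA : ContDiffAt ℝ k A x) :
    ContDiffAt ℝ k (fun y => (ContinuousLinearMap.compL ℝ X Y Z).flip (A y)) x := by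
  fun_prop

theorem contDiffAt_clm_comp_multilinear {r : ℕ} {A : F → Y →L[ℝ] Z} {T : F → X [×r]→L[ℝ] Y}
    (hA : ContDiffAt ℝ k A x) (hT : ContDiffAt ℝ k T x) :
    ContDiffAt ℝ k (fun y => (A y).compContinuousMultilinearMap (T y)) x :=
  (isBoundedBilinearMap_compMultilinear (𝕜 := ℝ) (E := fun _ : Fin r => X)
    (F := Y) (G := Z)).contDiff.contDiffAt.comp x
    (hA.prodMk hT)

theorem contDiffAt_compContinuousLinearMapL {r : ℕ} {A : Fin r → F → X →L[ℝ] Y}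
    (hA : ∀ i, ContDiffAt ℝ k (A i) x) :
    ContDiffAt ℝ k (fun y => (ContinuousMultilinearMap.compContinuousLinearMapL
      (fun i => A i y) : (Y [×r]→L[ℝ] Z) →L[ℝ] (X [×r]→L[ℝ] Z))) x :=
  (ContinuousMultilinearMap.compContinuousLinearMapContinuousMultilinear ℝ (fun _ : Fin r => X)
    (fun _ => Y) Z).contDiff.contDiffAt.comp x (contDiffAt_pi.2 hA)

end Generic

section FlatTensor

variable {m r s : ℕ} {F : Type*} [NormedAddCommGroup F] [NormedSpace ℝ F]

theorem Tensor.pull_apply (A A' : E m →L[ℝ] E m) (T : Tensor m r s)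
    (α : Fin r → E m →L[ℝ] ℝ) (v : Fin s → E m) :
    Tensor.pull A A' T α v = T (fun j => (α j).comp A') (fun i => A (v i)) := rfl

theorem Tensor.ext_apply {T T' : Tensor m r s} (h : ∀ α v, T α v = T' α v) : T = T' := by
  ext α v
  exact h α v

theorem Tensor.pull_id (T : Tensor m r s) : Tensor.pull (.id ℝ (E m)) (.id ℝ (E m)) T = T :=
  Tensor.ext_apply fun _ _ => rfl

theorem Tensor.pull_pull (A A' B B' : E m →L[ℝ] E m) (T : Tensor m r s) :
    Tensor.pull A A' (Tensor.pull B B' T) = Tensor.pull (B.comp A) (A'.comp B') T :=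
  Tensor.ext_apply fun _ _ => rfl

theorem contDiffAt_precomp {x : F} {k : WithTop ℕ∞} {A : F → E m →L[ℝ] E m}
    (hA : ContDiffAt ℝ k A x) : ContDiffAt ℝ k (fun y => precomp (A y)) x :=
  contDiffAt_compL_flip hA

theorem contDiffAt_pull {x : F} {k : WithTop ℕ∞} {A A' : F → E m →L[ℝ] E m}
    {T : F → Tensor m r s} (hA : ContDiffAt ℝ k A x) (hA' : ContDiffAt ℝ k A' x)
    (hT : ContDiffAt ℝ k T x) : ContDiffAt ℝ k (fun y => Tensor.pull (A y) (A' y) (T y)) x := by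
  have h1 : ContDiffAt ℝ k (fun y => (T y).compContinuousLinearMap fun _ => precomp (A' y)) x :=
    contDiffAt_multilinear_comp hT fun _ => contDiffAt_precomp hA'
  exact contDiffAt_clm_comp_multilinear (contDiffAt_compContinuousLinearMapL fun _ => hA) h1

theorem flatLie_apply (ξ : E m → E m) (T : E m → Tensor m r s) (y : E m)
    (α : Fin r → E m →L[ℝ] ℝ) (v : Fin s → E m) :
    flatLie ξ T y α v = fderiv ℝ T y (ξ y) α v
      + ∑ i, T y α (Function.update v i (fderiv ℝ ξ y (v i)))
      - ∑ j, T y (Function.update α j ((α j).comp (fderiv ℝ ξ y))) v := by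
  have h1 : ∀ i : Fin s, (fun k => (Function.update
      (fun _ : Fin s => ContinuousLinearMap.id ℝ (E m)) i (fderiv ℝ ξ y) k) (v k))
      = Function.update v i (fderiv ℝ ξ y (v i)) := by
    intro i
    ext1 k
    rcases eq_or_ne k i with rfl | h <;> simp [*]
  have h2 : ∀ j : Fin r, (fun k => (Function.update
      (fun _ : Fin r => ContinuousLinearMap.id ℝ (E m →L[ℝ] ℝ)) j (precomp (fderiv ℝ ξ y)) k) (α k))
      = Function.update α j ((α j).comp (fderiv ℝ ξ y)) := by
    intro j
    ext1 k
    rcases eq_or_ne k j with rfl | h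
    · simp [precomp]
    · simp [*]
  simp only [flatLie, _root_.sub_apply, _root_.add_apply,
    _root_.sum_apply]
  congr 2
  · exact Finset.sum_congr rfl fun i _ => congrArg (T y α) (h1 i)
  · exact funext fun j => congrArg (fun β => T y β v) (h2 j)

theorem fderiv_tensor_apply {T : F → Tensor m r s} {x : F} {a : Fin r → F → E m →L[ℝ] ℝ}
    {b : Fin s → F → E m} {a' : Fin r → F →L[ℝ] E m →L[ℝ] ℝ} {b' : Fin s → F →L[ℝ] E m}
    (hT : DifferentiableAt ℝ T x) (ha : ∀ j, HasFDerivAt (a j) (a' j) x)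
    (hb : ∀ i, HasFDerivAt (b i) (b' i) x) (h : F) :
    fderiv ℝ (fun y => T y (fun j => a j y) (fun i => b i y)) x h
      = fderiv ℝ T x h (fun j => a j x) (fun i => b i x)
        + ∑ i, T x (fun j => a j x) (Function.update (fun i => b i x) i (b' i h))
        + ∑ j, T x (Function.update (fun j => a j x) j (a' j h)) (fun i => b i x) := by
  have h1 := (hT.hasFDerivAt.continuousMultilinearMap_apply ha).continuousMultilinearMap_apply hb
  rw [h1.fderiv]
  simp [ContinuousMultilinearMap.toContinuousLinearMap]
  ring

/-- Naturality of the Lie derivative of tensor fields under changes of coordinates. -/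
theorem flatLie_pull {g : E m → E m} {A' : E m → E m →L[ℝ] E m} {u : E m → E m}
    {T : E m → Tensor m r s} {y : E m} (hg : ContDiffAt ℝ ∞ g y) (hA' : DifferentiableAt ℝ A' y)
    (hl : ∀ᶠ z in 𝓝 y, (A' z).comp (fderiv ℝ g z) = .id ℝ (E m))
    (hr : ∀ᶠ z in 𝓝 y, (fderiv ℝ g z).comp (A' z) = .id ℝ (E m))
    (hu : DifferentiableAt ℝ u (g y)) (hT : DifferentiableAt ℝ T (g y))
    (hP : DifferentiableAt ℝ (fun z => Tensor.pull (fderiv ℝ g z) (A' z) (T (g z))) y) :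
    flatLie (fun z => A' z (u (g z))) (fun z => Tensor.pull (fderiv ℝ g z) (A' z) (T (g z))) y
      = Tensor.pull (fderiv ℝ g y) (A' y) (flatLie u T (g y)) := by
  have hgd := hg.differentiableAt (by norm_num)
  have hA : DifferentiableAt ℝ (fderiv ℝ g) y :=
    (hg.fderiv_right (m := 1) two_le_infty).differentiableAt (by norm_num)
  have hsymm : ∀ a b, fderiv ℝ (fderiv ℝ g) y a b = fderiv ℝ (fderiv ℝ g) y b a := fun a b =>
    hg.isSymmSndFDerivAt (by rw [minSmoothness_of_isRCLikeNormedField]; exact two_le_infty) a b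
  have hug : DifferentiableAt ℝ (fun z => u (g z)) y := DifferentiableAt.comp y hu hgd
  have hug' : fderiv ℝ (fun z => u (g z)) y = (fderiv ℝ u (g y)).comp (fderiv ℝ g y) :=
    fderiv_comp y hu hgd
  set A := fderiv ℝ g with hAdef
  set u' : E m → E m := fun z => A' z (u (g z)) with hu'
  have hu'd : DifferentiableAt ℝ u' y := hA'.clm_apply hug
  have hAl := hl.self_of_nhds
  have hAr := hr.self_of_nhds
  have hArv : ∀ v, A y (A' y v) = v := fun v => DFunLike.congr_fun hAr v
  have hAlv : ∀ v, A' y (A y v) = v := fun v => DFunLike.congr_fun hAl v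
  -- Differentiate `A z (u' z) = u (g z)`, the relation between a vector field and its coordinate
  -- expression.
  have e1 : ∀ a, fderiv ℝ A y a (u' y) + A y (fderiv ℝ u' y a) = fderiv ℝ u (g y) (A y a) := by
    intro a
    have h1 : (fun z => A z (u' z)) =ᶠ[𝓝 y] fun z => u (g z) := by
      filter_upwards [hr] with z hz
      exact DFunLike.congr_fun hz (u (g z))
    have h2 := h1.fderiv_eq (𝕜 := ℝ)
    rw [hug', (hA.hasFDerivAt.clm_apply hu'd.hasFDerivAt).fderiv] at h2
    have h3 := DFunLike.congr_fun h2 a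
    simp only [_root_.add_apply, ContinuousLinearMap.comp_apply,
      ContinuousLinearMap.flip_apply] at h3
    rw [← h3, add_comm]
  -- Differentiate `A' z (A z v) = v`.
  have e2 : ∀ a v, fderiv ℝ A' y a (A y v) + A' y (fderiv ℝ A y a v) = 0 := by
    intro a v
    have h1 : (fun z => A' z (A z v)) =ᶠ[𝓝 y] fun _ => v := by
      filter_upwards [hl] with z hz
      exact DFunLike.congr_fun hz v
    have h2 := h1.fderiv_eq (𝕜 := ℝ)
    rw [fderiv_const_apply,
      (hA'.hasFDerivAt.clm_apply (hA.hasFDerivAt.clm_apply (hasFDerivAt_const v y))).fderiv] at h2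
    have h3 := DFunLike.congr_fun h2 a
    simp only [_root_.add_apply, ContinuousLinearMap.comp_apply,
      ContinuousLinearMap.flip_apply, _root_.zero_apply, map_zero, zero_add] at h3
    rw [← h3, add_comm]
  -- The second derivative of `g` drops out: symmetry exchanges its arguments in `e1`, after which
  -- it cancels against `e2`.
  have e3 : ∀ w, fderiv ℝ A' y (u' y) w - fderiv ℝ u' y (A' y w)
      = - A' y (fderiv ℝ u (g y) w) := by
    intro w
    have h1 := e1 (A' y w)
    have h2 := e2 (u' y) (A' y w)
    rw [hArv] at h1 h2
    rw [hsymm] at h1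
    rw [← h1, map_add, hAlv, eq_neg_of_add_eq_zero_left h2]
    abel
  refine Tensor.ext_apply fun α v => ?_
  rw [Tensor.pull_apply, flatLie_apply, flatLie_apply]
  have hd := fderiv_tensor_apply (T := fun z => T (g z)) (x := y)
    (a := fun j z => (α j).comp (A' z)) (b := fun i z => A z (v i))
    (DifferentiableAt.comp (G := Tensor m r s) (g := T) y hT hgd)
    (fun j => ((ContinuousLinearMap.compL ℝ (E m) (E m) ℝ (α j)).hasFDerivAt).comp y
      hA'.hasFDerivAt)
    (fun i => hA.hasFDerivAt.clm_apply (hasFDerivAt_const (v i) y)) (u' y)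
  have hev : fderiv ℝ (fun z => Tensor.pull (A z) (A' z) (T (g z))) y (u' y) α v
      = fderiv ℝ (fun z => T (g z) (fun j => (α j).comp (A' z)) (fun i => A z (v i))) y (u' y) := by
    have h1 := (hP.hasFDerivAt.continuousMultilinear_apply_const α)
    have h2 := (h1.continuousMultilinear_apply_const v).fderiv
    change _ = fderiv ℝ (fun z => Tensor.pull (A z) (A' z) (T (g z)) α v) y (u' y)
    rw [h2]
    rfl
  rw [hev, hd]
  have hTg : fderiv ℝ (fun z => T (g z)) y (u' y) = fderiv ℝ T (g y) (u (g y)) := by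
    have : fderiv ℝ (fun z => T (g z)) y = _ :=
      fderiv_comp (G := Tensor m r s) (g := T) y hT hgd
    rw [this]
    change fderiv ℝ T (g y) (A y (A' y (u (g y)))) = _
    rw [hArv]
  rw [hTg]
  -- Slot by slot, the terms from differentiating `A` and `A'` combine with those of the Lie
  -- derivative along `u'` into those along `u`: covariant slots by `e1`, contravariant slots by
  -- `e3`.
  have hi : ∀ i, T (g y) (fun j => (α j).comp (A' y)) (Function.update (fun i => A y (v i)) i
        (fderiv ℝ A y (u' y) (v i)))
      + Tensor.pull (A y) (A' y) (T (g y)) α (Function.update v i (fderiv ℝ u' y (v i)))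
      = T (g y) (fun j => (α j).comp (A' y)) (Function.update (fun i => A y (v i)) i
        (fderiv ℝ u (g y) (A y (v i)))) := by
    intro i
    have h1 : (fun k => A y (Function.update v i (fderiv ℝ u' y (v i)) k))
        = Function.update (fun i => A y (v i)) i (A y (fderiv ℝ u' y (v i))) := by
      ext1 k
      rcases eq_or_ne k i with rfl | h <;> simp [*]
    rw [Tensor.pull_apply, h1, ← ContinuousMultilinearMap.map_update_add, hsymm, e1]
  have hj : ∀ j, T (g y) (Function.update (fun j => (α j).comp (A' y)) j
        ((α j).comp (fderiv ℝ A' y (u' y)))) (fun i => A y (v i))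
      - Tensor.pull (A y) (A' y) (T (g y)) (Function.update α j ((α j).comp (fderiv ℝ u' y))) v
      = - T (g y) (Function.update (fun j => (α j).comp (A' y)) j
        (((α j).comp (A' y)).comp (fderiv ℝ u (g y)))) (fun i => A y (v i)) := by
    intro j
    have h1 : (fun k => (Function.update α j ((α j).comp (fderiv ℝ u' y)) k).comp (A' y))
        = Function.update (fun j => (α j).comp (A' y)) j
          (((α j).comp (fderiv ℝ u' y)).comp (A' y)) := by
      ext1 k
      rcases eq_or_ne k j with rfl | h <;> simp [*]
    rw [Tensor.pull_apply, h1, ← _root_.sub_apply,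
      ← ContinuousMultilinearMap.map_update_sub, ← _root_.neg_apply]
    have h2 : (α j).comp (fderiv ℝ A' y (u' y)) - ((α j).comp (fderiv ℝ u' y)).comp (A' y)
        = (-1 : ℝ) • ((α j).comp (A' y)).comp (fderiv ℝ u (g y)) := by
      ext w
      have := congrArg (α j) (e3 w)
      rw [map_sub, map_neg] at this
      simpa using this
    rw [h2, ContinuousMultilinearMap.map_update_smul, neg_one_smul]
  have hi' := Finset.sum_congr (s₁ := Finset.univ) rfl fun i _ => hi i
  have hj' := Finset.sum_congr (s₁ := Finset.univ) rfl fun j _ => hj j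
  rw [Finset.sum_add_distrib] at hi'
  rw [Finset.sum_sub_distrib, Finset.sum_neg_distrib] at hj'
  rw [← hi', sub_eq_add_neg _ (∑ j, T (g y) _ _), ← hj']
  simp only [_root_.add_apply, ContinuousLinearMap.comp_apply,
    ContinuousLinearMap.flip_apply, _root_.zero_apply, map_zero, zero_add,
    ContinuousLinearMap.compL_apply]
  abel

end FlatTensor

/-! ### Joint smoothness in parameters and position. -/

section ParametricCalculus

variable {P F V : Type*} [NormedAddCommGroup P] [NormedSpace ℝ P] [NormedAddCommGroup F]
  [NormedSpace ℝ F] [NormedAddCommGroup V] [NormedSpace ℝ V]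

theorem contDiffAt_partial_fderiv {G : P → F → V} {p : P} {y : F}
    (h : ContDiffAt ℝ ∞ (fun z : P × F => G z.1 z.2) (p, y)) :
    ContDiffAt ℝ ∞ (fun z : P × F => fderiv ℝ (G z.1) z.2) (p, y) := by
  refine ContDiffAt.fderiv (n := ∞) (f := fun z : P × F => G z.1) (g := Prod.snd) ?_
    contDiffAt_snd (by simp)
  exact ContDiffAt.comp (g := fun z : P × F => G z.1 z.2) (f := fun z : (P × F) × F => (z.1.1, z.2))
    ((p, y), y) h (by fun_prop)

theorem contDiffAt_slice {G : P → F → V} {p : P} {y : F} {k : WithTop ℕ∞}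
    (h : ContDiffAt ℝ k (fun z : P × F => G z.1 z.2) (p, y)) : ContDiffAt ℝ k (G p) y :=
  ContDiffAt.comp (g := fun z : P × F => G z.1 z.2) (f := fun z : F => (p, z)) y h (by fun_prop)

/-- Smoothness of order ∞ at a point need not hold at nearby points, but any finite order does;
order one is all that the coordinate formulas need. -/
theorem eventually_contDiffAt_slice {G : P → F → V} {p : P} {y : F}
    (h : ContDiffAt ℝ ∞ (fun z : P × F => G z.1 z.2) (p, y)) :
    ∀ᶠ z : P × F in 𝓝 (p, y), ContDiffAt ℝ 1 (G z.1) z.2 := by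
  filter_upwards [(h.of_le (m := 1) (by norm_num)).eventually (by norm_num)] with z hz
  exact contDiffAt_slice hz

end ParametricCalculus

/-! ### Chart independence, smoothness and symmetry of Lie derivatives of tensor fields. -/

section Tensors

variable {m r t : ℕ} {X : Type*} [TopologicalSpace X] [ChartedSpace (E m) X]
  [IsManifold (𝓡 m) ∞ X]

theorem flatLie_congr {ξ ξ' : E m → E m} {T T' : E m → Tensor m r t} {y : E m}
    (hξ : ξ =ᶠ[𝓝 y] ξ') (hT : T =ᶠ[𝓝 y] T') : flatLie ξ T y = flatLie ξ' T' y := by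
  simp only [flatLie, hξ.fderiv_eq, hT.fderiv_eq, hξ.self_of_nhds, hT.self_of_nhds]

theorem lieTensor_apply (ξ : VF m X) (T : X → Tensor m r t) (x : X) :
    lieTensor ξ T x = flatLie (vecRep x ξ) (tensorRep x T) (extChartAt (𝓡 m) x x) := by
  rw [lieTensor, dChart_self, dChartSymm_self, Tensor.pull_id]

theorem dMap_symm (x : X) (y : E m) : dMap (extChartAt (𝓡 m) x).symm y = dChartSymm x y := rfl

/-- Derivative of the transition map from the chart around `z` to the chart around `x`. -/
theorem fderiv_transition {x z : X} {w : E m} (hw : w ∈ (extChartAt (𝓡 m) z).target)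
    (hx : (extChartAt (𝓡 m) z).symm w ∈ (extChartAt (𝓡 m) x).source) :
    fderiv ℝ (fun w => extChartAt (𝓡 m) x ((extChartAt (𝓡 m) z).symm w)) w
      = (dChart x ((extChartAt (𝓡 m) z).symm w)).comp (dChartSymm z w) := by
  rw [fderiv_extChartAt_comp ((contMDiffAt_extChartAt_symm hw).mdifferentiableAt (by norm_num)) hx,
    dMap_symm]

/-- `lieTensor` is evaluated at each point in that point's own chart. Naturality under the
transition map `g` from the chart around `z` to the chart around `x` shows that the chart around `x`
gives the same answer throughout its domain, so joint smoothness can be checked in one chart. -/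
theorem tensorRep_lieTensor {ξ : VF m X} {T : X → Tensor m r t} {x : X} {y : E m}
    (hy : y ∈ (extChartAt (𝓡 m) x).target) (hξ : ContDiffAt ℝ 1 (vecRep x ξ) y)
    (hT : ContDiffAt ℝ 1 (tensorRep x T) y) :
    tensorRep x (lieTensor ξ T) y = flatLie (vecRep x ξ) (tensorRep x T) y := by
  set z := (extChartAt (𝓡 m) x).symm y with hz
  set w := extChartAt (𝓡 m) z z with hw
  set g : E m → E m := fun w => extChartAt (𝓡 m) x ((extChartAt (𝓡 m) z).symm w) with hg
  set g' : E m → E m := fun y => extChartAt (𝓡 m) z ((extChartAt (𝓡 m) x).symm y) with hg'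
  have hzx : z ∈ (extChartAt (𝓡 m) x).source := (extChartAt (𝓡 m) x).map_target hy
  have hzz : z ∈ (extChartAt (𝓡 m) z).source := mem_extChartAt_source z
  have hwt : w ∈ (extChartAt (𝓡 m) z).target := (extChartAt (𝓡 m) z).map_source hzz
  have hwz : (extChartAt (𝓡 m) z).symm w = z := (extChartAt (𝓡 m) z).left_inv hzz
  have hyz : extChartAt (𝓡 m) x z = y := (extChartAt (𝓡 m) x).right_inv hy
  have hgw : g w = y := by rw [hg]; simp only [hwz, hyz]
  have hσ := contMDiffAt_extChartAt_symm hwt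
  have hgs : ContDiffAt ℝ ∞ g w := contDiffAt_extChartAt_comp hσ (by rwa [hwz])
  have hgs' : ContDiffAt ℝ ∞ g' y :=
    contDiffAt_extChartAt_comp (contMDiffAt_extChartAt_symm hy) hzz
  have hA' : ContDiffAt ℝ 1 (fun v => fderiv ℝ g' (g v)) w := by
    refine ContDiffAt.comp (g := fderiv ℝ g') w ?_ (hgs.of_le (by norm_num))
    rw [hgw]
    exact hgs'.fderiv_right (m := 1) two_le_infty
  have hev : ∀ᶠ v in 𝓝 w, v ∈ (extChartAt (𝓡 m) z).target ∧
      (extChartAt (𝓡 m) z).symm v ∈ (extChartAt (𝓡 m) x).source :=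
    (eventually_mem_target z).and (eventually_mem_source hσ.continuousAt (by rwa [hwz]))
  have key : ∀ v, v ∈ (extChartAt (𝓡 m) z).target →
      (extChartAt (𝓡 m) z).symm v ∈ (extChartAt (𝓡 m) x).source →
      fderiv ℝ g v = (dChart x ((extChartAt (𝓡 m) z).symm v)).comp (dChartSymm z v) ∧
      fderiv ℝ g' (g v)
        = (dChart z ((extChartAt (𝓡 m) z).symm v)).comp (dChartSymm x (g v)) ∧
      (dChartSymm x (g v)).comp (dChart x ((extChartAt (𝓡 m) z).symm v)) = .id ℝ (E m) ∧
      (dChart x ((extChartAt (𝓡 m) z).symm v)).comp (dChartSymm x (g v)) = .id ℝ (E m) := by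
    intro v h1 h2
    have h3 : (extChartAt (𝓡 m) x).symm (g v) = (extChartAt (𝓡 m) z).symm v :=
      (extChartAt (𝓡 m) x).left_inv h2
    have h4 : g v ∈ (extChartAt (𝓡 m) x).target := (extChartAt (𝓡 m) x).map_source h2
    have h5 := fderiv_transition (z := x) (x := z) h4
      (by rw [h3]; exact (extChartAt (𝓡 m) z).map_target h1)
    have h6 := dChartSymm_comp_dChart h4
    have h7 := dChart_comp_dChartSymm h4
    rw [h3] at h5 h6 h7
    exact ⟨fderiv_transition h1 h2, h5, h6, h7⟩
  have hvec : vecRep z ξ =ᶠ[𝓝 w] fun v => fderiv ℝ g' (g v) (vecRep x ξ (g v)) := by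
    filter_upwards [hev] with v hv
    obtain ⟨-, h2, h3, -⟩ := key v hv.1 hv.2
    have h4 : (extChartAt (𝓡 m) x).symm (g v) = (extChartAt (𝓡 m) z).symm v :=
      (extChartAt (𝓡 m) x).left_inv hv.2
    rw [h2, vecRep, vecRep, h4, ContinuousLinearMap.comp_apply]
    congr 1
    exact (DFunLike.congr_fun h3 _).symm
  have hten : tensorRep z T =ᶠ[𝓝 w]
      fun v => Tensor.pull (fderiv ℝ g v) (fderiv ℝ g' (g v)) (tensorRep x T (g v)) := by
    filter_upwards [hev] with v hv
    obtain ⟨h1, h2, h3, h3'⟩ := key v hv.1 hv.2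
    have h4 : (extChartAt (𝓡 m) x).symm (g v) = (extChartAt (𝓡 m) z).symm v :=
      (extChartAt (𝓡 m) x).left_inv hv.2
    rw [h1, h2, tensorRep, tensorRep, h4, Tensor.pull_pull, ← ContinuousLinearMap.comp_assoc, h3,
      ContinuousLinearMap.comp_assoc, h3, ContinuousLinearMap.id_comp, ContinuousLinearMap.comp_id]
  -- At the centre `w` of its own chart the derivatives of the chart around `z` are identities, so
  -- the Jacobians of both transition maps are derivatives of the chart around `x` and of its
  -- inverse.
  obtain ⟨k1, k2, k3, k4⟩ := key w hwt (by rwa [hwz])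
  rw [hwz, hw, dChartSymm_self, ContinuousLinearMap.comp_id, ← hw] at k1
  rw [hwz, dChart_self, ContinuousLinearMap.id_comp, hgw] at k2
  rw [hwz, hgw] at k3 k4
  have hTg : ContDiffAt ℝ 1 (fun v => tensorRep x T (g v)) w :=
    ContDiffAt.comp (G := Tensor m r t) (g := tensorRep x T) w (by rwa [hgw])
      (hgs.of_le (by norm_num))
  have hflat := flatLie_pull (T := tensorRep x T) (u := vecRep x ξ)
    (A' := fun v => fderiv ℝ g' (g v)) hgs
    (hA'.differentiableAt (by norm_num))
    (by
      filter_upwards [hev] with v hv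
      obtain ⟨h1, h2, h3, -⟩ := key v hv.1 hv.2
      rw [h1, h2, ContinuousLinearMap.comp_assoc, ← ContinuousLinearMap.comp_assoc _ _ (dChartSymm z v),
        h3, ContinuousLinearMap.id_comp]
      exact dChart_comp_dChartSymm hv.1)
    (by
      filter_upwards [hev] with v hv
      obtain ⟨h1, h2, -, h3⟩ := key v hv.1 hv.2
      rw [h1, h2, ContinuousLinearMap.comp_assoc, ← ContinuousLinearMap.comp_assoc _ _ (dChartSymm x (g v)),
        dChartSymm_comp_dChart hv.1, ContinuousLinearMap.id_comp]
      exact h3)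
    (by rw [hgw]; exact hξ.differentiableAt (by norm_num))
    (by rw [hgw]; exact hT.differentiableAt (by norm_num))
    ((contDiffAt_pull (hgs.fderiv_right (m := 1) two_le_infty) hA' hTg).differentiableAt
      (by norm_num))
  rw [tensorRep, ← hz, lieTensor_apply, ← hw, flatLie_congr hvec hten, hflat, Tensor.pull_pull,
    hgw, k1, k2, k4, Tensor.pull_id]

theorem contDiffAt_flatLie {P : Type*} [NormedAddCommGroup P] [NormedSpace ℝ P]
    {ξ : P → E m → E m} {T : P → E m → Tensor m r t} {p : P} {y : E m}
    (hξ : ContDiffAt ℝ ∞ (fun z : P × E m => ξ z.1 z.2) (p, y))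
    (hT : ContDiffAt ℝ ∞ (fun z : P × E m => T z.1 z.2) (p, y)) :
    ContDiffAt ℝ ∞ (fun z : P × E m => flatLie (ξ z.1) (T z.1) z.2) (p, y) := by
  have hξ' := contDiffAt_partial_fderiv hξ
  have hT' := contDiffAt_partial_fderiv hT
  have hup : ∀ {G : Type} [NormedAddCommGroup G] [NormedSpace ℝ G] {k : ℕ} (i : Fin k)
      (A : P × E m → G →L[ℝ] G), ContDiffAt ℝ ∞ A (p, y) → ∀ j,
      ContDiffAt ℝ ∞ (fun z => (Function.update (fun _ : Fin k => ContinuousLinearMap.id ℝ G) i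
        (A z) : Fin k → G →L[ℝ] G) j) (p, y) := by
    intro G _ _ k i A hA j
    rcases eq_or_ne j i with rfl | h
    · simpa using hA
    · simpa [h] using contDiffAt_const
  refine ((hT'.clm_apply hξ).add (ContDiffAt.sum fun i _ => ?_)).sub
    (ContDiffAt.sum fun j _ => ?_)
  · refine contDiffAt_clm_comp_multilinear ?_ hT
    exact contDiffAt_compContinuousLinearMapL fun k => hup i _ hξ' k
  · exact contDiffAt_multilinear_comp hT fun k => hup j _ (contDiffAt_precomp hξ') k

theorem SmoothTensorAt.lie {k : ℕ} {ξ : (Fin k → ℝ) → VF m X}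
    {T : (Fin k → ℝ) → X → Tensor m r t} {s : Fin k → ℝ} {x : X} (hξ : SmoothVFAt ξ s x)
    (hT : SmoothTensorAt T s x) : SmoothTensorAt (fun s' => lieTensor (ξ s') (T s')) s x := by
  refine (contDiffAt_flatLie (ξ := fun s => vecRep x (ξ s))
    (T := fun s => tensorRep x (T s)) hξ hT).congr_of_eventuallyEq ?_
  filter_upwards [eventually_contDiffAt_slice (G := fun s => vecRep x (ξ s)) hξ,
    eventually_contDiffAt_slice (G := fun s => tensorRep x (T s)) hT,
    continuousAt_snd.eventually (eventually_mem_target x)] with z h1 h2 h3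
  exact tensorRep_lieTensor h3 h1 h2

/-- `IsFamilyAt` demands symmetry at every parameter value, also where nothing is known to be
smooth. Hence no regularity is assumed: where the representative is not differentiable, its `fderiv`
is zero and symmetry of that term is trivial. -/
theorem IsSym.lieTensor {ξ : VF m X} {g : X → Tensor m 0 2} (hg : ∀ x, IsSym (g x)) (x : X) :
    IsSym (lieTensor ξ g x) := by
  have hs : ∀ y, IsSym (tensorRep x g y) := by
    intro y u v
    have h1 := hg ((extChartAt (𝓡 m) x).symm y) (dChartSymm x y u) (dChartSymm x y v)
    rw [tensorRep, Tensor.pull_apply, Tensor.pull_apply]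
    have h2 : ∀ a b : E m, (fun i => dChartSymm x y (![a, b] i))
        = ![dChartSymm x y a, dChartSymm x y b] := fun a b => by
      ext1 i; fin_cases i <;> rfl
    rwa [h2, h2, Subsingleton.elim (fun j => (![] j : E m →L[ℝ] ℝ).comp _) ![]]
  intro u v
  rw [lieTensor_apply, flatLie_apply, flatLie_apply]
  set y := extChartAt (𝓡 m) x x
  set S := tensorRep x g
  have h1 : ∀ w, fderiv ℝ S y w ![] ![u, v] = fderiv ℝ S y w ![] ![v, u] := by
    intro w
    by_cases hd : DifferentiableAt ℝ S y
    · have e : ∀ a b, fderiv ℝ S y w ![] ![a, b] = fderiv ℝ (fun z => S z ![] ![a, b]) y w := by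
        intro a b
        rw [((hd.hasFDerivAt.continuousMultilinear_apply_const
          ![]).continuousMultilinear_apply_const ![a, b]).fderiv]
        rfl
      rw [e, e]
      simp only [hs _ u v]
    · rw [fderiv_zero_of_not_differentiableAt hd]
      rfl
  rw [h1]
  simp only [Fin.sum_univ_two, Finset.univ_eq_empty, Finset.sum_empty, sub_zero]
  have u0 : ∀ a b c : E m, Function.update ![a, b] 0 c = ![c, b] := fun a b c => by
    ext1 i; fin_cases i <;> simp
  have u1 : ∀ a b c : E m, Function.update ![a, b] 1 c = ![a, c] := fun a b c => by
    ext1 i; fin_cases i <;> simp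
  rw [u0, u1, u0, u1, hs y _ v, hs y u]
  simp only [Matrix.cons_val_zero, Matrix.cons_val_one]
  ring

end Tensors

/-! ### Exchanging parameter derivatives with linear maps and spatial derivatives. -/

section ParametricDerivatives

variable {P F V W : Type*} [NormedAddCommGroup P] [NormedSpace ℝ P] [NormedAddCommGroup F]
  [NormedSpace ℝ F] [NormedAddCommGroup V] [NormedSpace ℝ V] [NormedAddCommGroup W]
  [NormedSpace ℝ W]

/-- With a left inverse, `f` is differentiable exactly when its image is; otherwise both sides take
the default value zero. So no differentiability hypothesis is needed. -/
theorem deriv_clm_comp_of_leftInverse {L : V →L[ℝ] W} {L' : W →L[ℝ] V}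
    (h : ∀ v, L' (L v) = v) (f : ℝ → V) (t : ℝ) :
    deriv (fun t => L (f t)) t = L (deriv f t) := by
  by_cases hf : DifferentiableAt ℝ f t
  · exact (L.hasFDerivAt.comp_hasDerivAt t hf.hasDerivAt).deriv
  · have hLf : ¬ DifferentiableAt ℝ (fun t => L (f t)) t := by
      intro h1
      have h2 := L'.differentiableAt.comp t h1
      exact hf (by simpa [Function.comp_def, h] using h2)
    rw [deriv_zero_of_not_differentiableAt hf, deriv_zero_of_not_differentiableAt hLf, map_zero]

theorem contDiffAt_deriv_param {H : P → ℝ → V} {p : P} {t : ℝ}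
    (h : ContDiffAt ℝ ∞ (fun z : P × ℝ => H z.1 z.2) (p, t)) :
    ContDiffAt ℝ ∞ (fun p => deriv (H p) t) p := by
  have h1 := contDiffAt_partial_fderiv h
  have h2 : ContDiffAt ℝ ∞ (fun p => fderiv ℝ (H p) t) p :=
    ContDiffAt.comp (g := fun z : P × ℝ => fderiv ℝ (H z.1) z.2) (f := fun p => (p, t)) p h1
      (by fun_prop)
  exact h2.clm_apply contDiffAt_const

/-- Derivatives in a parameter and in a spatial variable commute. -/
theorem hasDerivAt_fderiv_param {G : ℝ → F → V} {y : F}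
    (h : ContDiffAt ℝ ∞ (fun z : ℝ × F => G z.1 z.2) (0, y)) :
    HasDerivAt (fun t => fderiv ℝ (G t) y) (fderiv ℝ (fun y => deriv (fun t => G t y) 0) y) 0 := by
  set f : ℝ × F → V := fun z => G z.1 z.2 with hf
  have h1 : ∀ᶠ z in 𝓝 ((0 : ℝ), y), DifferentiableAt ℝ f z := by
    filter_upwards [(h.of_le (m := 1) (by norm_num)).eventually (by norm_num)] with z hz
    exact hz.differentiableAt (by norm_num)
  have hd : DifferentiableAt ℝ (fderiv ℝ f) (0, y) :=
    (h.fderiv_right (m := 1) two_le_infty).differentiableAt (by norm_num)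
  have hsymm := h.isSymmSndFDerivAt
    (by rw [minSmoothness_of_isRCLikeNormedField]; exact two_le_infty)
  have hy : ∀ y', HasFDerivAt (fun y : F => ((0 : ℝ), y)) (ContinuousLinearMap.inr ℝ ℝ F) y' :=
    fun y' => (hasFDerivAt_prodMk_right (0 : ℝ) y')
  have ht : ∀ t : ℝ, HasFDerivAt (fun t : ℝ => (t, y)) (ContinuousLinearMap.inl ℝ ℝ F) t :=
    fun t => (hasFDerivAt_prodMk_left t y)
  -- Both sides become second derivatives of the joint function `f`, in the directions `(1, 0)` and
  -- `(0, v)`, taken in the two orders.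
  have e1 : (fun y' => deriv (fun t => G t y') 0) =ᶠ[𝓝 y] fun y' => fderiv ℝ f (0, y') (1, 0) := by
    have hc : ContinuousAt (fun y : F => ((0 : ℝ), y)) y := by fun_prop
    filter_upwards [hc.eventually h1] with y' hy'
    exact (hy'.hasFDerivAt.comp_hasDerivAt (0 : ℝ)
      (((hasDerivAt_id (0 : ℝ)).prodMk (hasDerivAt_const (0 : ℝ) y')))).deriv
  have e2 : (fun t => fderiv ℝ (G t) y) =ᶠ[𝓝 0]
      fun t => (fderiv ℝ f (t, y)).comp (ContinuousLinearMap.inr ℝ ℝ F) := by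
    have hc : ContinuousAt (fun t : ℝ => (t, y)) 0 := by fun_prop
    filter_upwards [hc.eventually h1] with t ht'
    exact (ht'.hasFDerivAt.comp y (hasFDerivAt_prodMk_right t y)).fderiv
  refine HasDerivAt.congr_of_eventuallyEq ?_ e2
  have h3 : HasDerivAt (fun t : ℝ => fderiv ℝ f (t, y)) (fderiv ℝ (fderiv ℝ f) (0, y) (1, 0)) 0 :=
    hd.hasFDerivAt.comp_hasDerivAt (0 : ℝ) (((hasDerivAt_id (0 : ℝ)).prodMk (hasDerivAt_const _ y)))
  have h4 := h3.clm_comp (hasDerivAt_const (0 : ℝ) (ContinuousLinearMap.inr ℝ ℝ F))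
  refine h4.congr_deriv ?_
  rw [e1.fderiv_eq]
  have h5 := (hd.hasFDerivAt.comp y (hy y)).clm_apply (hasFDerivAt_const ((1 : ℝ), (0 : F)) y)
  have h6 := h5.fderiv
  simp only [Function.comp_def] at h6
  rw [h6]
  ext v
  simpa using (hsymm (0, v) (1, 0)).symm

/-- Coordinate 0 of a family with `k + 1` parameters is reserved for the variable of
differentiation; the others are carried along. -/
theorem contDiff_finCons {k : ℕ} :
    ContDiff ℝ ∞ (fun z : ℝ × (Fin k → ℝ) => (Fin.cons z.1 z.2 : Fin (k + 1) → ℝ)) := by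
  rw [contDiff_pi]
  intro i
  refine Fin.cases ?_ (fun j => ?_) i
  · simpa using contDiff_fst
  · simp only [Fin.cons_succ]
    exact (contDiff_apply ℝ ℝ j).comp contDiff_snd

theorem contDiffAt_alternatize {q : ℕ} {k : WithTop ℕ∞} {A : P → F →L[ℝ] F [⋀^Fin q]→L[ℝ] ℝ}
    {p : P} (hA : ContDiffAt ℝ k A p) :
    ContDiffAt ℝ k (fun p => ContinuousAlternatingMap.alternatizeUncurryFin (A p)) p := by
  exact (ContinuousAlternatingMap.alternatizeUncurryFinCLM ℝ F
    ℝ).isBoundedLinearMap.contDiff.contDiffAt.comp p hA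

theorem contDiffAt_curryLeft {q : ℕ} {k : WithTop ℕ∞} {A : P → F [⋀^Fin (q + 1)]→L[ℝ] ℝ}
    {p : P} (hA : ContDiffAt ℝ k A p) :
    ContDiffAt ℝ k (fun p => (A p).curryLeft) p := by
  have h : ContDiff ℝ k (fun η : F [⋀^Fin (q + 1)]→L[ℝ] ℝ => η.curryLeft) := by
    refine IsBoundedLinearMap.contDiff ⟨⟨fun _ _ => rfl, fun _ _ => rfl⟩, 1, one_pos, fun η => ?_⟩
    rw [one_mul, ContinuousAlternatingMap.norm_curryLeft]
  exact h.contDiffAt.comp p hA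

end ParametricDerivatives

/-! ### Smooth families of forms and the operations d, i_ξ and £_ξ. -/

section SmoothFamilies

variable {m k q : ℕ} {X : Type*} [TopologicalSpace X] [ChartedSpace (E m) X]

theorem Form.neg_eq (η : Form m q X) : -η = (-1 : ℝ) • η := by
  ext x v
  exact (neg_one_mul (η x v)).symm

theorem formRep_add (x : X) (η ζ : Form m q X) : formRep x (η + ζ) = formRep x η + formRep x ζ :=
  rfl

theorem formRep_smul (x : X) (c : ℝ) (η : Form m q X) : formRep x (c • η) = c • formRep x η := rfl

theorem SmoothFormAt.add {F G : (Fin k → ℝ) → Form m q X} {s : Fin k → ℝ} {x : X}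
    (hF : SmoothFormAt F s x) (hG : SmoothFormAt G s x) :
    SmoothFormAt (fun s => F s + G s) s x :=
  ContDiffAt.add hF hG

theorem SmoothFormAt.const_smul {F : (Fin k → ℝ) → Form m q X} {s : Fin k → ℝ} {x : X} (c : ℝ)
    (hF : SmoothFormAt F s x) : SmoothFormAt (fun s => c • F s) s x :=
  ContDiffAt.const_smul c hF

theorem SmoothFormAt.zero {s : Fin k → ℝ} {x : X} :
    SmoothFormAt (fun _ => (0 : Form m q X)) s x :=
  contDiffAt_const (c := 0)

theorem SmoothFormAt.sum {ι : Type*} (t : Finset ι) {F : ι → (Fin k → ℝ) → Form m q X}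
    {s : Fin k → ℝ} {x : X} (hF : ∀ i ∈ t, SmoothFormAt (F i) s x) :
    SmoothFormAt (fun s => ∑ i ∈ t, F i s) s x := by
  classical
  induction t using Finset.induction_on with
  | empty => simpa using SmoothFormAt.zero
  | insert a t ha ih =>
    simp only [Finset.sum_insert ha]
    exact (hF a (Finset.mem_insert_self a t)).add
      (ih fun i hi => hF i (Finset.mem_insert_of_mem hi))

theorem SmoothFormAt.smoothForm {F : (Fin k → ℝ) → Form m q X} {s : Fin k → ℝ}
    (hF : ∀ x, SmoothFormAt F s x) : SmoothForm (F s) := fun x =>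
  contDiffAt_slice (G := fun s => formRep x (F s)) (hF x)

theorem SmoothForm.smoothFormAt {η : Form m q X} (h : SmoothForm η) (s : Fin k → ℝ) (x : X) :
    SmoothFormAt (fun _ => η) s x :=
  ContDiffAt.comp (g := formRep x η) (f := fun p : (Fin k → ℝ) × E m => p.2)
    (s, extChartAt (𝓡 m) x x) (h x) contDiffAt_snd

theorem SmoothVFAt.smoothVF {F : (Fin k → ℝ) → VF m X} {s : Fin k → ℝ}
    (hF : ∀ x, SmoothVFAt F s x) : SmoothVF (F s) := fun x =>
  contDiffAt_slice (G := fun s => vecRep x (F s)) (hF x)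

theorem SmoothVF.smoothVFAt {η : VF m X} (h : SmoothVF η) (s : Fin k → ℝ) (x : X) :
    SmoothVFAt (fun _ => η) s x :=
  ContDiffAt.comp (g := vecRep x η) (f := fun p : (Fin k → ℝ) × E m => p.2)
    (s, extChartAt (𝓡 m) x x) (h x) contDiffAt_snd

theorem SmoothTensor.smoothTensorAt {r t : ℕ} {η : X → Tensor m r t} (h : SmoothTensor η)
    (s : Fin k → ℝ) (x : X) : SmoothTensorAt (fun _ => η) s x :=
  ContDiffAt.comp (G := Tensor m r t) (g := tensorRep x η) (f := fun p : (Fin k → ℝ) × E m => p.2)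
    (s, extChartAt (𝓡 m) x x) (h x) contDiffAt_snd

theorem SmoothTensorAt.smoothTensor {r t : ℕ} {F : (Fin k → ℝ) → X → Tensor m r t}
    {s : Fin k → ℝ} (hF : ∀ x, SmoothTensorAt F s x) : SmoothTensor (F s) := fun x =>
  contDiffAt_slice (G := fun s => tensorRep x (F s)) (hF x)

theorem tensorRep_add {r t : ℕ} (x : X) (T S : X → Tensor m r t) (y : E m) :
    tensorRep x (T + S) y = tensorRep x T y + tensorRep x S y :=
  Tensor.ext_apply fun _ _ => rfl

theorem tensorRep_smul {r t : ℕ} (x : X) (c : ℝ) (T : X → Tensor m r t) (y : E m) :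
    tensorRep x (c • T) y = c • tensorRep x T y :=
  Tensor.ext_apply fun _ _ => rfl

theorem SmoothTensorAt.add {r t : ℕ} {F G : (Fin k → ℝ) → X → Tensor m r t} {s : Fin k → ℝ}
    {x : X} (hF : SmoothTensorAt F s x) (hG : SmoothTensorAt G s x) :
    SmoothTensorAt (fun s => F s + G s) s x := by
  refine (ContDiffAt.add hF hG).congr_of_eventuallyEq (Filter.Eventually.of_forall fun z => ?_)
  exact tensorRep_add x _ _ _

theorem SmoothTensorAt.smul {r t : ℕ} {F : (Fin k → ℝ) → X → Tensor m r t} {s : Fin k → ℝ}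
    {x : X} {c : (Fin k → ℝ) → ℝ} (hc : ContDiffAt ℝ ∞ c s) (hF : SmoothTensorAt F s x) :
    SmoothTensorAt (fun s => c s • F s) s x := by
  have h1 : ContDiffAt ℝ ∞ (fun p : (Fin k → ℝ) × E m => c p.1) (s, extChartAt (𝓡 m) x x) :=
    ContDiffAt.comp (s, extChartAt (𝓡 m) x x) hc contDiffAt_fst
  refine (ContDiffAt.smul h1 hF).congr_of_eventuallyEq (Filter.Eventually.of_forall fun z => ?_)
  exact tensorRep_smul x _ _ _

theorem SmoothTensorAt.comp {l r t : ℕ} {F : (Fin k → ℝ) → X → Tensor m r t}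
    {c : (Fin l → ℝ) → Fin k → ℝ} {s : Fin l → ℝ} {x : X} (hF : SmoothTensorAt F (c s) x)
    (hc : ContDiffAt ℝ ∞ c s) : SmoothTensorAt (fun s => F (c s)) s x :=
  ContDiffAt.comp (G := Tensor m r t)
    (g := fun p : (Fin k → ℝ) × E m => tensorRep x (F p.1) p.2)
    (f := fun p : (Fin l → ℝ) × E m => (c p.1, p.2)) (s, extChartAt (𝓡 m) x x) hF
    ((ContDiffAt.comp (s, extChartAt (𝓡 m) x x) hc contDiffAt_fst).prodMk contDiffAt_snd)

variable [IsManifold (𝓡 m) ∞ X]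

theorem formRep_self (x : X) (η : Form m q X) : formRep x η (extChartAt (𝓡 m) x x) = η x := by
  rw [formRep, dChartSymm_self, extChartAt_to_inv]
  rfl

/-- On the chart domain, passing to the chart is an invertible linear map at each point, so this
holds without differentiability. -/
theorem formRep_deriv {F : ℝ → Form m q X} {x : X} {y : E m}
    (hy : y ∈ (extChartAt (𝓡 m) x).target) (t : ℝ) :
    formRep x (fun z => deriv (fun t => F t z) t) y = deriv (fun t => formRep x (F t) y) t := by
  symm
  refine deriv_clm_comp_of_leftInverse (V := E m [⋀^Fin q]→L[ℝ] ℝ) (W := E m [⋀^Fin q]→L[ℝ] ℝ)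
    (L := ContinuousAlternatingMap.compContinuousLinearMapCLM (dChartSymm x y))
    (L' := ContinuousAlternatingMap.compContinuousLinearMapCLM
      (dChart x ((extChartAt (𝓡 m) x).symm y))) (fun η => ?_) _ t
  have h := dChartSymm_comp_dChart hy
  ext v
  exact congrArg η (funext fun i => DFunLike.congr_fun h (v i))

theorem vecRep_deriv {F : ℝ → VF m X} {x : X} {y : E m}
    (hy : y ∈ (extChartAt (𝓡 m) x).target) (t : ℝ) :
    vecRep x (fun z => deriv (fun t => F t z) t) y = deriv (fun t => vecRep x (F t) y) t := by
  symm
  exact deriv_clm_comp_of_leftInverse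
    (L := dChart x ((extChartAt (𝓡 m) x).symm y)) (L' := dChartSymm x y)
    (fun v => DFunLike.congr_fun (dChartSymm_comp_dChart hy) v) _ t

theorem contDiffAt_deriv_finCons {V : Type*} [NormedAddCommGroup V] [NormedSpace ℝ V]
    {H : (Fin (k + 1) → ℝ) → E m → V} {s : Fin k → ℝ} {y : E m}
    (h : ContDiffAt ℝ ∞ (fun p : (Fin (k + 1) → ℝ) × E m => H p.1 p.2) (Fin.cons 0 s, y)) :
    ContDiffAt ℝ ∞ (fun p : (Fin k → ℝ) × E m => deriv (fun t => H (Fin.cons t p.1) p.2) 0)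
      (s, y) := by
  refine contDiffAt_deriv_param
    (H := fun (p : (Fin k → ℝ) × E m) t => H (Fin.cons t p.1) p.2) ?_
  refine ContDiffAt.comp (g := fun p : (Fin (k + 1) → ℝ) × E m => H p.1 p.2)
    (f := fun z : ((Fin k → ℝ) × E m) × ℝ => ((Fin.cons z.2 z.1.1 : Fin (k + 1) → ℝ), z.1.2))
    ((s, y), 0) h ?_
  refine ContDiffAt.prodMk ?_ (by fun_prop)
  exact contDiff_finCons.contDiffAt.comp ((s, y), (0 : ℝ))
    (f := fun z : ((Fin k → ℝ) × E m) × ℝ => (z.2, z.1.1)) (by fun_prop)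

theorem SmoothFormAt.deriv {F : (Fin (k + 1) → ℝ) → Form m q X} {s : Fin k → ℝ} {x : X}
    (hF : SmoothFormAt F (Fin.cons 0 s) x) :
    SmoothFormAt (fun s z => deriv (fun t => F (Fin.cons t s) z) 0) s x := by
  refine (contDiffAt_deriv_finCons (H := fun s => formRep x (F s)) hF).congr_of_eventuallyEq ?_
  filter_upwards [continuousAt_snd.eventually (eventually_mem_target x)] with z hz
  exact formRep_deriv hz 0

theorem SmoothVFAt.deriv {F : (Fin (k + 1) → ℝ) → VF m X} {s : Fin k → ℝ} {x : X}
    (hF : SmoothVFAt F (Fin.cons 0 s) x) :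
    SmoothVFAt (fun s z => deriv (fun t => F (Fin.cons t s) z) 0) s x := by
  refine (contDiffAt_deriv_finCons (H := fun s => vecRep x (F s)) hF).congr_of_eventuallyEq ?_
  filter_upwards [continuousAt_snd.eventually (eventually_mem_target x)] with z hz
  exact vecRep_deriv hz 0

theorem contDiffAt_finCons_slice {V : Type*} [NormedAddCommGroup V] [NormedSpace ℝ V]
    {H : (Fin (k + 1) → ℝ) → E m → V} {s : Fin k → ℝ} {y : E m}
    (h : ContDiffAt ℝ ∞ (fun p : (Fin (k + 1) → ℝ) × E m => H p.1 p.2) (Fin.cons 0 s, y)) :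
    ContDiffAt ℝ ∞ (fun z : ℝ × E m => H (Fin.cons z.1 s) z.2) (0, y) := by
  refine ContDiffAt.comp (g := fun p : (Fin (k + 1) → ℝ) × E m => H p.1 p.2)
    (f := fun z : ℝ × E m => ((Fin.cons z.1 s : Fin (k + 1) → ℝ), z.2)) (0, y) h ?_
  refine ContDiffAt.prodMk ?_ (by fun_prop)
  exact contDiff_finCons.contDiffAt.comp ((0 : ℝ), y)
    (f := fun z : ℝ × E m => (z.1, s)) (by fun_prop)

theorem SmoothFormAt.contDiffAt {F : (Fin k → ℝ) → Form m q X} {s : Fin k → ℝ} {x : X}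
    (hF : SmoothFormAt F s x) : ContDiffAt ℝ ∞ (fun s => F s x) s := by
  have h1 : ContDiffAt ℝ ∞ (fun s : Fin k → ℝ => formRep x (F s) (extChartAt (𝓡 m) x x)) s :=
    ContDiffAt.comp (g := fun z : (Fin k → ℝ) × E m => formRep x (F z.1) z.2)
      (f := fun s : Fin k → ℝ => (s, extChartAt (𝓡 m) x x)) s hF (by fun_prop)
  simpa only [formRep_self] using h1

theorem extDeriv_eq {F : Type*} [NormedAddCommGroup F] [NormedSpace ℝ F]
    (η : F → F [⋀^Fin q]→L[ℝ] ℝ) (y : F) :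
    extDeriv η y = ContinuousAlternatingMap.alternatizeUncurryFinCLM ℝ F ℝ (fderiv ℝ η y) := rfl

/-- The source of δd = dδ: in a chart, d is a fixed linear map applied to the spatial derivative,
and this commutes with the parameter derivative. -/
theorem SmoothFormAt.hasDerivAt_dForm {F : (Fin (k + 1) → ℝ) → Form m q X} {s : Fin k → ℝ} {x : X}
    (hF : SmoothFormAt F (Fin.cons 0 s) x) :
    HasDerivAt (fun t => CovPhase.dForm (F (Fin.cons t s)) x)
      (CovPhase.dForm (fun z => _root_.deriv (fun t => F (Fin.cons t s) z) 0) x) 0 := by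
  have h := contDiffAt_finCons_slice (H := fun s => formRep x (F s)) hF
  have h1 := hasDerivAt_fderiv_param (G := fun t => formRep x (F (Fin.cons t s))) h
  simp only [dForm_apply, extDeriv_eq]
  have h2 : formRep x (fun z => _root_.deriv (fun t => F (Fin.cons t s) z) 0)
      =ᶠ[𝓝 (extChartAt (𝓡 m) x x)]
        fun y => _root_.deriv (fun t => formRep x (F (Fin.cons t s)) y) 0 := by
    filter_upwards [eventually_mem_target x] with y hy
    exact formRep_deriv hy 0
  rw [h2.fderiv_eq]
  exact (ContinuousAlternatingMap.alternatizeUncurryFinCLM ℝ (E m) ℝ).hasFDerivAt.comp_hasDerivAt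
    0 h1

theorem SmoothFormAt.dForm {F : (Fin k → ℝ) → Form m q X} {s : Fin k → ℝ} {x : X}
    (hF : SmoothFormAt F s x) : SmoothFormAt (fun s => CovPhase.dForm (F s)) s x := by
  have h1 := contDiffAt_partial_fderiv (G := fun s => formRep x (F s)) hF
  refine (contDiffAt_alternatize h1).congr_of_eventuallyEq ?_
  filter_upwards [continuousAt_snd.eventually (eventually_mem_target x),
    eventually_contDiffAt_slice (G := fun s => formRep x (F s)) hF] with z hz hd
  exact formRep_dForm hz (hd.differentiableAt (by norm_num))

theorem formRep_iForm {ξ : VF m X} {η : Form m (q + 1) X} {x : X} {y : E m}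
    (hy : y ∈ (extChartAt (𝓡 m) x).target) :
    formRep x (iForm ξ η) y = (formRep x η y).curryLeft (vecRep x ξ y) := by
  ext v
  simp only [formRep, iForm, vecRep, ContinuousAlternatingMap.compContinuousLinearMap_apply,
    ContinuousAlternatingMap.curryLeft_apply_apply]
  congr 1
  ext1 i
  refine Fin.cases ?_ (fun j => ?_) i
  · exact (DFunLike.congr_fun (dChartSymm_comp_dChart hy) _).symm
  · rfl

theorem SmoothFormAt.iForm {F : (Fin k → ℝ) → Form m (q + 1) X} {ξ : (Fin k → ℝ) → VF m X}
    {s : Fin k → ℝ} {x : X} (hξ : SmoothVFAt ξ s x) (hF : SmoothFormAt F s x) :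
    SmoothFormAt (fun s => CovPhase.iForm (ξ s) (F s)) s x := by
  refine ((contDiffAt_curryLeft hF).clm_apply hξ).congr_of_eventuallyEq ?_
  filter_upwards [continuousAt_snd.eventually (eventually_mem_target x)] with z hz
  exact formRep_iForm hz

theorem SmoothFormAt.lieForm {F : (Fin k → ℝ) → Form m q X} {ξ : (Fin k → ℝ) → VF m X}
    {s : Fin k → ℝ} {x : X} (hξ : SmoothVFAt ξ s x) (hF : SmoothFormAt F s x) :
    SmoothFormAt (fun s => CovPhase.lieForm (ξ s) (F s)) s x := by
  cases q with
  | zero => exact hF.dForm.iForm hξ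
  | succ q => exact (hF.dForm.iForm hξ).add (hF.iForm hξ).dForm

theorem SmoothForm.add {η ζ : Form m q X} (h : SmoothForm η) (h' : SmoothForm ζ) :
    SmoothForm (η + ζ) := fun x => (h x).add (h' x)

theorem SmoothForm.const_smul {η : Form m q X} (c : ℝ) (h : SmoothForm η) :
    SmoothForm (c • η) := fun x => (h x).const_smul c

/-- A single form is a family with no parameters, so statements about families specialise to it. The
same device is used below for fields and field-space forms. -/
theorem SmoothForm.dForm {η : Form m q X} (h : SmoothForm η) : SmoothForm (dForm η) :=
  SmoothFormAt.smoothForm (s := (0 : Fin 0 → ℝ)) fun x => (h.smoothFormAt 0 x).dForm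

theorem SmoothForm.iForm {η : Form m (q + 1) X} {ξ : VF m X} (hξ : SmoothVF ξ)
    (h : SmoothForm η) : SmoothForm (iForm ξ η) :=
  SmoothFormAt.smoothForm (s := (0 : Fin 0 → ℝ)) fun x =>
    (h.smoothFormAt 0 x).iForm (hξ.smoothVFAt 0 x)

theorem SmoothForm.lieForm {η : Form m q X} {ξ : VF m X} (hξ : SmoothVF ξ)
    (h : SmoothForm η) : SmoothForm (lieForm ξ η) :=
  SmoothFormAt.smoothForm (s := (0 : Fin 0 → ℝ)) fun x =>
    (h.smoothFormAt 0 x).lieForm (hξ.smoothVFAt 0 x)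

theorem SmoothForm.differentiableAt {η : Form m q X} (h : SmoothForm η) (x : X) :
    DifferentiableAt ℝ (formRep x η) (extChartAt (𝓡 m) x x) :=
  (h x).differentiableAt (by norm_num)

theorem dForm_add {η ζ : Form m q X} (h : SmoothForm η) (h' : SmoothForm ζ) :
    dForm (η + ζ) = dForm η + dForm ζ := by
  ext1 x
  rw [Pi.add_apply, dForm_apply, dForm_apply, dForm_apply, formRep_add,
    extDeriv_add (h.differentiableAt x) (h'.differentiableAt x)]

theorem dForm_smul (c : ℝ) (η : Form m q X) : dForm (c • η) = c • dForm η := by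
  ext1 x
  rw [Pi.smul_apply, dForm_apply, dForm_apply, formRep_smul, extDeriv_smul]

theorem dForm_neg (η : Form m q X) : dForm (-η) = - dForm η := by
  rw [Form.neg_eq η, Form.neg_eq, dForm_smul]

theorem dForm_sub {η ζ : Form m q X} (h : SmoothForm η) (h' : SmoothForm ζ) :
    dForm (η - ζ) = dForm η - dForm ζ := by
  have h'' : SmoothForm (-ζ) := by rw [Form.neg_eq]; exact h'.const_smul (-1)
  rw [sub_eq_add_neg, dForm_add h h'', dForm_neg, ← sub_eq_add_neg]

theorem dForm_zero : dForm (0 : Form m q X) = 0 := by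
  simpa using dForm_smul 0 (0 : Form m q X)

theorem dForm_dForm {η : Form m q X} (h : SmoothForm η) : dForm (dForm η) = 0 := by
  ext1 x
  rw [dForm_apply]
  have h1 : formRep x (dForm η) =ᶠ[𝓝 (extChartAt (𝓡 m) x x)] extDeriv (formRep x η) := by
    filter_upwards [eventually_mem_target x,
      ((h x).of_le (m := 1) (by norm_num)).eventually (by norm_num)] with y hy hd
    exact formRep_dForm hy (hd.differentiableAt (by norm_num))
  rw [h1.extDeriv_eq]
  exact extDeriv_extDeriv_apply (h x)
    (by rw [minSmoothness_of_isRCLikeNormedField]; exact two_le_infty)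

theorem iForm_zero (ξ : VF m X) : iForm ξ (0 : Form m (q + 1) X) = 0 := rfl

theorem iForm_add (ξ : VF m X) (η ζ : Form m (q + 1) X) :
    iForm ξ (η + ζ) = iForm ξ η + iForm ξ ζ := rfl

theorem lieForm_add {ξ : VF m X} (hξ : SmoothVF ξ) {η ζ : Form m q X} (h : SmoothForm η)
    (h' : SmoothForm ζ) : lieForm ξ (η + ζ) = lieForm ξ η + lieForm ξ ζ := by
  cases q with
  | zero => simp only [lieForm, dForm_add h h', iForm_add]
  | succ q =>
    simp only [lieForm, dForm_add h h', iForm_add, dForm_add (h.iForm hξ) (h'.iForm hξ)]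
    abel

theorem lieForm_dForm {ξ : VF m X} (hξ : SmoothVF ξ) {η : Form m q X} (h : SmoothForm η) :
    lieForm ξ (dForm η) = dForm (lieForm ξ η) := by
  cases q with
  | zero => simp only [lieForm, dForm_dForm h, iForm_zero, zero_add]
  | succ q =>
    simp only [lieForm, dForm_dForm h, iForm_zero, zero_add,
      dForm_add (h.dForm.iForm hξ) (h.iForm hξ).dForm, dForm_dForm (h.iForm hξ), add_zero]

end SmoothFamilies

theorem hasDerivAt_clm_comp {V W : Type*} [NormedAddCommGroup V] [NormedSpace ℝ V]
    [NormedAddCommGroup W] [NormedSpace ℝ W] (L : V →L[ℝ] W) {f : ℝ → V} {f' : V} {t : ℝ}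
    (hf : HasDerivAt f f' t) : HasDerivAt (fun t => L (f t)) (L f') t :=
  L.hasFDerivAt.comp_hasDerivAt t hf

/-! ### Pull-back along a smooth map. -/

section PullBack

variable {m m' k q : ℕ} {X Y : Type*} [TopologicalSpace X] [ChartedSpace (E m) X]
  [IsManifold (𝓡 m) ∞ X] [TopologicalSpace Y] [ChartedSpace (E m') Y] [IsManifold (𝓡 m') ∞ Y]
  {f : X → Y}

theorem contMDiffAt_comp_symm (hf : ContMDiff (𝓡 m) (𝓡 m') ∞ f) {x : X} {y : E m}
    (hy : y ∈ (extChartAt (𝓡 m) x).target) :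
    ContMDiffAt 𝓘(ℝ, E m) (𝓡 m') ∞ (fun y => f ((extChartAt (𝓡 m) x).symm y)) y :=
  hf.contMDiffAt.comp y (contMDiffAt_extChartAt_symm hy)

theorem formRep_pullForm (hf : ContMDiff (𝓡 m) (𝓡 m') ∞ f) (η : Form m' q Y) {x : X} {y : E m}
    (hy : y ∈ (extChartAt (𝓡 m) x).target) :
    formRep x (pullForm f η) y = pullFlat (fun y => f ((extChartAt (𝓡 m) x).symm y)) η y := by
  have h : dMap (fun y => f ((extChartAt (𝓡 m) x).symm y)) y
      = (mfderiv (𝓡 m) (𝓡 m') f ((extChartAt (𝓡 m) x).symm y) : E m →L[ℝ] E m').comp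
        (dChartSymm x y) :=
    mfderiv_comp y (hf.mdifferentiable (by norm_num) _)
      ((contMDiffAt_extChartAt_symm hy).mdifferentiableAt (by norm_num))
  rw [pullFlat, h]
  rfl

theorem SmoothFormAt.pullForm (hf : ContMDiff (𝓡 m) (𝓡 m') ∞ f)
    {F : (Fin k → ℝ) → Form m' q Y} {s : Fin k → ℝ} {x : X} (hF : SmoothFormAt F s (f x)) :
    SmoothFormAt (fun s => CovPhase.pullForm (m := m) f (F s)) s x := by
  set g : E m → E m' := fun y => extChartAt (𝓡 m') (f x) (f ((extChartAt (𝓡 m) x).symm y)) with hg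
  set y₀ := extChartAt (𝓡 m) x x with hy₀
  have ht : y₀ ∈ (extChartAt (𝓡 m) x).target := mem_extChartAt_target x
  have hx : (extChartAt (𝓡 m) x).symm y₀ = x := extChartAt_to_inv x
  have hc := contMDiffAt_comp_symm hf ht
  have hs : f ((extChartAt (𝓡 m) x).symm y₀) ∈ (extChartAt (𝓡 m') (f x)).source := by
    rw [hx]; exact mem_extChartAt_source (f x)
  have hgs : ContDiffAt ℝ ∞ g y₀ := contDiffAt_extChartAt_comp hc hs
  have hgy : g y₀ = extChartAt (𝓡 m') (f x) (f x) := by rw [hg]; simp only [hx]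
  have h1 : ContDiffAt ℝ ∞ (fun p : (Fin k → ℝ) × E m => formRep (f x) (F p.1) (g p.2))
      (s, y₀) := by
    refine ContDiffAt.comp (g := fun p : (Fin k → ℝ) × E m' => formRep (f x) (F p.1) p.2)
      (f := fun p : (Fin k → ℝ) × E m => (p.1, g p.2)) (s, y₀) ?_
      (contDiffAt_fst.prodMk
        (ContDiffAt.comp (g := g) (f := Prod.snd) (s, y₀) hgs contDiffAt_snd))
    simp only [hgy]
    exact hF
  have h2 : ContDiffAt ℝ ∞ (fun p : (Fin k → ℝ) × E m => fderiv ℝ g p.2) (s, y₀) :=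
    ContDiffAt.comp (g := fderiv ℝ g) (s, y₀) (hgs.fderiv_right (m := ∞) (by simp)) contDiffAt_snd
  -- In the charts around `x` and `f x`, the pull-back is evaluation along the coordinate expression
  -- `g` of `f` followed by composition with its Jacobian.
  refine (contDiffAt_alternating_comp h1 h2).congr_of_eventuallyEq ?_
  have he : ∀ᶠ y in 𝓝 y₀, y ∈ (extChartAt (𝓡 m) x).target ∧
      MDifferentiableAt 𝓘(ℝ, E m) (𝓡 m') (fun y => f ((extChartAt (𝓡 m) x).symm y)) y ∧
      f ((extChartAt (𝓡 m) x).symm y) ∈ (extChartAt (𝓡 m') (f x)).source :=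
    (eventually_mem_target x).and ((eventually_mdifferentiableAt hc).and
      (eventually_mem_source hc.continuousAt hs))
  filter_upwards [continuousAt_snd.eventually he] with z hz
  rw [formRep_pullForm hf _ hz.1, pullFlat_eq _ hz.2.1 hz.2.2]

theorem SmoothForm.pullForm (hf : ContMDiff (𝓡 m) (𝓡 m') ∞ f) {η : Form m' q Y}
    (h : SmoothForm η) : SmoothForm (CovPhase.pullForm (m := m) f η) :=
  SmoothFormAt.smoothForm (s := (0 : Fin 0 → ℝ)) fun x => (h.smoothFormAt 0 (f x)).pullForm hf

theorem dForm_pullForm (hf : ContMDiff (𝓡 m) (𝓡 m') ∞ f) {η : Form m' q Y} (h : SmoothForm η) :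
    dForm (pullForm (m := m) f η) = pullForm f (dForm η) := by
  ext1 x
  have ht := mem_extChartAt_target (I := 𝓡 m) x
  have hx : (extChartAt (𝓡 m) x).symm (extChartAt (𝓡 m) x x) = x := extChartAt_to_inv x
  have h1 : formRep x (pullForm f η) =ᶠ[𝓝 (extChartAt (𝓡 m) x x)]
      pullFlat (fun y => f ((extChartAt (𝓡 m) x).symm y)) η := by
    filter_upwards [eventually_mem_target x] with y hy
    exact formRep_pullForm hf η hy
  rw [dForm_apply, h1.extDeriv_eq, extDeriv_pullFlat (x := f x) (contMDiffAt_comp_symm hf ht)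
    (by rw [hx]; exact mem_extChartAt_source (f x)) (by rw [hx]; exact h.differentiableAt (f x)),
    ← formRep_pullForm hf _ ht, formRep_self]

theorem iForm_pullForm {ξ : VF m' Y} {ξX : VF m X}
    (h : ∀ x, (mfderiv (𝓡 m) (𝓡 m') f x : E m →L[ℝ] E m') (ξX x) = ξ (f x))
    (η : Form m' (q + 1) Y) : iForm ξX (pullForm f η) = pullForm f (iForm ξ η) := by
  ext x v
  refine congrArg (η (f x)) (funext fun i => ?_)
  refine Fin.cases ?_ (fun j => ?_) i
  · exact h x
  · rfl

/-- Unlike passage to a chart, pull-back need not be injective on forms at a point, so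
differentiability is needed here: the pulled-back family might be differentiable when the original
is not. -/
theorem pullForm_deriv {F : ℝ → Form m' q Y} {x : X} {t : ℝ}
    (hF : DifferentiableAt ℝ (fun t => F t (f x)) t) :
    pullForm (m := m) f (fun y => deriv (fun t => F t y) t) x
      = deriv (fun t => pullForm (m := m) f (F t) x) t := by
  exact (hasDerivAt_clm_comp (V := E m' [⋀^Fin q]→L[ℝ] ℝ) (W := E m [⋀^Fin q]→L[ℝ] ℝ)
    (ContinuousAlternatingMap.compContinuousLinearMapCLM
      (mfderiv (𝓡 m) (𝓡 m') f x : E m →L[ℝ] E m')) hF.hasDerivAt).deriv.symm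

end PullBack

/-! ### Families of field configurations and smoothness of ξ̂ and δξ along them. -/

section Families

variable {m N k : ℕ} {ty : Fin N → ℕ × ℕ} {M : Type*} [TopologicalSpace M] [ChartedSpace (E m) M]

theorem Fields.add_zero_smul (φ χ : Fields m ty M) : φ + (0 : ℝ) • χ = φ := by
  refine Prod.ext (funext fun x => Tensor.ext_apply fun α v => ?_)
    (funext fun j => funext fun x => Tensor.ext_apply fun α v => ?_)
  · change φ.1 x α v + 0 * χ.1 x α v = φ.1 x α v
    ring
  · change φ.2 j x α v + 0 * χ.2 j x α v = φ.2 j x α v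
    ring

theorem IsSym.add {g g' : Tensor m 0 2} (h : IsSym g) (h' : IsSym g') : IsSym (g + g') :=
  fun u v => congrArg₂ (· + ·) (h u v) (h' u v)

theorem IsSym.smul {g : Tensor m 0 2} (h : IsSym g) (c : ℝ) : IsSym (c • g) :=
  fun u v => congrArg (c * ·) (h u v)

theorem IsVariation.isFamilyAt {χ : Fields m ty M} (h : IsVariation χ) (s : Fin k → ℝ) :
    IsFamilyAt (fun _ => χ) s :=
  ⟨fun _ => h.1, fun x => ⟨h.2.1.smoothTensorAt s x, fun j => (h.2.2 j).smoothTensorAt s x⟩⟩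

theorem IsFamilyAt.isVariation {Φ : (Fin k → ℝ) → Fields m ty M} {s : Fin k → ℝ}
    (h : IsFamilyAt Φ s) : IsVariation (Φ s) :=
  ⟨h.1 s, SmoothTensorAt.smoothTensor (F := fun s => (Φ s).1) fun x => (h.2 x).1,
    fun j => SmoothTensorAt.smoothTensor (F := fun s => (Φ s).2 j) fun x => (h.2 x).2 j⟩

theorem IsFamilyAt.add_smul {Φ Ψ : (Fin k → ℝ) → Fields m ty M} {s : Fin k → ℝ}
    {c : (Fin k → ℝ) → ℝ} (hc : ContDiffAt ℝ ∞ c s) (hΦ : IsFamilyAt Φ s) (hΨ : IsFamilyAt Ψ s) :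
    IsFamilyAt (fun s => Φ s + c s • Ψ s) s :=
  ⟨fun s' x => (hΦ.1 s' x).add ((hΨ.1 s' x).smul (c s')), fun x =>
    ⟨(hΦ.2 x).1.add ((hΨ.2 x).1.smul hc), fun j => ((hΦ.2 x).2 j).add (((hΨ.2 x).2 j).smul hc)⟩⟩

theorem IsFamilyAt.comp {l : ℕ} {Φ : (Fin k → ℝ) → Fields m ty M} {s : Fin l → ℝ}
    {c : (Fin l → ℝ) → Fin k → ℝ} (hΦ : IsFamilyAt Φ (c s)) (hc : ContDiffAt ℝ ∞ c s) :
    IsFamilyAt (fun s => Φ (c s)) s :=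
  ⟨fun s' => hΦ.1 (c s'), fun x => ⟨SmoothTensorAt.comp (F := fun s => (Φ s).1) (hΦ.2 x).1 hc,
    fun j => SmoothTensorAt.comp (F := fun s => (Φ s).2 j) ((hΦ.2 x).2 j) hc⟩⟩

theorem contDiff_finTail : ContDiff ℝ ∞ (fun s : Fin (k + 1) → ℝ => (Fin.tail s : Fin k → ℝ)) := by
  rw [contDiff_pi]
  exact fun i => contDiff_apply ℝ ℝ i.succ

theorem IsFamilyAt.tail {Φ : (Fin k → ℝ) → Fields m ty M} {s : Fin k → ℝ} (hΦ : IsFamilyAt Φ s) :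
    IsFamilyAt (fun s' : Fin (k + 1) → ℝ => Φ (Fin.tail s')) (Fin.cons 0 s) :=
  IsFamilyAt.comp (c := Fin.tail) (by rwa [Fin.tail_cons]) contDiff_finTail.contDiffAt

/-- Adjoins the displacement along `Ψ` as a new parameter 0. At the value 0 the family meets `𝓕`
wherever `Φ` does, so smoothness hypotheses apply, and differentiating in the new parameter produces
directional derivatives such as δα and δξ. -/
theorem IsFamilyAt.line {Φ Ψ : (Fin k → ℝ) → Fields m ty M} {s : Fin k → ℝ}
    (hΦ : IsFamilyAt Φ s) (hΨ : IsFamilyAt Ψ s) :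
    IsFamilyAt (fun s' : Fin (k + 1) → ℝ => Φ (Fin.tail s') + s' 0 • Ψ (Fin.tail s'))
      (Fin.cons 0 s) :=
  hΦ.tail.add_smul (contDiff_apply ℝ ℝ 0).contDiffAt hΨ.tail

variable [IsManifold (𝓡 m) ∞ M]

theorem IsFamilyAt.lieFields {Φ : (Fin k → ℝ) → Fields m ty M} {ξ : (Fin k → ℝ) → VF m M}
    {s : Fin k → ℝ} (hξ : ∀ x, SmoothVFAt ξ s x) (hΦ : IsFamilyAt Φ s) :
    IsFamilyAt (fun s => CovPhase.lieFields (ξ s) (Φ s)) s :=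
  ⟨fun s' x => IsSym.lieTensor (hΦ.1 s') x, fun x =>
    ⟨(hΦ.2 x).1.lie (hξ x), fun j => ((hΦ.2 x).2 j).lie (hξ x)⟩⟩

variable {𝓕 : Set (Fields m ty M)} {ξ : Fields m ty M → VF m M}

theorem IsSmoothGen.hat (hξ : IsSmoothGen 𝓕 ξ) {Φ : (Fin k → ℝ) → Fields m ty M}
    {s : Fin k → ℝ} (hΦ : IsFamilyAt Φ s) (hs : Φ s ∈ 𝓕) :
    IsFamilyAt (fun s => CovPhase.hat ξ (Φ s)) s :=
  hΦ.lieFields (hξ.smooth k Φ s hΦ hs)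

theorem IsSmoothGen.smoothVF (hξ : IsSmoothGen 𝓕 ξ) {φ : Fields m ty M} (h : IsVariation φ)
    (hφ : φ ∈ 𝓕) : SmoothVF (ξ φ) :=
  SmoothVFAt.smoothVF (s := (0 : Fin 0 → ℝ)) (F := fun _ => ξ φ)
    (hξ.smooth 0 (fun _ => φ) 0 (h.isFamilyAt 0) hφ)

theorem IsSmoothGen.deltaVF (hξ : IsSmoothGen 𝓕 ξ) {Φ Ψ : (Fin k → ℝ) → Fields m ty M}
    {s : Fin k → ℝ} (hΦ : IsFamilyAt Φ s) (hΨ : IsFamilyAt Ψ s) (hs : Φ s ∈ 𝓕) (x : M) :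
    SmoothVFAt (fun s => CovPhase.deltaVF ξ (Φ s) (Ψ s)) s x := by
  have h := (hξ.smooth (k + 1) _ _ (hΦ.line hΨ)
    (by simpa [Fields.add_zero_smul] using hs) x).deriv
  simp only [Fin.tail_cons, Fin.cons_zero] at h
  exact h

end Families

/-! ### Calculus of δ on field-space forms. -/

section FieldForms

variable {m m' N p q : ℕ} {ty : Fin N → ℕ × ℕ} {M X : Type*}
  [TopologicalSpace M] [ChartedSpace (E m) M]
  [TopologicalSpace X] [ChartedSpace (E m') X]
  {𝓕 : Set (Fields m ty M)}

/-- Field-space forms (not necessarily multilinear) that take smooth families to smooth families. -/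
def SmoothOn (𝓕 : Set (Fields m ty M)) (α : FieldForm m ty M p (Form m' q X)) : Prop :=
  ∀ (k : ℕ) (Φ : (Fin k → ℝ) → Fields m ty M) (Ψ : Fin p → (Fin k → ℝ) → Fields m ty M)
    (s : Fin k → ℝ), IsFamilyAt Φ s → (∀ i, IsFamilyAt (Ψ i) s) → Φ s ∈ 𝓕 →
    ∀ x, SmoothFormAt (fun s' => α (Φ s') (fun i => Ψ i s')) s x

/-- Equality at points of `𝓕`, on all variations. -/
def VEq {V : Type*} (𝓕 : Set (Fields m ty M)) (α β : FieldForm m ty M p V) : Prop :=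
  ∀ φ ∈ 𝓕, ∀ χ : Fin p → Fields m ty M, (∀ i, IsVariation (χ i)) → α φ χ = β φ χ

/-- Equality near the base point of every smooth family through a point of `𝓕`. -/
def GermEq (𝓕 : Set (Fields m ty M)) (α β : FieldForm m ty M p (Form m' q X)) : Prop :=
  ∀ (k : ℕ) (Φ : (Fin k → ℝ) → Fields m ty M) (Ψ : Fin p → (Fin k → ℝ) → Fields m ty M)
    (s : Fin k → ℝ), IsFamilyAt Φ s → (∀ i, IsFamilyAt (Ψ i) s) → Φ s ∈ 𝓕 →
    ∀ x, ∀ᶠ s' in 𝓝 s, α (Φ s') (fun i => Ψ i s') x = β (Φ s') (fun i => Ψ i s') x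

theorem VEq.feq {V : Type*} {α β : FieldForm m ty M p V} (h : VEq 𝓕 α β) : FEq 𝓕 α β :=
  fun φ hφ χ hχ => h φ hφ χ fun i => (hχ i).1

theorem VEq.symm {V : Type*} {α β : FieldForm m ty M p V} (h : VEq 𝓕 α β) : VEq 𝓕 β α :=
  fun φ hφ χ hχ => (h φ hφ χ hχ).symm

theorem VEq.trans {V : Type*} {α β γ : FieldForm m ty M p V} (h : VEq 𝓕 α β) (h' : VEq 𝓕 β γ) :
    VEq 𝓕 α γ := fun φ hφ χ hχ => (h φ hφ χ hχ).trans (h' φ hφ χ hχ)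

theorem VEq.add {V : Type*} [Add V] {α β α' β' : FieldForm m ty M p V} (h : VEq 𝓕 α β)
    (h' : VEq 𝓕 α' β') : VEq 𝓕 (α + α') (β + β') :=
  fun φ hφ χ hχ => congrArg₂ (· + ·) (h φ hφ χ hχ) (h' φ hφ χ hχ)

theorem VEq.sub {V : Type*} [Sub V] {α β α' β' : FieldForm m ty M p V} (h : VEq 𝓕 α β)
    (h' : VEq 𝓕 α' β') : VEq 𝓕 (α - α') (β - β') :=
  fun φ hφ χ hχ => congrArg₂ (· - ·) (h φ hφ χ hχ) (h' φ hφ χ hχ)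

theorem FEq.add {V : Type*} [Add V] {α β α' β' : FieldForm m ty M p V} (h : FEq 𝓕 α β)
    (h' : FEq 𝓕 α' β') : FEq 𝓕 (α + α') (β + β') :=
  fun φ hφ χ hχ => congrArg₂ (· + ·) (h φ hφ χ hχ) (h' φ hφ χ hχ)

theorem FEq.trans {V : Type*} {α β γ : FieldForm m ty M p V} (h : FEq 𝓕 α β) (h' : FEq 𝓕 β γ) :
    FEq 𝓕 α γ := fun φ hφ χ hχ => (h φ hφ χ hχ).trans (h' φ hφ χ hχ)

theorem VEq.fd {α β : FieldForm m ty M p (Form m' q X)} (h : VEq 𝓕 α β) :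
    VEq 𝓕 (fd α) (fd β) := fun φ hφ χ hχ => congrArg dForm (h φ hφ χ hχ)

theorem IsFieldForm.smoothOn {α : FieldForm m ty M p (Form m' q X)} (h : IsFieldForm 𝓕 α) :
    SmoothOn 𝓕 α := h.smooth

variable {α β : FieldForm m ty M p (Form m' q X)}

theorem SmoothOn.add (hα : SmoothOn 𝓕 α) (hβ : SmoothOn 𝓕 β) : SmoothOn 𝓕 (α + β) :=
  fun k Φ Ψ s hΦ hΨ hs x => (hα k Φ Ψ s hΦ hΨ hs x).add (hβ k Φ Ψ s hΦ hΨ hs x)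

theorem SmoothOn.const_smul (c : ℝ) (hα : SmoothOn 𝓕 α) : SmoothOn 𝓕 (c • α) :=
  fun k Φ Ψ s hΦ hΨ hs x => (hα k Φ Ψ s hΦ hΨ hs x).const_smul c

theorem FieldForm.neg_eq (α : FieldForm m ty M p (Form m' q X)) : -α = (-1 : ℝ) • α := by
  funext φ χ
  exact Form.neg_eq (α φ χ)

theorem FieldForm.sub_eq (α β : FieldForm m ty M p (Form m' q X)) :
    α - β = α + (-1 : ℝ) • β := by
  rw [sub_eq_add_neg, FieldForm.neg_eq]

theorem SmoothOn.sub (hα : SmoothOn 𝓕 α) (hβ : SmoothOn 𝓕 β) : SmoothOn 𝓕 (α - β) := by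
  rw [FieldForm.sub_eq]
  exact hα.add (hβ.const_smul _)

theorem SmoothOn.fI {α : FieldForm m ty M (p + 1) (Form m' q X)} (hα : SmoothOn 𝓕 α)
    {v : Fields m ty M → Fields m ty M}
    (hv : ∀ (k : ℕ) (Φ : (Fin k → ℝ) → Fields m ty M) (s : Fin k → ℝ), IsFamilyAt Φ s →
      Φ s ∈ 𝓕 → IsFamilyAt (fun s => v (Φ s)) s) : SmoothOn 𝓕 (fI v α) := by
  intro k Φ Ψ s hΦ hΨ hs x
  have h := hα k Φ (Fin.cons (fun s => v (Φ s)) Ψ) s hΦ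
    (fun i => Fin.cases (hv k Φ s hΦ hs) hΨ i) hs x
  have e : ∀ s', CovPhase.fI v α (Φ s') (fun i => Ψ i s') = α (Φ s') (fun i =>
      (Fin.cons (fun s => v (Φ s)) Ψ : Fin (p + 1) → (Fin k → ℝ) → Fields m ty M) i s') :=
    fun s' => congrArg (α (Φ s')) (funext (Fin.cases rfl fun _ => rfl))
  simp only [e]
  exact h

theorem SmoothOn.smoothForm (hα : SmoothOn 𝓕 α) {φ : Fields m ty M} (h : IsVariation φ)
    (hφ : φ ∈ 𝓕) {χ : Fin p → Fields m ty M} (hχ : ∀ i, IsVariation (χ i)) :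
    SmoothForm (α φ χ) :=
  SmoothFormAt.smoothForm (s := (0 : Fin 0 → ℝ)) (F := fun _ => α φ χ)
    (hα 0 (fun _ => φ) (fun i _ => χ i) 0 (h.isFamilyAt 0) (fun i => (hχ i).isFamilyAt 0) hφ)

theorem SmoothOn.line (hα : SmoothOn 𝓕 α) {k : ℕ} {Φ v : (Fin k → ℝ) → Fields m ty M}
    {Ψ : Fin p → (Fin k → ℝ) → Fields m ty M} {s : Fin k → ℝ} (hΦ : IsFamilyAt Φ s)
    (hv : IsFamilyAt v s) (hΨ : ∀ i, IsFamilyAt (Ψ i) s) (hs : Φ s ∈ 𝓕) (x : X) :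
    SmoothFormAt (fun s' : Fin (k + 1) → ℝ => α (Φ (Fin.tail s') + s' 0 • v (Fin.tail s'))
      (fun i => Ψ i (Fin.tail s'))) (Fin.cons 0 s) x :=
  hα (k + 1) _ (fun i s' => Ψ i (Fin.tail s')) _ (hΦ.line hv) (fun i => (hΨ i).tail)
    (by simpa [Fields.add_zero_smul] using hs) x

/-- Directional derivative of a field-space form. -/
def dirDeriv (α : FieldForm m ty M p (Form m' q X)) (φ v : Fields m ty M)
    (χ : Fin p → Fields m ty M) : Form m' q X :=
  fun x => deriv (fun t : ℝ => α (φ + t • v) χ x) 0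

theorem delta_eq_sum (α : FieldForm m ty M p (Form m' q X)) (φ : Fields m ty M)
    (χ : Fin (p + 1) → Fields m ty M) :
    delta α φ χ = ∑ i : Fin (p + 1), (-1 : ℝ) ^ (i : ℕ) • dirDeriv α φ (χ i) (i.removeNth χ) := by
  funext x
  rw [Finset.sum_apply]
  rfl

variable [IsManifold (𝓡 m') ∞ X]

theorem SmoothOn.dirDeriv (hα : SmoothOn 𝓕 α) {k : ℕ} {Φ v : (Fin k → ℝ) → Fields m ty M}
    {Ψ : Fin p → (Fin k → ℝ) → Fields m ty M} {s : Fin k → ℝ} (hΦ : IsFamilyAt Φ s)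
    (hv : IsFamilyAt v s) (hΨ : ∀ i, IsFamilyAt (Ψ i) s) (hs : Φ s ∈ 𝓕) (x : X) :
    SmoothFormAt (fun s => CovPhase.dirDeriv α (Φ s) (v s) (fun i => Ψ i s)) s x := by
  have h := (hα.line hΦ hv hΨ hs x).deriv
  simp only [Fin.tail_cons, Fin.cons_zero] at h
  exact h

/-- Fields `Φ s'` near the base point may lie outside `𝓕`, where nothing is assumed. Being C¹ is an
open condition on the enlarged family, which gives differentiability in `t` at these fields as well.
-/
theorem SmoothOn.eventually_differentiableAt (hα : SmoothOn 𝓕 α) {k : ℕ}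
    {Φ v : (Fin k → ℝ) → Fields m ty M}
    {Ψ : Fin p → (Fin k → ℝ) → Fields m ty M} {s : Fin k → ℝ} (hΦ : IsFamilyAt Φ s)
    (hv : IsFamilyAt v s) (hΨ : ∀ i, IsFamilyAt (Ψ i) s) (hs : Φ s ∈ 𝓕) (x : X) :
    ∀ᶠ s' in 𝓝 s, DifferentiableAt ℝ
      (fun t : ℝ => α (Φ s' + t • v s') (fun i => Ψ i s') x) 0 := by
  have h := (hα.line hΦ hv hΨ hs x).contDiffAt
  have h1 := (h.of_le (m := 1) (by norm_num)).eventually (by norm_num)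
  have hc : ContinuousAt (fun s' : Fin k → ℝ => (Fin.cons 0 s' : Fin (k + 1) → ℝ)) s :=
    (contDiff_finCons.contDiffAt.comp s (f := fun s' : Fin k → ℝ => ((0 : ℝ), s'))
      (by fun_prop)).continuousAt
  filter_upwards [hc.eventually h1] with s' hs'
  have h2 := (hs'.comp (0 : ℝ) ((contDiff_finCons.of_le (m := 1) (by norm_num)).contDiffAt.comp
    (0 : ℝ) (f := fun t : ℝ => (t, s')) (by fun_prop))).differentiableAt (by norm_num)
  simpa [Function.comp_def] using h2

theorem SmoothOn.delta (hα : SmoothOn 𝓕 α) : SmoothOn 𝓕 (delta α) := by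
  intro k Φ Ψ s hΦ hΨ hs x
  simp only [delta_eq_sum]
  exact SmoothFormAt.sum _ fun i _ => (hα.dirDeriv hΦ (hΨ i) (fun j => hΨ (i.succAbove j))
    hs x).const_smul _

theorem SmoothOn.fd (hα : SmoothOn 𝓕 α) : SmoothOn 𝓕 (fd α) :=
  fun k Φ Ψ s hΦ hΨ hs x => (hα k Φ Ψ s hΦ hΨ hs x).dForm

theorem SmoothOn.fpull {α : FieldForm m ty M p (Form m q M)} [IsManifold (𝓡 m) ∞ M]
    (hα : SmoothOn 𝓕 α) {f : X → M} (hf : ContMDiff (𝓡 m') (𝓡 m) ∞ f) :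
    SmoothOn 𝓕 (CovPhase.fpull (m' := m') f α) :=
  fun k Φ Ψ s hΦ hΨ hs x => SmoothFormAt.pullForm hf (hα k Φ Ψ s hΦ hΨ hs (f x))

/-- δ at a point of `𝓕` samples α at the nearby fields φ + tχ, which may lie off `𝓕`. Agreement
along families near the base point is therefore what is required. -/
theorem delta_congr (hv : ∀ φ ∈ 𝓕, IsVariation φ) (h : GermEq 𝓕 α β) :
    VEq 𝓕 (delta α) (delta β) := by
  intro φ hφ χ hχ
  rw [delta_eq_sum, delta_eq_sum]
  refine Finset.sum_congr rfl fun i _ => congrArg _ (funext fun x => ?_)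
  have h1 := h 1 (fun s => φ + s 0 • χ i) (fun j _ => i.removeNth χ j) 0
    (((hv φ hφ).isFamilyAt 0).add_smul (contDiff_apply ℝ ℝ 0).contDiffAt ((hχ i).isFamilyAt 0))
    (fun j => (hχ _).isFamilyAt 0) (by simpa [Fields.add_zero_smul] using hφ) x
  have hc : Filter.Tendsto (fun t : ℝ => (fun _ : Fin 1 => t)) (𝓝 0) (𝓝 0) := by
    have : Continuous (fun t : ℝ => (fun _ : Fin 1 => t)) := by fun_prop
    exact this.tendsto 0
  exact Filter.EventuallyEq.deriv_eq (hc.eventually h1)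

/-- Stated as a germ rather than on `𝓕` alone so that it can be differentiated again, as in the
anomaly of δ(b' + a). -/
theorem delta_add_germEq (hα : SmoothOn 𝓕 α) (hβ : SmoothOn 𝓕 β) :
    GermEq 𝓕 (delta (α + β)) (delta α + delta β) := by
  intro k Φ Ψ s hΦ hΨ hs x
  have h1 : ∀ i : Fin (p + 1), ∀ᶠ s' in 𝓝 s,
      dirDeriv (α + β) (Φ s') (Ψ i s') (i.removeNth fun j => Ψ j s') x
        = dirDeriv α (Φ s') (Ψ i s') (i.removeNth fun j => Ψ j s') x
          + dirDeriv β (Φ s') (Ψ i s') (i.removeNth fun j => Ψ j s') x := by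
    intro i
    filter_upwards [hα.eventually_differentiableAt hΦ (hΨ i) (fun j => hΨ (i.succAbove j)) hs x,
      hβ.eventually_differentiableAt hΦ (hΨ i) (fun j => hΨ (i.succAbove j)) hs x] with s' ha hb
    exact deriv_add ha hb
  filter_upwards [Filter.eventually_all.2 h1] with s' hs'
  rw [Pi.add_apply, Pi.add_apply, Pi.add_apply, delta_eq_sum, delta_eq_sum, delta_eq_sum,
    Finset.sum_apply, Finset.sum_apply, Finset.sum_apply, ← Finset.sum_add_distrib]
  refine Finset.sum_congr rfl fun i _ => ?_
  rw [Pi.smul_apply, hs' i, smul_add]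
  rfl

theorem GermEq.vEq (hv : ∀ φ ∈ 𝓕, IsVariation φ) (h : GermEq 𝓕 α β) : VEq 𝓕 α β :=
  fun φ hφ χ hχ => funext fun x =>
    (h 0 (fun _ => φ) (fun i _ => χ i) 0 ((hv φ hφ).isFamilyAt 0) (fun i => (hχ i).isFamilyAt 0)
      hφ x).self_of_nhds

theorem delta_add (hv : ∀ φ ∈ 𝓕, IsVariation φ) (hα : SmoothOn 𝓕 α) (hβ : SmoothOn 𝓕 β) :
    VEq 𝓕 (delta (α + β)) (delta α + delta β) :=
  (delta_add_germEq hα hβ).vEq hv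

theorem dirDeriv_smul (c : ℝ) (φ v : Fields m ty M) (χ : Fin p → Fields m ty M) :
    dirDeriv (c • α) φ v χ = c • dirDeriv α φ v χ :=
  funext fun x => deriv_fun_const_smul_field (F := E m' [⋀^Fin q]→L[ℝ] ℝ) c
    (fun t : ℝ => α (φ + t • v) χ x)

theorem delta_smul (c : ℝ) : delta (c • α) = c • delta α := by
  funext φ χ
  rw [Pi.smul_apply, Pi.smul_apply, delta_eq_sum, delta_eq_sum, Finset.smul_sum]
  refine Finset.sum_congr rfl fun i _ => ?_
  rw [dirDeriv_smul, smul_comm]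

theorem delta_sub (hv : ∀ φ ∈ 𝓕, IsVariation φ) (hα : SmoothOn 𝓕 α) (hβ : SmoothOn 𝓕 β) :
    VEq 𝓕 (delta (α - β)) (delta α - delta β) := by
  rw [FieldForm.sub_eq, FieldForm.sub_eq, ← delta_smul]
  exact delta_add hv hα (hβ.const_smul _)

theorem dForm_sum {ι : Type*} (t : Finset ι) {F : ι → Form m' q X} (hF : ∀ i ∈ t, SmoothForm (F i)) :
    SmoothForm (∑ i ∈ t, F i) ∧ dForm (∑ i ∈ t, F i) = ∑ i ∈ t, dForm (F i) := by
  classical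
  induction t using Finset.induction_on with
  | empty => exact ⟨fun x => contDiffAt_const (c := 0), by simpa using dForm_zero⟩
  | insert a t ha ih =>
    obtain ⟨h1, h2⟩ := ih fun i hi => hF i (Finset.mem_insert_of_mem hi)
    have h3 := hF a (Finset.mem_insert_self a t)
    rw [Finset.sum_insert ha, Finset.sum_insert ha]
    exact ⟨h3.add h1, by rw [dForm_add h3 h1, h2]⟩

/-- Each term of δ is a derivative in one parameter, to which `SmoothFormAt.hasDerivAt_dForm`
applies; d then passes through the finite alternating sum. -/
theorem delta_fd (hv : ∀ φ ∈ 𝓕, IsVariation φ) (hα : SmoothOn 𝓕 α) :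
    VEq 𝓕 (delta (fd α)) (fd (delta α)) := by
  intro φ hφ χ hχ
  have hf : ∀ (ψ : Fields m ty M), IsVariation ψ → IsFamilyAt (fun _ => ψ) (0 : Fin 0 → ℝ) :=
    fun ψ h => h.isFamilyAt 0
  have hs : ∀ i : Fin (p + 1), SmoothForm (dirDeriv α φ (χ i) (i.removeNth χ)) := fun i =>
    SmoothFormAt.smoothForm (s := (0 : Fin 0 → ℝ))
      (F := fun _ => dirDeriv α φ (χ i) (i.removeNth χ))
      (hα.dirDeriv (Ψ := fun j _ => i.removeNth χ j) (hf φ (hv φ hφ)) (hf _ (hχ i))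
        (fun j => hf _ (hχ _)) hφ)
  rw [CovPhase.fd, delta_eq_sum, delta_eq_sum,
    (dForm_sum _ fun i _ => (hs i).const_smul ((-1) ^ (i : ℕ))).2]
  refine Finset.sum_congr rfl fun i _ => ?_
  rw [dForm_smul]
  refine congrArg _ (funext fun x => ?_)
  have h := (hα.line (s := (0 : Fin 0 → ℝ)) (Ψ := fun j _ => i.removeNth χ j) (hf φ (hv φ hφ))
    (hf _ (hχ i)) (fun j => hf _ (hχ _)) hφ x).hasDerivAt_dForm
  simp only [Fin.cons_zero] at h
  exact h.deriv

theorem delta_fpull {α : FieldForm m ty M p (Form m q M)} [IsManifold (𝓡 m) ∞ M]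
    (hv : ∀ φ ∈ 𝓕, IsVariation φ) (hα : SmoothOn 𝓕 α) {f : X → M} :
    VEq 𝓕 (delta (fpull (m' := m') f α)) (fpull f (delta α)) := by
  intro φ hφ χ hχ
  have hsum : pullForm (m := m') f (delta α φ χ) = ∑ i : Fin (p + 1), (-1 : ℝ) ^ (i : ℕ) •
      pullForm (m := m') f (dirDeriv α φ (χ i) (i.removeNth χ)) := by
    rw [delta_eq_sum]
    funext x
    rw [Finset.sum_apply, pullForm, Finset.sum_apply]
    exact map_sum (ContinuousAlternatingMap.compContinuousLinearMapCLM (ι := Fin q) (F := ℝ)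
      (mfderiv (𝓡 m') (𝓡 m) f x : E m' →L[ℝ] E m)) _ _
  refine Eq.trans ?_ hsum.symm
  rw [delta_eq_sum]
  refine Finset.sum_congr rfl fun i _ => congrArg _ (funext fun x => ?_)
  have h := (hα.eventually_differentiableAt (s := (0 : Fin 0 → ℝ)) (Ψ := fun j _ => i.removeNth χ j)
    ((hv φ hφ).isFamilyAt 0) ((hχ i).isFamilyAt 0) (fun j => (hχ _).isFamilyAt 0) hφ
    (f x)).self_of_nhds
  exact (pullForm_deriv (F := fun t => α (φ + t • χ i) (i.removeNth χ)) h).symm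

/-- `δ² = 0` on functions on field space. -/
theorem delta_delta {α : FieldForm m ty M 0 (Form m' q X)} (hv : ∀ φ ∈ 𝓕, IsVariation φ)
    (hα : SmoothOn 𝓕 α) : VEq 𝓕 (delta (delta α)) 0 := by
  intro φ hφ χ hχ
  funext x
  -- Restricting α to the plane of fields spanned by the two variations turns δ² into the difference
  -- of the two mixed partial derivatives of `f`.
  set f : ℝ → ℝ → E m' [⋀^Fin q]→L[ℝ] ℝ :=
    fun t u => α (φ + t • χ 0 + u • χ 1) Fin.elim0 x with hf
  have hfs : ContDiffAt ℝ ∞ (fun z : ℝ × ℝ => f z.1 z.2) (0, 0) := by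
    have h1 := (hα 2 (fun s => φ + s 0 • χ 0 + s 1 • χ 1) Fin.elim0 0
      ((((hv φ hφ).isFamilyAt 0).add_smul (contDiff_apply ℝ ℝ 0).contDiffAt
        ((hχ 0).isFamilyAt 0)).add_smul (contDiff_apply ℝ ℝ 1).contDiffAt ((hχ 1).isFamilyAt 0))
      (fun i => i.elim0) (by simpa [Fields.add_zero_smul] using hφ) x).contDiffAt
    have hc : ContDiff ℝ ∞ (fun z : ℝ × ℝ => ![z.1, z.2]) := by
      rw [contDiff_pi]
      intro i
      fin_cases i
      · exact contDiff_fst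
      · exact contDiff_snd
    have h0 : ![(0 : ℝ), 0] = 0 := by
      ext i; fin_cases i <;> rfl
    have h2 := ContDiffAt.comp (f := fun z : ℝ × ℝ => ![z.1, z.2]) ((0 : ℝ), (0 : ℝ))
      (by rw [h0]; exact h1) hc.contDiffAt
    refine h2.congr_of_eventuallyEq (Filter.Eventually.of_forall fun z => ?_)
    exact congrArg (fun χ => α (φ + z.1 • _ + z.2 • _) χ x) (Subsingleton.elim _ _)
  have hcomm : deriv (fun t => deriv (fun u => f t u) 0) 0
      = deriv (fun u => deriv (fun t => f t u) 0) 0 := by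
    have h1 := (hasDerivAt_fderiv_param hfs).clm_apply (hasDerivAt_const (0 : ℝ) (1 : ℝ))
    have h2 := h1.deriv
    simpa using h2
  have e0 : dirDeriv (delta α) φ (χ 0) (Fin.removeNth 0 χ) x
      = deriv (fun t => deriv (fun u => f t u) 0) 0 := by
    refine congrArg (fun g => deriv g 0) (funext fun t => ?_)
    rw [delta_eq_sum, Fin.sum_univ_one]
    simp only [Fin.val_zero, pow_zero, one_smul]
    exact congrArg (fun g => deriv g 0) (funext fun u =>
      congrArg (fun χ' => α (φ + t • χ 0 + u • χ 1) χ' x) (Subsingleton.elim _ _))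
  have e1 : dirDeriv (delta α) φ (χ 1) (Fin.removeNth 1 χ) x
      = deriv (fun u => deriv (fun t => f t u) 0) 0 := by
    refine congrArg (fun g => deriv g 0) (funext fun u => ?_)
    rw [delta_eq_sum, Fin.sum_univ_one]
    simp only [Fin.val_zero, pow_zero, one_smul]
    refine congrArg (fun g => deriv g 0) (funext fun t => ?_)
    rw [hf]
    simp only
    rw [add_right_comm φ (t • χ 0)]
    exact congrArg (fun χ' => α (φ + u • χ 1 + t • χ 0) χ' x) (Subsingleton.elim _ _)
  rw [delta_eq_sum, Fin.sum_univ_two, Pi.add_apply, Pi.smul_apply, Pi.smul_apply, e0, e1, hcomm]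
  simp only [Fin.val_zero, pow_zero, one_smul, Fin.val_one, pow_one]
  ext v
  rw [Pi.zero_apply]
  change _ + (-1) * _ = (0 : ℝ)
  ring

end FieldForms

/-! ### Additivity of the anomaly operator and its commutation with d. -/

section Anomaly

theorem SmoothForm.sub {m q : ℕ} {X : Type*} [TopologicalSpace X] [ChartedSpace (E m) X]
    [IsManifold (𝓡 m) ∞ X] {η ζ : Form m q X} (h : SmoothForm η) (h' : SmoothForm ζ) : SmoothForm (η - ζ) := by
  rw [sub_eq_add_neg, Form.neg_eq]
  exact h.add (h'.const_smul _)

theorem Fields.add_assoc {m N : ℕ} {ty : Fin N → ℕ × ℕ} {M : Type*} (φ χ ψ : Fields m ty M) :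
    φ + χ + ψ = φ + (χ + ψ) :=
  Prod.ext (funext fun x => Tensor.ext_apply fun α v => _root_.add_assoc (φ.1 x α v) _ _)
    (funext fun j => funext fun x => Tensor.ext_apply fun α v =>
      _root_.add_assoc (φ.2 j x α v) _ _)

theorem Fields.zero_smul_add {m N : ℕ} {ty : Fin N → ℕ × ℕ} {M : Type*} (φ χ : Fields m ty M) :
    (0 : ℝ) • φ + χ = χ := by
  refine Prod.ext (funext fun x => Tensor.ext_apply fun α v => ?_)
    (funext fun j => funext fun x => Tensor.ext_apply fun α v => ?_)
  · change 0 * φ.1 x α v + χ.1 x α v = χ.1 x α v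
    ring
  · change 0 * φ.2 j x α v + χ.2 j x α v = χ.2 j x α v
    ring

theorem Fields.smul_add {m N : ℕ} {ty : Fin N → ℕ × ℕ} {M : Type*} (c : ℝ)
    (φ χ : Fields m ty M) : c • (φ + χ) = c • φ + c • χ :=
  Prod.ext (funext fun x => Tensor.ext_apply fun α v => mul_add c (φ.1 x α v) (χ.1 x α v))
    (funext fun j => funext fun x => Tensor.ext_apply fun α v =>
      mul_add c (φ.2 j x α v) (χ.2 j x α v))


variable {m N p q : ℕ} {ty : Fin N → ℕ × ℕ} {M : Type*}
  [TopologicalSpace M] [ChartedSpace (E m) M] [IsManifold (𝓡 m) ∞ M]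
  {𝓕 : Set (Fields m ty M)} {ξ : Fields m ty M → VF m M}

theorem IsSmoothGen.hat_isVariation (hξ : IsSmoothGen 𝓕 ξ) {φ : Fields m ty M} (hφ : φ ∈ 𝓕) :
    IsVariation (CovPhase.hat ξ φ) := (hξ.tangent φ hφ).1

theorem IsSmoothGen.lieFields_deltaVF (hξ : IsSmoothGen 𝓕 ξ) {k : ℕ}
    {Φ Ψ : (Fin k → ℝ) → Fields m ty M} {s : Fin k → ℝ} (hΦ : IsFamilyAt Φ s)
    (hΨ : IsFamilyAt Ψ s) (hs : Φ s ∈ 𝓕) :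
    IsFamilyAt (fun s => lieFields (CovPhase.deltaVF ξ (Φ s) (Ψ s)) (Φ s)) s :=
  hΦ.lieFields (hξ.deltaVF hΦ hΨ hs)

theorem IsSmoothGen.lieFields_deltaVF_isVariation (hξ : IsSmoothGen 𝓕 ξ) {φ χ : Fields m ty M}
    (h : IsVariation φ) (hχ : IsVariation χ) (hφ : φ ∈ 𝓕) :
    IsVariation (lieFields (CovPhase.deltaVF ξ φ χ) φ) :=
  (hξ.lieFields_deltaVF (s := (0 : Fin 0 → ℝ)) (h.isFamilyAt 0) (hχ.isFamilyAt 0) hφ).isVariation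

theorem isVariation_cons {v : Fields m ty M} {χ : Fin p → Fields m ty M} (hv : IsVariation v)
    (hχ : ∀ i, IsVariation (χ i)) :
    ∀ i, IsVariation ((Fin.cons v χ : Fin (p + 1) → Fields m ty M) i) :=
  Fin.cases hv hχ

theorem isVariation_update {v : Fields m ty M} {χ : Fin p → Fields m ty M} (hv : IsVariation v)
    (hχ : ∀ i, IsVariation (χ i)) (i j : Fin p) : IsVariation (Function.update χ i v j) := by
  rcases eq_or_ne j i with rfl | h
  · simpa using hv
  · simpa [h] using hχ j

theorem VEq.fI {V : Type*} {α β : FieldForm m ty M (p + 1) V} (hξ : IsSmoothGen 𝓕 ξ)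
    (h : VEq 𝓕 α β) : VEq 𝓕 (fI (hat ξ) α) (fI (hat ξ) β) :=
  fun φ hφ _ hχ => h φ hφ _ (isVariation_cons (hξ.hat_isVariation hφ) hχ)

theorem SmoothOn.fI_hat {α : FieldForm m ty M (p + 1) (Form m q M)} (hα : SmoothOn 𝓕 α)
    (hξ : IsSmoothGen 𝓕 ξ) : SmoothOn 𝓕 (CovPhase.fI (hat ξ) α) :=
  hα.fI fun _ _ _ hΦ hs => hξ.hat hΦ hs

theorem GermEq.fI {α β : FieldForm m ty M (p + 1) (Form m q M)} (hξ : IsSmoothGen 𝓕 ξ)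
    (h : GermEq 𝓕 α β) : GermEq 𝓕 (fI (hat ξ) α) (fI (hat ξ) β) := by
  intro k Φ Ψ s hΦ hΨ hs x
  have h1 := h k Φ (Fin.cons (fun s => hat ξ (Φ s)) Ψ) s hΦ
    (fun i => Fin.cases (hξ.hat hΦ hs) hΨ i) hs x
  have e : ∀ s', (Fin.cons (hat ξ (Φ s')) (fun i => Ψ i s') : Fin (p + 1) → Fields m ty M)
      = fun i => (Fin.cons (fun s => hat ξ (Φ s)) Ψ :
        Fin (p + 1) → (Fin k → ℝ) → Fields m ty M) i s' :=
    fun s' => funext (Fin.cases rfl fun _ => rfl)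
  filter_upwards [h1] with s' hs'
  rw [CovPhase.fI, CovPhase.fI, e]
  exact hs'

variable {α β : FieldForm m ty M p (Form m q M)}

theorem fL_congr (hv : ∀ φ ∈ 𝓕, IsVariation φ) (hξ : IsSmoothGen 𝓕 ξ) (h : GermEq 𝓕 α β) :
    VEq 𝓕 (fL (hat ξ) α) (fL (hat ξ) β) := by
  cases p with
  | zero => exact (delta_congr hv h).fI hξ
  | succ p => exact ((delta_congr hv h).fI hξ).add (delta_congr hv (h.fI hξ))

/-- Equality of germs is needed because L_ξ̂ contains δ. The last term evaluates the forms on £_{δξ}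
φ, a variation not known to be tangent to `𝓕`, which is why equality must hold on all variations. -/
theorem anomaly_congr (hv : ∀ φ ∈ 𝓕, IsVariation φ) (hξ : IsSmoothGen 𝓕 ξ) (h : GermEq 𝓕 α β) :
    VEq 𝓕 (anomaly ξ ξ α) (anomaly ξ ξ β) := by
  refine ((fL_congr hv hξ h).sub fun φ hφ χ hχ => ?_).sub fun φ hφ χ hχ => ?_
  · exact congrArg (lieForm (ξ φ)) (h.vEq hv φ hφ χ hχ)
  · exact Finset.sum_congr rfl fun i _ => h.vEq hv φ hφ _
      (isVariation_update (hξ.lieFields_deltaVF_isVariation (hv φ hφ) (hχ i) hφ) hχ i)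

theorem fL_add (hv : ∀ φ ∈ 𝓕, IsVariation φ) (hξ : IsSmoothGen 𝓕 ξ) (hα : SmoothOn 𝓕 α)
    (hβ : SmoothOn 𝓕 β) : VEq 𝓕 (fL (hat ξ) (α + β)) (fL (hat ξ) α + fL (hat ξ) β) := by
  cases p with
  | zero => exact (delta_add hv hα hβ).fI hξ
  | succ p =>
    refine (((delta_add hv hα hβ).fI hξ).add
      (delta_add hv (hα.fI_hat hξ) (hβ.fI_hat hξ))).trans fun φ _ χ _ => ?_
    exact add_add_add_comm _ _ _ _

theorem anomaly_add (hv : ∀ φ ∈ 𝓕, IsVariation φ) (hξ : IsSmoothGen 𝓕 ξ) (hα : SmoothOn 𝓕 α)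
    (hβ : SmoothOn 𝓕 β) :
    VEq 𝓕 (anomaly ξ ξ (α + β)) (anomaly ξ ξ α + anomaly ξ ξ β) := by
  intro φ hφ χ hχ
  have h1 := fL_add hv hξ hα hβ φ hφ χ hχ
  have h2 : lieForm (ξ φ) (α φ χ + β φ χ) = lieForm (ξ φ) (α φ χ) + lieForm (ξ φ) (β φ χ) :=
    lieForm_add (hξ.smoothVF (hv φ hφ) hφ) (hα.smoothForm (hv φ hφ) hφ hχ)
      (hβ.smoothForm (hv φ hφ) hφ hχ)
  have h3 : fIone (fun φ χ => lieFields (deltaVF ξ φ χ) φ) (α + β) φ χ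
      = fIone (fun φ χ => lieFields (deltaVF ξ φ χ) φ) α φ χ
        + fIone (fun φ χ => lieFields (deltaVF ξ φ χ) φ) β φ χ := Finset.sum_add_distrib
  change fL (hat ξ) (α + β) φ χ - lieForm (ξ φ) (α φ χ + β φ χ)
      - fIone (fun φ χ => lieFields (deltaVF ξ φ χ) φ) (α + β) φ χ
    = (fL (hat ξ) α φ χ - lieForm (ξ φ) (α φ χ)
        - fIone (fun φ χ => lieFields (deltaVF ξ φ χ) φ) α φ χ)
      + (fL (hat ξ) β φ χ - lieForm (ξ φ) (β φ χ)
        - fIone (fun φ χ => lieFields (deltaVF ξ φ χ) φ) β φ χ)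
  rw [h1, h2, h3]
  change fL (hat ξ) α φ χ + fL (hat ξ) β φ χ - _ - _ = _
  abel

theorem SmoothOn.fL (hα : SmoothOn 𝓕 α) (hξ : IsSmoothGen 𝓕 ξ) :
    SmoothOn 𝓕 (fL (hat ξ) α) := by
  cases p with
  | zero => exact hα.delta.fI_hat hξ
  | succ p => exact (hα.delta.fI_hat hξ).add (hα.fI_hat hξ).delta

theorem fL_fd (hv : ∀ φ ∈ 𝓕, IsVariation φ) (hξ : IsSmoothGen 𝓕 ξ) (hα : SmoothOn 𝓕 α) :
    VEq 𝓕 (fL (hat ξ) (fd α)) (fd (fL (hat ξ) α)) := by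
  cases p with
  | zero => exact (delta_fd hv hα).fI hξ
  | succ p =>
    refine (((delta_fd hv hα).fI hξ).add (delta_fd hv (hα.fI_hat hξ))).trans fun φ hφ χ hχ => ?_
    exact (dForm_add ((hα.delta.fI_hat hξ).smoothForm (hv φ hφ) hφ hχ)
      ((hα.fI_hat hξ).delta.smoothForm (hv φ hφ) hφ hχ)).symm

/-- Each of L_ξ̂, £_ξ and the insertion of £_{δξ} φ commutes with d separately; smoothness of the
three terms allows d to be distributed over their difference. -/
theorem anomaly_fd (hv : ∀ φ ∈ 𝓕, IsVariation φ) (hξ : IsSmoothGen 𝓕 ξ) (hα : SmoothOn 𝓕 α) :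
    VEq 𝓕 (anomaly ξ ξ (fd α)) (fd (anomaly ξ ξ α)) := by
  intro φ hφ χ hχ
  have hx := hξ.smoothVF (hv φ hφ) hφ
  have hs := hα.smoothForm (hv φ hφ) hφ hχ
  have hl := (hα.fL hξ).smoothForm (hv φ hφ) hφ hχ
  have h3 := dForm_sum Finset.univ (F := fun i : Fin p =>
    α φ (Function.update χ i (lieFields (deltaVF ξ φ (χ i)) φ))) fun i _ =>
      hα.smoothForm (hv φ hφ) hφ
        (isVariation_update (hξ.lieFields_deltaVF_isVariation (hv φ hφ) (hχ i) hφ) hχ i)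
  change CovPhase.fL (hat ξ) (fd α) φ χ - lieForm (ξ φ) (dForm (α φ χ))
      - ∑ i : Fin p, dForm (α φ (Function.update χ i (lieFields (deltaVF ξ φ (χ i)) φ)))
    = dForm (CovPhase.fL (hat ξ) α φ χ - lieForm (ξ φ) (α φ χ)
      - ∑ i : Fin p, α φ (Function.update χ i (lieFields (deltaVF ξ φ (χ i)) φ)))
  rw [fL_fd hv hξ hα φ hφ χ hχ, dForm_sub (hl.sub (hs.lieForm hx)) h3.1,
    dForm_sub hl (hs.lieForm hx), h3.2, lieForm_dForm hx hs]
  rfl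

end Anomaly

/-! ### Closure of field-space forms under sums, pull-back, d and δ. -/

section Closure

variable {m m' N p q : ℕ} {ty : Fin N → ℕ × ℕ} {M X : Type*}
  [TopologicalSpace M] [ChartedSpace (E m) M]
  [TopologicalSpace X] [ChartedSpace (E m') X]
  {𝓕 : Set (Fields m ty M)} {α β : FieldForm m ty M p (Form m' q X)}

theorem IsFieldForm.add (hα : IsFieldForm 𝓕 α) (hβ : IsFieldForm 𝓕 β) :
    IsFieldForm 𝓕 (α + β) where
  map_add φ hφ χ hχ i u v hu hv := by
    simp only [Pi.add_apply α β, Pi.add_apply (α φ) (β φ)]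
    rw [hα.map_add φ hφ χ hχ i u v hu hv, hβ.map_add φ hφ χ hχ i u v hu hv, add_add_add_comm]
  map_smul φ hφ χ hχ i u c hu := by
    simp only [Pi.add_apply α β, Pi.add_apply (α φ) (β φ)]
    rw [hα.map_smul φ hφ χ hχ i u c hu, hβ.map_smul φ hφ χ hχ i u c hu, smul_add]
  map_eq_zero φ hφ χ hχ i j hij h := by
    simp only [Pi.add_apply α β, Pi.add_apply (α φ) (β φ)]
    rw [hα.map_eq_zero φ hφ χ hχ i j hij h, hβ.map_eq_zero φ hφ χ hχ i j hij h, add_zero]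
  smooth := hα.smoothOn.add hβ.smoothOn

theorem IsFieldForm.const_smul (r : ℝ) (hα : IsFieldForm 𝓕 α) : IsFieldForm 𝓕 (r • α) where
  map_add φ hφ χ hχ i u v hu hv := by
    simp only [Pi.smul_apply r α, Pi.smul_apply r (α φ)]
    rw [hα.map_add φ hφ χ hχ i u v hu hv, smul_add]
  map_smul φ hφ χ hχ i u c hu := by
    simp only [Pi.smul_apply r α, Pi.smul_apply r (α φ)]
    rw [hα.map_smul φ hφ χ hχ i u c hu, smul_comm]
  map_eq_zero φ hφ χ hχ i j hij h := by
    simp only [Pi.smul_apply r α, Pi.smul_apply r (α φ)]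
    rw [hα.map_eq_zero φ hφ χ hχ i j hij h, smul_zero]
  smooth := hα.smoothOn.const_smul r

theorem IsFieldForm.sub (hα : IsFieldForm 𝓕 α) (hβ : IsFieldForm 𝓕 β) :
    IsFieldForm 𝓕 (α - β) := by
  rw [FieldForm.sub_eq]
  exact hα.add (hβ.const_smul _)

theorem IsFieldForm.fpull [IsManifold (𝓡 m') ∞ X] [IsManifold (𝓡 m) ∞ M] {f : X → M}
    (hf : ContMDiff (𝓡 m') (𝓡 m) ∞ f) {α : FieldForm m ty M p (Form m q M)}
    (hα : IsFieldForm 𝓕 α) : IsFieldForm 𝓕 (fpull (m' := m') f α) where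
  map_add φ hφ χ hχ i u v hu hv :=
    congrArg (pullForm f) (hα.map_add φ hφ χ hχ i u v hu hv)
  map_smul φ hφ χ hχ i u c hu := congrArg (pullForm f) (hα.map_smul φ hφ χ hχ i u c hu)
  map_eq_zero φ hφ χ hχ i j hij h :=
    congrArg (pullForm f) (hα.map_eq_zero φ hφ χ hχ i j hij h)
  smooth := hα.smoothOn.fpull hf

variable [IsManifold (𝓡 m') ∞ X]

theorem IsFieldForm.fd [IsManifold (𝓡 m) ∞ M] (hv : ∀ φ ∈ 𝓕, IsVariation φ) (hα : IsFieldForm 𝓕 α) :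
    IsFieldForm 𝓕 (fd α) where
  map_add φ hφ χ hχ i u v hu hu' := by
    have hs : ∀ {w}, IsVariation w → SmoothForm (α φ (Function.update χ i w)) := fun hw =>
      hα.smoothOn.smoothForm (hv φ hφ) hφ (isVariation_update hw hχ i)
    exact (congrArg dForm (hα.map_add φ hφ χ hχ i u v hu hu')).trans (dForm_add (hs hu) (hs hu'))
  map_smul φ hφ χ hχ i u c hu :=
    (congrArg dForm (hα.map_smul φ hφ χ hχ i u c hu)).trans (dForm_smul c _)
  map_eq_zero φ hφ χ hχ i j hij h :=
    (congrArg dForm (hα.map_eq_zero φ hφ χ hχ i j hij h)).trans dForm_zero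
  smooth := hα.smoothOn.fd

/-- Directional derivatives need not be additive in the direction. Here they are, because smoothness
along the two-parameter family φ + s₀u + s₁v makes all three of them values of one Fréchet
derivative on ℝ². -/
theorem dirDeriv_add (hv : ∀ φ ∈ 𝓕, IsVariation φ) (hα : SmoothOn 𝓕 α) {φ : Fields m ty M}
    (hφ : φ ∈ 𝓕) {u v : Fields m ty M} (hu : IsVariation u) (hv' : IsVariation v)
    {χ : Fin p → Fields m ty M} (hχ : ∀ i, IsVariation (χ i)) :
    dirDeriv α φ (u + v) χ = dirDeriv α φ u χ + dirDeriv α φ v χ := by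
  funext x
  set f : (Fin 2 → ℝ) → E m' [⋀^Fin q]→L[ℝ] ℝ := fun s => α (φ + s 0 • u + s 1 • v) χ x with hf
  have hd : DifferentiableAt ℝ f 0 :=
    ((hα 2 (fun s => φ + s 0 • u + s 1 • v) (fun i _ => χ i) 0
      ((((hv φ hφ).isFamilyAt 0).add_smul (contDiff_apply ℝ ℝ 0).contDiffAt
        (hu.isFamilyAt 0)).add_smul (contDiff_apply ℝ ℝ 1).contDiffAt (hv'.isFamilyAt 0))
      (fun i => (hχ i).isFamilyAt 0)
      (by simpa [Fields.add_zero_smul] using hφ) x).contDiffAt).differentiableAt (by norm_num)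
  have hl : ∀ w : Fin 2 → ℝ, HasDerivAt (fun t : ℝ => f (t • w)) (fderiv ℝ f 0 w) 0 := by
    intro w
    have h1 : HasDerivAt (fun t : ℝ => t • w) w 0 := by
      simpa using (hasDerivAt_id (0 : ℝ)).smul_const w
    have h2 : HasFDerivAt f (fderiv ℝ f 0) ((0 : ℝ) • w) := by
      rw [zero_smul]; exact hd.hasFDerivAt
    exact h2.comp_hasDerivAt 0 h1
  have e : ∀ (w : Fin 2 → ℝ) (z : Fields m ty M), z = w 0 • u + w 1 • v →
      dirDeriv α φ z χ x = fderiv ℝ f 0 w := by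
    intro w z hz
    rw [← (hl w).deriv, hz]
    refine congrArg (fun g => deriv g 0) (funext fun t => ?_)
    simp only [hf, Pi.smul_apply, smul_eq_mul, Fields.smul_add, mul_smul,
      Fields.add_assoc]
  rw [Pi.add_apply, e ![1, 1] (u + v) (by simp), e ![1, 0] u (by simp [Fields.add_zero_smul]),
    e ![0, 1] v (by
      simp [Fields.zero_smul_add]), ← map_add]
  congr 1
  ext i; fin_cases i <;> simp

/-- A rescaling of the parameter `t`, valid for `deriv` even without differentiability. -/
theorem dirDeriv_smul_right (c : ℝ) (φ u : Fields m ty M) (χ : Fin p → Fields m ty M) :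
    dirDeriv α φ (c • u) χ = c • dirDeriv α φ u χ := by
  funext x
  have h := deriv_comp_mul_left c (fun t : ℝ => α (φ + t • u) χ x) 0
  rw [mul_zero] at h
  rw [Pi.smul_apply]
  refine Eq.trans (congrArg (fun g => deriv g 0) (funext fun t => ?_)) h
  simp only [smul_smul, mul_comm c t]

/-- Degree zero suffices, since only δa and δB enter the transformed data. The result has a single
slot, so alternation is vacuous and only linearity in the direction has content. -/
theorem IsFieldForm.delta (hv : ∀ φ ∈ 𝓕, IsVariation φ)
    {α : FieldForm m ty M 0 (Form m' q X)} (hα : IsFieldForm 𝓕 α) :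
    IsFieldForm 𝓕 (delta α) := by
  have e : ∀ φ (χ : Fin 1 → Fields m ty M) w, CovPhase.delta α φ (Function.update χ 0 w)
      = dirDeriv α φ w Fin.elim0 := by
    intro φ χ w
    rw [delta_eq_sum, Fin.sum_univ_one, Function.update_self, Subsingleton.elim (Fin.removeNth _ _)
      Fin.elim0]
    simp only [Fin.val_zero, pow_zero, one_smul]
  refine ⟨fun φ hφ χ hχ i u v hu hu' => ?_, fun φ hφ χ hχ i u c hu => ?_,
    fun φ hφ χ hχ i j hij => absurd ((Fin.fin_one_eq_zero i).trans (Fin.fin_one_eq_zero j).symm) hij, hα.smoothOn.delta⟩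
  · rw [Fin.fin_one_eq_zero i, e, e, e]
    exact dirDeriv_add hv hα.smoothOn hφ hu hu' fun i => i.elim0
  · rw [Fin.fin_one_eq_zero i, e, e]
    exact dirDeriv_smul_right c φ u _

end Closure

/-! ### Integration over chains and Stokes' theorem. -/

section Stokes

variable {m m' k : ℕ} {X Y : Type*} [TopologicalSpace X] [ChartedSpace (E m) X]
  [IsManifold (𝓡 m) ∞ X] [TopologicalSpace Y] [ChartedSpace (E m') Y] [IsManifold (𝓡 m') ∞ Y]

theorem Cube.integral_eq (c : Cube m k X) (η : Form m k X) :
    c.integral η = ∫ t in Set.Icc (0 : Fin k → ℝ) 1,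
      pullFlat c.toFun η t (fun i => (Pi.single i 1 : Fin k → ℝ)) := rfl

theorem Cube.differentiable_pullFlat {q : ℕ} (c : Cube m k X) {η : Form m q X}
    (h : SmoothForm η) : Differentiable ℝ (pullFlat c.toFun η) := fun t =>
  differentiableAt_pullFlat (x := c.toFun t) c.smooth.contMDiffAt (mem_extChartAt_source _)
    (h.differentiableAt _)

theorem Cube.differentiable_pullFlat_apply {q : ℕ} (c : Cube m k X) {η : Form m q X}
    (h : SmoothForm η) (v : Fin q → Fin k → ℝ) :
    Differentiable ℝ (fun t => pullFlat c.toFun η t v) := fun t =>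
  (ContinuousAlternatingMap.apply ℝ (Fin k → ℝ) ℝ v).differentiableAt.comp t
    (c.differentiable_pullFlat h t)

theorem Cube.integrableOn (c : Cube m k X) {η : Form m k X} (h : SmoothForm η) :
    MeasureTheory.IntegrableOn
      (fun t => pullFlat c.toFun η t (fun i => (Pi.single i 1 : Fin k → ℝ)))
      (Set.Icc (0 : Fin k → ℝ) 1) :=
  (c.differentiable_pullFlat_apply h _).continuous.continuousOn.integrableOn_compact isCompact_Icc

/-- Only the action on the standard basis matters: the face inclusion lists the basis vectors of the
larger cube with the `i`-th one removed, matching `Fin.removeNth`. -/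
theorem hasFDerivAt_insertNth (i : Fin (k + 1)) (e : ℝ) (t : Fin k → ℝ) :
    ∃ L : (Fin k → ℝ) →L[ℝ] (Fin (k + 1) → ℝ),
      HasFDerivAt (fun t : Fin k → ℝ => (i.insertNth e t : Fin (k + 1) → ℝ)) L t ∧
      ∀ l, L (Pi.single l 1) = Pi.single (i.succAbove l) 1 := by
  refine ⟨ContinuousLinearMap.pi (i.insertNth (α := fun _ => (Fin k → ℝ) →L[ℝ] ℝ) 0
    fun l => ContinuousLinearMap.proj l), ?_, fun l => ?_⟩
  · rw [hasFDerivAt_pi]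
    intro j
    refine Fin.succAboveCases i ?_ (fun l => ?_) j
    · simpa using hasFDerivAt_const e t
    · simpa using hasFDerivAt_apply l t
  · ext j
    refine Fin.succAboveCases i ?_ (fun l' => ?_) j
    · simp
    · simp [Pi.single_apply]

theorem Cube.integral_face (c : Cube m (k + 1) X) (i : Fin (k + 1)) (e : ℝ) (η : Form m k X) :
    (c.face i e).integral η = ∫ t in Set.Icc (0 : Fin k → ℝ) 1,
      pullFlat c.toFun η (i.insertNth e t)
        (i.removeNth fun j => (Pi.single j 1 : Fin (k + 1) → ℝ)) := by
  rw [Cube.integral_eq]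
  refine MeasureTheory.integral_congr_ae (Filter.Eventually.of_forall fun t => ?_)
  obtain ⟨L, hL, hL'⟩ := hasFDerivAt_insertNth i e t
  have h : dMap (m := m) (c.face i e).toFun t = (dMap (m := m) c.toFun (i.insertNth e t)).comp L := by
    have h1 := mfderiv_comp (I := 𝓘(ℝ, Fin k → ℝ)) (I' := 𝓘(ℝ, Fin (k + 1) → ℝ)) (I'' := 𝓡 m) t
      (f := fun t : Fin k → ℝ => (i.insertNth e t : Fin (k + 1) → ℝ)) (g := c.toFun)
      (c.smooth.mdifferentiable (by norm_num) _) hL.differentiableAt.mdifferentiableAt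
    rw [mfderiv_eq_fderiv, hL.fderiv] at h1
    exact h1
  refine congrArg (η (c.toFun (i.insertNth e t))) (funext fun l => ?_)
  change dMap (m := m) (c.face i e).toFun t (Pi.single l 1) = _
  rw [h]
  exact congrArg (dMap (m := m) c.toFun (i.insertNth e t)) (hL' l)

/-- Pulled back to the parameter space, dη on the standard basis is the divergence of the field with
components (−1)^i η(…, i-th basis vector omitted, …). The divergence theorem on the unit cube leaves
the face integrals with exactly the signs of `Chain.boundary`. -/
theorem Cube.integral_dForm (c : Cube m (k + 1) X) {η : Form m k X} (h : SmoothForm η) :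
    c.integral (dForm η) = ∑ i : Fin (k + 1), (-1 : ℝ) ^ (i : ℕ) *
      ((c.face i 1).integral η - (c.face i 0).integral η) := by
  set f : Fin (k + 1) → (Fin (k + 1) → ℝ) → ℝ := fun i t =>
    (-1 : ℝ) ^ (i : ℕ) * pullFlat c.toFun η t (i.removeNth fun j => (Pi.single j 1 : Fin (k + 1) → ℝ)) with hf
  have hd : ∀ i, Differentiable ℝ (f i) := fun i =>
    (c.differentiable_pullFlat_apply h _).const_mul _
  have hdiv : ∀ t, pullFlat c.toFun (dForm η) t
      (fun i => (Pi.single i 1 : Fin (k + 1) → ℝ))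
      = ∑ i, fderiv ℝ (f i) t (Pi.single i 1) := by
    intro t
    rw [← extDeriv_pullFlat (x := c.toFun t) c.smooth.contMDiffAt (mem_extChartAt_source _)
      (h.differentiableAt _), extDeriv_apply (c.differentiable_pullFlat h t)]
    refine Finset.sum_congr rfl fun i _ => ?_
    rw [hf]
    simp only
    rw [fderiv_const_mul (c.differentiable_pullFlat_apply h _ t)]
    simp
  rw [Cube.integral_eq]
  simp only [hdiv]
  rw [MeasureTheory.integral_divergence_of_hasFDerivAt_off_countable' 0 1 (by
    intro i; exact zero_le_one) f (fun i t => fderiv ℝ (f i) t) ∅ Set.countable_empty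
    (fun i => (hd i).continuous.continuousOn) (fun t _ i => (hd i t).hasFDerivAt) (by
      simp only [← hdiv]
      exact c.integrableOn h.dForm)]
  refine Finset.sum_congr rfl fun i _ => ?_
  rw [Cube.integral_face, Cube.integral_face, mul_sub, ← MeasureTheory.integral_const_mul,
    ← MeasureTheory.integral_const_mul]
  rfl

theorem Cube.integral_add (c : Cube m k X) {η ζ : Form m k X} (h : SmoothForm η)
    (h' : SmoothForm ζ) : c.integral (η + ζ) = c.integral η + c.integral ζ :=
  MeasureTheory.integral_add (c.integrableOn h) (c.integrableOn h')

theorem Cube.integral_smul (c : Cube m k X) (r : ℝ) (η : Form m k X) :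
    c.integral (r • η) = r * c.integral η :=
  MeasureTheory.integral_const_mul r _

theorem Cube.integral_push {f : X → Y} (hf : ContMDiff (𝓡 m) (𝓡 m') ∞ f) (c : Cube m k X)
    (η : Form m' k Y) : (c.push f hf).integral η = c.integral (pullForm f η) := by
  refine MeasureTheory.integral_congr_ae (Filter.Eventually.of_forall fun t => ?_)
  have h : dMap (m := m') (c.push f hf).toFun t
      = (mfderiv (𝓡 m) (𝓡 m') f (c.toFun t) : E m →L[ℝ] E m').comp (dMap (m := m) c.toFun t) :=
    mfderiv_comp t (hf.mdifferentiable (by norm_num) _) (c.smooth.mdifferentiable (by norm_num) t)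
  refine congrArg (η (f (c.toFun t))) (funext fun l => ?_)
  change dMap (m := m') (c.push f hf).toFun t (Pi.single l 1) = _
  rw [h]
  rfl

/-- Exhibits the integral as ℤ-linear in the chain, so that sums, boundaries and images are handled
cube by cube. -/
theorem Chain.integral_eq_linearCombination (C : Chain m k X) (η : Form m k X) :
    C.integral η = Finsupp.linearCombination ℤ (fun c : Cube m k X => c.integral η) C := by
  rw [Finsupp.linearCombination_apply]
  exact Finsupp.sum_congr fun c _ => (zsmul_eq_mul _ _).symm

theorem Chain.integral_add_left (C C' : Chain m k X) (η : Form m k X) :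
    (C + C').integral η = C.integral η + C'.integral η := by
  simp only [Chain.integral_eq_linearCombination, map_add]

theorem Chain.integral_add (C : Chain m k X) {η ζ : Form m k X} (h : SmoothForm η)
    (h' : SmoothForm ζ) : C.integral (η + ζ) = C.integral η + C.integral ζ := by
  simp only [Chain.integral, Finsupp.sum, ← Finset.sum_add_distrib, ← mul_add]
  exact Finset.sum_congr rfl fun c _ => by rw [Cube.integral_add c h h']

theorem Chain.integral_smul (C : Chain m k X) (r : ℝ) (η : Form m k X) :
    C.integral (r • η) = r * C.integral η := by
  simp only [Chain.integral, Finsupp.sum, Finset.mul_sum]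
  exact Finset.sum_congr rfl fun c _ => by rw [Cube.integral_smul, mul_left_comm]

theorem Chain.integral_sub (C : Chain m k X) {η ζ : Form m k X} (h : SmoothForm η)
    (h' : SmoothForm ζ) : C.integral (η - ζ) = C.integral η - C.integral ζ := by
  rw [sub_eq_add_neg, Form.neg_eq, Chain.integral_add C h (h'.const_smul _), Chain.integral_smul]
  ring

/-- Stokes' theorem for smooth singular chains. -/
theorem Chain.integral_boundary (C : Chain m (k + 1) X) {η : Form m k X} (h : SmoothForm η) :
    C.boundary.integral η = C.integral (dForm η) := by
  rw [Chain.integral_eq_linearCombination, Chain.boundary, Finsupp.sum, map_sum, Chain.integral,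
    Finsupp.sum]
  refine Finset.sum_congr rfl fun c _ => ?_
  rw [map_sum, Cube.integral_dForm c h, Finset.mul_sum]
  refine Finset.sum_congr rfl fun i _ => ?_
  rw [map_smul, map_sub, Finsupp.linearCombination_single, Finsupp.linearCombination_single,
    one_smul, one_smul, zsmul_eq_mul]
  push_cast
  ring

theorem Chain.integral_push {f : X → Y} (hf : ContMDiff (𝓡 m) (𝓡 m') ∞ f) (C : Chain m k X)
    (η : Form m' k Y) : (C.push f hf).integral η = C.integral (pullForm f η) := by
  rw [Chain.integral_eq_linearCombination, Chain.push, Finsupp.linearCombination_mapDomain,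
    Chain.integral_eq_linearCombination]
  congr 2
  exact funext fun c => Cube.integral_push hf c η

end Stokes

/-! ### Smoothness of the anomaly. -/

section AnomalySmooth

variable {m N p q : ℕ} {ty : Fin N → ℕ × ℕ} {M : Type*}
  [TopologicalSpace M] [ChartedSpace (E m) M] [IsManifold (𝓡 m) ∞ M]
  {𝓕 : Set (Fields m ty M)} {ξ : Fields m ty M → VF m M}
  {α β : FieldForm m ty M p (Form m q M)}

theorem IsFamilyAt.update {k : ℕ} {Ψ : Fin p → (Fin k → ℝ) → Fields m ty M}
    {v : (Fin k → ℝ) → Fields m ty M} {s : Fin k → ℝ} (hΨ : ∀ i, IsFamilyAt (Ψ i) s)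
    (hv : IsFamilyAt v s) (i j : Fin p) : IsFamilyAt (Function.update Ψ i v j) s := by
  rcases eq_or_ne j i with rfl | h
  · simpa using hv
  · simpa [h] using hΨ j

/-- Needed to distribute d over the sums Δ_ξ̂ b' + Δ_ξ̂ a and Δ_ξ̂ λ' + Δ_ξ̂ ν. -/
theorem SmoothOn.anomaly (hα : SmoothOn 𝓕 α) (hξ : IsSmoothGen 𝓕 ξ) :
    SmoothOn 𝓕 (anomaly ξ ξ α) := by
  refine ((hα.fL hξ).sub fun k Φ Ψ s hΦ hΨ hs x =>
    (hα k Φ Ψ s hΦ hΨ hs x).lieForm (hξ.smooth k Φ s hΦ hs x)).sub fun k Φ Ψ s hΦ hΨ hs x => ?_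
  refine SmoothFormAt.sum _ fun i _ => ?_
  have h := hα k Φ (Function.update Ψ i
      fun s => lieFields (deltaVF ξ (Φ s) (Ψ i s)) (Φ s)) s hΦ
    (IsFamilyAt.update hΨ (hξ.lieFields_deltaVF hΦ (hΨ i) hs) i) hs x
  have e : ∀ s', Function.update (fun j => Ψ j s') i
      (lieFields (deltaVF ξ (Φ s') (Ψ i s')) (Φ s')) = fun j => Function.update Ψ i
        (fun s => lieFields (deltaVF ξ (Φ s) (Ψ i s)) (Φ s)) j s' := by
    intro s'
    funext j
    rcases eq_or_ne j i with rfl | h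
    · simp
    · simp [h]
  simp only [e]
  exact h

end AnomalySmooth

/-! ### Additivity of d and of integrals, and d² = 0, at the level of field-space forms. -/

section Fd

variable {m m' N p q : ℕ} {ty : Fin N → ℕ × ℕ} {M X : Type*}
  [TopologicalSpace M] [ChartedSpace (E m) M]
  [TopologicalSpace X] [ChartedSpace (E m') X] [IsManifold (𝓡 m') ∞ X]
  {𝓕 : Set (Fields m ty M)} {α β : FieldForm m ty M p (Form m' q X)}

theorem fd_add (hv : ∀ φ ∈ 𝓕, IsVariation φ) (hα : SmoothOn 𝓕 α) (hβ : SmoothOn 𝓕 β) :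
    VEq 𝓕 (fd (α + β)) (fd α + fd β) := fun φ hφ _ hχ =>
  dForm_add (hα.smoothForm (hv φ hφ) hφ hχ) (hβ.smoothForm (hv φ hφ) hφ hχ)

theorem fd_fd (hv : ∀ φ ∈ 𝓕, IsVariation φ) (hα : SmoothOn 𝓕 α) :
    VEq 𝓕 (fd (fd α)) 0 := fun φ hφ _ hχ => dForm_dForm (hα.smoothForm (hv φ hφ) hφ hχ)

theorem fint_add (hv : ∀ φ ∈ 𝓕, IsVariation φ) (hα : SmoothOn 𝓕 α) (hβ : SmoothOn 𝓕 β)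
    (C : Chain m' q X) : VEq 𝓕 (fint C (α + β)) (fint C α + fint C β) := fun φ hφ _ hχ =>
  C.integral_add (hα.smoothForm (hv φ hφ) hφ hχ) (hβ.smoothForm (hv φ hφ) hφ hχ)

theorem VEq.fint {C : Chain m' q X} (h : VEq 𝓕 α β) : VEq 𝓕 (fint C α) (fint C β) :=
  fun φ hφ χ hχ => congrArg C.integral (h φ hφ χ hχ)

end Fd

/-! ### The two transformations of the phase space data. -/

section Formalism

variable {n N : ℕ} {ty : Fin N → ℕ × ℕ} {M 𝒩 : Type*}
  [TopologicalSpace M] [ChartedSpace (E (n + 2)) M] [IsManifold (𝓡 (n + 2)) ∞ M]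
  [TopologicalSpace 𝒩] [ChartedSpace (E (n + 1)) 𝒩] [IsManifold (𝓡 (n + 1)) ∞ 𝒩]
  {𝓕 : Set (Fields (n + 2) ty M)} {H : Hypersurface n M 𝒩} {D : PhaseData n ty M 𝒩}
  {a : FieldForm (n + 2) ty M 0 (Form (n + 2) (n + 1) M)}
  {ν : FieldForm (n + 2) ty M 1 (Form (n + 2) n M)}
  {B : FieldForm (n + 2) ty M 0 (Form (n + 1) (n + 1) 𝒩)}
  {Λ : FieldForm (n + 2) ty M 1 (Form (n + 1) n 𝒩)}

/-- The vector field on the hypersurface induced by `δξ` is the variation of the induced one. -/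
theorem Generator.deltaVF_tangent (G : Generator 𝓕 H) (φ χ : Fields (n + 2) ty M) (y : 𝒩) :
    (mfderiv (𝓡 (n + 1)) (𝓡 (n + 2)) H.ι y : E (n + 1) →L[ℝ] E (n + 2)) (deltaVF G.ξN φ χ y)
      = deltaVF G.ξ φ χ (H.ι y) := by
  set L : E (n + 1) →L[ℝ] E (n + 2) := mfderiv (𝓡 (n + 1)) (𝓡 (n + 2)) H.ι y with hL
  have hinj : Function.Injective L := H.immersive y
  -- The immersion has injective derivative, so the left-inverse lemma applies and no smoothness of
  -- `ξN` in the fields is used.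
  obtain ⟨L', hL'⟩ := (L : E (n + 1) →ₗ[ℝ] E (n + 2)).exists_leftInverse_of_injective
    (LinearMap.ker_eq_bot.2 hinj)
  have h := deriv_clm_comp_of_leftInverse (L := L) (L' := L'.toContinuousLinearMap)
    (fun v => LinearMap.congr_fun hL' v) (fun t : ℝ => G.ξN (φ + t • χ) y) 0
  refine h.symm.trans ?_
  exact congrArg (fun g => deriv g 0) (funext fun t => G.tangent (φ + t • χ) y)

namespace PhaseData

/-- The term δδa vanishes and δdν = dδν. -/
theorem jkm_sympCurrent (hv : ∀ φ ∈ 𝓕, IsVariation φ) (hD : D.IsValid 𝓕 H)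
    (ha : IsFieldForm 𝓕 a) (hν : IsFieldForm 𝓕 ν) :
    VEq 𝓕 (D.jkm H a ν).sympCurrent (D.sympCurrent + fd (delta ν)) := by
  intro φ hφ χ hχ
  change delta (D.θ + delta a + fd ν) φ χ = delta D.θ φ χ + fd (delta ν) φ χ
  rw [delta_add hv (hD.hθ.smoothOn.add ha.smoothOn.delta) hν.smoothOn.fd φ hφ χ hχ]
  change delta (D.θ + delta a) φ χ + delta (fd ν) φ χ = _
  rw [delta_add hv hD.hθ.smoothOn ha.smoothOn.delta φ hφ χ hχ, delta_fd hv hν.smoothOn φ hφ χ hχ]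
  change delta D.θ φ χ + delta (delta a) φ χ + _ = _
  rw [delta_delta hv ha.smoothOn φ hφ χ hχ]
  change delta D.θ φ χ + 0 + _ = _
  rw [add_zero]

/-- Together with `jkm_Lcov` this fixes the covariant Noether current, so the unchanged `Qcov` still
satisfies its potential relation. -/
theorem jkm_θcov (hv : ∀ φ ∈ 𝓕, IsVariation φ) (hD : D.IsValid 𝓕 H)
    (ha : IsFieldForm 𝓕 a) (hν : IsFieldForm 𝓕 ν) :
    VEq 𝓕 (D.jkm H a ν).θcov D.θcov := by
  intro φ hφ χ hχ
  change D.θ φ χ + delta a φ χ + fd ν φ χ - delta (D.b + a) φ χ - fd (D.lam + ν) φ χ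
    = D.θ φ χ - delta D.b φ χ - fd D.lam φ χ
  rw [delta_add hv hD.hb.smoothOn ha.smoothOn φ hφ χ hχ,
    fd_add hv hD.hlam.smoothOn hν.smoothOn φ hφ χ hχ]
  change _ - (delta D.b φ χ + delta a φ χ) - (fd D.lam φ χ + fd ν φ χ) = _
  abel

theorem jkm_Lcov (hv : ∀ φ ∈ 𝓕, IsVariation φ) (hD : D.IsValid 𝓕 H)
    (ha : IsFieldForm 𝓕 a) :
    VEq 𝓕 (D.jkm H a ν).Lcov D.Lcov := by
  intro φ hφ χ hχ
  change D.L φ χ + fd a φ χ - fd (D.b + a) φ χ = D.L φ χ - fd D.b φ χ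
  rw [fd_add hv hD.hb.smoothOn ha.smoothOn φ hφ χ hχ]
  change _ - (fd D.b φ χ + fd a φ χ) = _
  abel

theorem jkm_delta_L (hv : ∀ φ ∈ 𝓕, IsVariation φ) (hD : D.IsValid 𝓕 H)
    (ha : IsFieldForm 𝓕 a) (hν : IsFieldForm 𝓕 ν) :
    delta (D.jkm H a ν).L ≐[𝓕] (D.jkm H a ν).eomForm + fd (D.jkm H a ν).θ := by
  intro φ hφ χ hχ
  have hχ' := fun i => (hχ i).1
  have h := hD.delta_L φ hφ χ hχ
  change delta (D.L + fd a) φ χ = D.eomForm φ χ + fd (D.θ + delta a + fd ν) φ χ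
  rw [delta_add hv hD.hL.smoothOn ha.smoothOn.fd φ hφ χ hχ',
    fd_add hv (hD.hθ.smoothOn.add ha.smoothOn.delta) hν.smoothOn.fd φ hφ χ hχ']
  change delta D.L φ χ + delta (fd a) φ χ
    = D.eomForm φ χ + (fd (D.θ + delta a) φ χ + fd (fd ν) φ χ)
  rw [fd_add hv hD.hθ.smoothOn ha.smoothOn.delta φ hφ χ hχ', delta_fd hv ha.smoothOn φ hφ χ hχ',
    fd_fd hv hν.smoothOn φ hφ χ hχ', h]
  change D.eomForm φ χ + fd D.θ φ χ + fd (delta a) φ χ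
    = D.eomForm φ χ + (fd D.θ φ χ + fd (delta a) φ χ + 0)
  abel

theorem jkm_anomaly_L (hv : ∀ φ ∈ 𝓕, IsVariation φ) (hD : D.IsValid 𝓕 H)
    (ha : IsFieldForm 𝓕 a) {ξ : Fields (n + 2) ty M → VF (n + 2) M} (hξ : IsSmoothGen 𝓕 ξ) :
    anomaly ξ ξ (D.jkm H a ν).L ≐[𝓕] fd (anomaly ξ ξ (D.jkm H a ν).b) :=
  (anomaly_add hv hξ hD.hL.smoothOn ha.smoothOn.fd).feq.trans
    (((hD.anomaly_L ξ hξ).add (anomaly_fd hv hξ ha.smoothOn).feq).trans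
      ((fd_add hv (hD.hb.smoothOn.anomaly hξ) (ha.smoothOn.anomaly hξ)).symm.trans
        (anomaly_add hv hξ hD.hb.smoothOn ha.smoothOn).symm.fd).feq)

theorem jkm_anomaly_θ (hv : ∀ φ ∈ 𝓕, IsVariation φ) (hD : D.IsValid 𝓕 H)
    (ha : IsFieldForm 𝓕 a) (hν : IsFieldForm 𝓕 ν)
    {ξ : Fields (n + 2) ty M → VF (n + 2) M} (hξ : IsSmoothGen 𝓕 ξ) :
    anomaly ξ ξ (D.jkm H a ν).θ ≐[𝓕]
      anomaly ξ ξ (delta (D.jkm H a ν).b) + fd (anomaly ξ ξ (D.jkm H a ν).lam) := by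
  have h1 := ((anomaly_add hv hξ (hD.hθ.smoothOn.add ha.smoothOn.delta) hν.smoothOn.fd).trans
    ((anomaly_add hv hξ hD.hθ.smoothOn ha.smoothOn.delta).add
      (anomaly_fd hv hξ hν.smoothOn))).feq
  -- The anomaly differentiates δ(b' + a) once more, so additivity of δ is used here as a germ.
  have h2 := ((anomaly_congr hv hξ (delta_add_germEq hD.hb.smoothOn ha.smoothOn)).trans
    (anomaly_add hv hξ hD.hb.smoothOn.delta ha.smoothOn.delta)).feq
  have h3 := ((anomaly_add hv hξ hD.hlam.smoothOn hν.smoothOn).fd.trans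
    (fd_add hv (hD.hlam.smoothOn.anomaly hξ) (hν.smoothOn.anomaly hξ))).feq
  intro φ hφ χ hχ
  have h4 := hD.anomaly_θ ξ hξ φ hφ χ hχ
  refine (h1 φ hφ χ hχ).trans (Eq.trans ?_ ((h2.add h3) φ hφ χ hχ).symm)
  change anomaly ξ ξ D.θ φ χ + anomaly ξ ξ (delta a) φ χ + fd (anomaly ξ ξ ν) φ χ
    = anomaly ξ ξ (delta D.b) φ χ + anomaly ξ ξ (delta a) φ χ
      + (fd (anomaly ξ ξ D.lam) φ χ + fd (anomaly ξ ξ ν) φ χ)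
  rw [h4]
  change anomaly ξ ξ (delta D.b) φ χ + fd (anomaly ξ ξ D.lam) φ χ + _ + _ = _
  abel

/-- The shifts ι*δa and ι*dν of the left side equal those of −δℓ' and dβ', because ι* commutes with
δ and d; the flux therefore need not change. -/
theorem jkm_decomposition (hv : ∀ φ ∈ 𝓕, IsVariation φ) (hD : D.IsValid 𝓕 H)
    (ha : IsFieldForm 𝓕 a) (hν : IsFieldForm 𝓕 ν) :
    fpull H.ι (D.jkm H a ν).θ ≐[𝓕]
      - delta (D.jkm H a ν).ell + fd (D.jkm H a ν).β + (D.jkm H a ν).flux := by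
  intro φ hφ χ hχ
  have hχ' := fun i => (hχ i).1
  have h := hD.decomposition φ hφ χ hχ
  have h1 := delta_sub hv hD.hell.smoothOn (ha.smoothOn.fpull H.smooth) φ hφ χ hχ'
  have h2 := delta_fpull (X := 𝒩) (m' := n + 1) (f := H.ι) hv ha.smoothOn φ hφ χ hχ'
  have h3 := fd_add hv hD.hβ.smoothOn (hν.smoothOn.fpull H.smooth) φ hφ χ hχ'
  have h4 := dForm_pullForm H.smooth (hν.smoothOn.smoothForm (hv φ hφ) hφ hχ')
  change fpull H.ι D.θ φ χ + pullForm H.ι (delta a φ χ) + pullForm H.ι (dForm (ν φ χ))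
    = - delta (D.ell - fpull H.ι a) φ χ + fd (D.β + fpull H.ι ν) φ χ + D.flux φ χ
  change _ = delta D.ell φ χ - delta (fpull H.ι a) φ χ at h1
  change fd (D.β + fpull H.ι ν) φ χ = fd D.β φ χ + dForm (pullForm H.ι (ν φ χ)) at h3
  change _ = pullForm H.ι (delta a φ χ) at h2
  change _ = - delta D.ell φ χ + fd D.β φ χ + D.flux φ χ at h
  rw [h1, h3, h2, h4, h]
  abel

theorem jkm_isValid (hv : ∀ φ ∈ 𝓕, IsVariation φ) (hD : D.IsValid 𝓕 H)
    (ha : IsFieldForm 𝓕 a) (hν : IsFieldForm 𝓕 ν) : (D.jkm H a ν).IsValid 𝓕 H where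
  hL := hD.hL.add (ha.fd hv)
  hθ := (hD.hθ.add (ha.delta hv)).add (hν.fd hv)
  hb := hD.hb.add ha
  hlam := hD.hlam.add hν
  hell := hD.hell.sub (ha.fpull H.smooth)
  hβ := hD.hβ.add (hν.fpull H.smooth)
  hflux := hD.hflux
  delta_L := jkm_delta_L hv hD ha hν
  anomaly_L _ hξ := jkm_anomaly_L hv hD ha hξ
  anomaly_θ _ hξ := jkm_anomaly_θ hv hD ha hν hξ
  decomposition := jkm_decomposition hv hD ha hν
  Q_add := hD.Q_add
  Q_smul := hD.Q_smul
  Q_smooth := hD.Q_smooth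
  Q_covariant := hD.Q_covariant
  Q_potential ξ hξ φ hφ ht χ := by
    have h := hD.Q_potential ξ hξ φ hφ ht χ
    have h1 : (D.jkm H a ν).θcov φ (Fin.cons (lieFields ξ φ) χ)
        = D.θcov φ (Fin.cons (lieFields ξ φ) χ) :=
      jkm_θcov hv hD ha hν φ hφ.1 _ (isVariation_cons ht.1 fun i => i.elim0)
    have h2 : (D.jkm H a ν).Lcov φ χ = D.Lcov φ χ :=
      jkm_Lcov hv hD ha φ hφ.1 χ fun i => i.elim0
    refine h.trans ?_
    change D.θcov φ (Fin.cons (lieFields ξ φ) χ) - iForm ξ (D.Lcov φ χ)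
      = (D.jkm H a ν).θcov φ (Fin.cons (lieFields ξ φ) χ) - iForm ξ ((D.jkm H a ν).Lcov φ χ)
    rw [h1, h2]

/-- By Cartan's formula I_ξ̂ δa − i_ξ da − Δ_ξ̂ a = d i_ξ a, and ν contributes d I_ξ̂ ν. -/
theorem jkm_J (hv : ∀ φ ∈ 𝓕, IsVariation φ) (hD : D.IsValid 𝓕 H)
    (ha : IsFieldForm 𝓕 a) (hν : IsFieldForm 𝓕 ν)
    {ξ : Fields (n + 2) ty M → VF (n + 2) M} (hξ : IsSmoothGen 𝓕 ξ) :
    VEq 𝓕 ((D.jkm H a ν).J ξ) (D.J ξ + fd (fi ξ a + fI (hat ξ) ν)) := by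
  intro φ hφ χ hχ
  have h1 := anomaly_add hv hξ hD.hb.smoothOn ha.smoothOn φ hφ χ hχ
  have hx := hξ.smoothVF (hv φ hφ) hφ
  have h2 : dForm (iForm (ξ φ) (a φ χ) + fI (hat ξ) ν φ χ)
      = dForm (iForm (ξ φ) (a φ χ)) + dForm (fI (hat ξ) ν φ χ) :=
    dForm_add ((ha.smoothOn.smoothForm (hv φ hφ) hφ hχ).iForm hx)
      ((hν.smoothOn.fI_hat hξ).smoothForm (hv φ hφ) hφ hχ)
  change fI (hat ξ) D.θ φ χ + fI (hat ξ) (delta a) φ χ + dForm (fI (hat ξ) ν φ χ)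
      - (fi ξ D.L φ χ + iForm (ξ φ) (dForm (a φ χ))) - anomaly ξ ξ (D.b + a) φ χ
    = fI (hat ξ) D.θ φ χ - fi ξ D.L φ χ - anomaly ξ ξ D.b φ χ
      + dForm (iForm (ξ φ) (a φ χ) + fI (hat ξ) ν φ χ)
  -- In field-space degree zero the sum inserting £_{δξ} φ is empty, so only the directional
  -- derivative and the Cartan terms remain.
  have h3 : anomaly ξ ξ a φ χ = fI (hat ξ) (delta a) φ χ
      - (iForm (ξ φ) (dForm (a φ χ)) + dForm (iForm (ξ φ) (a φ χ))) := by
    refine Eq.trans ?_ (sub_zero _)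
    rfl
  rw [h2, h1]
  change _ - (anomaly ξ ξ D.b φ χ + anomaly ξ ξ a φ χ) = _
  rw [h3]
  abel

theorem jkm_Q (ξ : Fields (n + 2) ty M → VF (n + 2) M) :
    (D.jkm H a ν).Q ξ = D.Q ξ + fi ξ a + fI (hat ξ) ν := by
  funext φ χ
  change D.Qcov (ξ φ) φ χ + (fi ξ D.b φ χ + fi ξ a φ χ)
      + (fI (hat ξ) D.lam φ χ + fI (hat ξ) ν φ χ)
    = D.Qcov (ξ φ) φ χ + fi ξ D.b φ χ + fI (hat ξ) D.lam φ χ + fi ξ a φ χ + fI (hat ξ) ν φ χ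
  abel

/-- Purely algebraic: i_{ξN} ι*a = ι* i_ξ a cancels the shift of ℓ' against that of Q'_ξ, and I_ξ̂
ι*ν = ι* I_ξ̂ ν does the same for β'. Tangency is asked only at the given φ and no smoothness
enters, so it covers both h_ξ and h_{δξ}. -/
theorem jkm_density {ξ : Fields (n + 2) ty M → VF (n + 2) M}
    {ξN : Fields (n + 2) ty M → VF (n + 1) 𝒩} {φ : Fields (n + 2) ty M}
    (h : ∀ y, (mfderiv (𝓡 (n + 1)) (𝓡 (n + 2)) H.ι y : E (n + 1) →L[ℝ] E (n + 2)) (ξN φ y)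
      = ξ φ (H.ι y)) (χ : Fin 0 → Fields (n + 2) ty M) :
    (D.jkm H a ν).density H ξ ξN φ χ = D.density H ξ ξN φ χ := by
  have h1 := iForm_pullForm h (a φ χ)
  change pullForm H.ι ((D.jkm H a ν).Q ξ φ χ)
      + (fi ξN D.ell φ χ - iForm (ξN φ) (pullForm H.ι (a φ χ)))
      - (fI (hat ξ) D.β φ χ + pullForm H.ι (fI (hat ξ) ν φ χ))
    = pullForm H.ι (D.Q ξ φ χ) + fi ξN D.ell φ χ - fI (hat ξ) D.β φ χ
  rw [h1, jkm_Q]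
  change pullForm H.ι (D.Q ξ φ χ) + pullForm H.ι (iForm (ξ φ) (a φ χ))
    + pullForm H.ι (fI (hat ξ) ν φ χ) + _ - _ = _
  abel

theorem jkm_h (G : Generator 𝓕 H) : (D.jkm H a ν).h G = D.h G :=
  funext fun φ => funext fun χ => jkm_density (G.tangent φ) χ

/-- The three terms are separately invariant: ℰ is fixed, β' − ι*λ' does not move, and h_{δξ} is the
density of a vector field tangent to the hypersurface. -/
theorem jkm_F (G : Generator 𝓕 H) (R : Subregion H) :
    (D.jkm H a ν).F G R = D.F G R := by
  have h1 : (D.jkm H a ν).β - fpull H.ι (D.jkm H a ν).lam = D.β - fpull H.ι D.lam := by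
    funext φ χ
    change D.β φ χ + pullForm H.ι (ν φ χ) - (pullForm H.ι (D.lam φ χ) + pullForm H.ι (ν φ χ))
      = D.β φ χ - pullForm H.ι (D.lam φ χ)
    abel
  have h2 : (D.jkm H a ν).hδ G = D.hδ G :=
    funext fun φ => funext fun χ => jkm_density
      (ξ := fun _ => deltaVF G.ξ φ (χ 0)) (ξN := fun _ => deltaVF G.ξN φ (χ 0))
      (G.deltaVF_tangent φ (χ 0)) Fin.elim0
  rw [F, F, h1, h2]
  rfl

/-- By Stokes the integral of dδν over the slice is that of ι*δν over the cut, which is also the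
change of the corner term since δ commutes with ι*. -/
theorem jkm_Ω (hv : ∀ φ ∈ 𝓕, IsVariation φ) (hD : D.IsValid 𝓕 H)
    (ha : IsFieldForm 𝓕 a) (hν : IsFieldForm 𝓕 ν) (R : Subregion H) :
    VEq 𝓕 ((D.jkm H a ν).Ω R) (D.Ω R) := by
  intro φ hφ χ hχ
  have hs := hν.smoothOn.delta.smoothForm (hv φ hφ) hφ hχ
  have h1 : R.slice.integral ((D.jkm H a ν).sympCurrent φ χ)
      = R.slice.integral (D.sympCurrent φ χ) + R.slice.integral (dForm (delta ν φ χ)) := by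
    rw [jkm_sympCurrent hv hD ha hν φ hφ χ hχ]
    exact R.slice.integral_add (hD.hθ.smoothOn.delta.smoothForm (hv φ hφ) hφ hχ) hs.dForm
  have h2 : R.cut.integral (delta (D.β + fpull H.ι ν) φ χ)
      = R.cut.integral (delta D.β φ χ) + R.cut.integral (pullForm H.ι (delta ν φ χ)) := by
    rw [delta_add hv hD.hβ.smoothOn (hν.smoothOn.fpull H.smooth) φ hφ χ hχ]
    have h3 := delta_fpull (X := 𝒩) (m' := n + 1) (f := H.ι) hv hν.smoothOn φ hφ χ hχ
    refine Eq.trans ?_ (R.cut.integral_add (hD.hβ.smoothOn.delta.smoothForm (hv φ hφ) hφ hχ)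
      (hs.pullForm H.smooth))
    exact congrArg (fun η => R.cut.integral (delta D.β φ χ + η)) h3
  have h4 : R.slice.integral (dForm (delta ν φ χ))
      = R.cut.integral (pullForm H.ι (delta ν φ χ)) := by
    rw [← Chain.integral_boundary _ hs, R.boundary_slice _ hs, Chain.integral_push]
  change R.slice.integral ((D.jkm H a ν).sympCurrent φ χ)
      - R.cut.integral (delta (D.β + fpull H.ι ν) φ χ)
    = R.slice.integral (D.sympCurrent φ χ) - R.cut.integral (delta D.β φ χ)
  rw [h1, h2, h4]
  ring

/-- Stokes splits the integral of da over U into its two boundary parts; the shift of ℓ' removes the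
one in the hypersurface. -/
theorem jkm_S (hv : ∀ φ ∈ 𝓕, IsVariation φ) (hD : D.IsValid 𝓕 H)
    (ha : IsFieldForm 𝓕 a) (R : Subregion H) :
    VEq 𝓕 ((D.jkm H a ν).S R) (D.S R + fint R.rest a) := by
  intro φ hφ χ hχ
  have hs := ha.smoothOn.smoothForm (hv φ hφ) hφ hχ
  have h1 := R.U.integral_add (hD.hL.smoothOn.smoothForm (hv φ hφ) hφ hχ) hs.dForm
  have h2 := R.bdry.integral_sub (hD.hell.smoothOn.smoothForm (hv φ hφ) hφ hχ)
    (hs.pullForm H.smooth)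
  have h3 : R.U.integral (dForm (a φ χ))
      = R.bdry.integral (pullForm H.ι (a φ χ)) + R.rest.integral (a φ χ) := by
    rw [← Chain.integral_boundary _ hs, R.boundary_U _ hs, Chain.integral_add_left,
      Chain.integral_push]
  change R.U.integral (D.L φ χ + dForm (a φ χ))
      + R.bdry.integral (D.ell φ χ - pullForm H.ι (a φ χ))
    = R.U.integral (D.L φ χ) + R.bdry.integral (D.ell φ χ) + R.rest.integral (a φ χ)
  rw [h1, h2, h3]
  ring

theorem jkm_ellb : (D.jkm H a ν).ellb H = D.ellb H := by
  funext φ χ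
  change D.ell φ χ - pullForm H.ι (a φ χ) + (pullForm H.ι (D.b φ χ) + pullForm H.ι (a φ χ))
    = D.ell φ χ + pullForm H.ι (D.b φ χ)
  abel

/-- Only the decomposition of the pulled-back θ' involves the changed data, and there the shifts −δB
and dΛ are compensated by the flux. -/
theorem bct_isValid (hv : ∀ φ ∈ 𝓕, IsVariation φ) (hD : D.IsValid 𝓕 H)
    (hB : IsFieldForm 𝓕 B) (hΛ : IsFieldForm 𝓕 Λ) : (D.bct B Λ).IsValid 𝓕 H where
  hL := hD.hL
  hθ := hD.hθ
  hb := hD.hb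
  hlam := hD.hlam
  hell := hD.hell.add hB
  hβ := hD.hβ.add hΛ
  hflux := (hD.hflux.add (hB.delta hv)).sub (hΛ.fd hv)
  delta_L := hD.delta_L
  anomaly_L := hD.anomaly_L
  anomaly_θ := hD.anomaly_θ
  decomposition φ hφ χ hχ := by
    have hχ' := fun i => (hχ i).1
    refine (hD.decomposition φ hφ χ hχ).trans ?_
    have h1 := delta_add hv hD.hell.smoothOn hB.smoothOn φ hφ χ hχ'
    have h2 := fd_add hv hD.hβ.smoothOn hΛ.smoothOn φ hφ χ hχ'
    change - delta D.ell φ χ + fd D.β φ χ + D.flux φ χ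
      = - delta (D.ell + B) φ χ + fd (D.β + Λ) φ χ + (D.flux φ χ + delta B φ χ - fd Λ φ χ)
    rw [h1, h2]
    change _ = - (delta D.ell φ χ + delta B φ χ) + (fd D.β φ χ + fd Λ φ χ) + _
    abel
  Q_add := hD.Q_add
  Q_smul := hD.Q_smul
  Q_smooth := hD.Q_smooth
  Q_covariant := hD.Q_covariant
  Q_potential := hD.Q_potential

theorem bct_S (hv : ∀ φ ∈ 𝓕, IsVariation φ) (hD : D.IsValid 𝓕 H) (hB : IsFieldForm 𝓕 B)
    (R : Subregion H) : VEq 𝓕 ((D.bct B Λ).S R) (D.S R + fint R.bdry B) := by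
  intro φ hφ χ hχ
  have h := fint_add hv hD.hell.smoothOn hB.smoothOn R.bdry φ hφ χ hχ
  change fint R.U D.L φ χ + fint R.bdry (D.ell + B) φ χ
    = fint R.U D.L φ χ + fint R.bdry D.ell φ χ + fint R.bdry B φ χ
  rw [h]
  exact (add_assoc _ _ _).symm

theorem bct_Ω (hv : ∀ φ ∈ 𝓕, IsVariation φ) (hD : D.IsValid 𝓕 H) (hΛ : IsFieldForm 𝓕 Λ)
    (R : Subregion H) : VEq 𝓕 ((D.bct B Λ).Ω R) (D.Ω R - fint R.cut (delta Λ)) := by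
  intro φ hφ χ hχ
  have h := (delta_add hv hD.hβ.smoothOn hΛ.smoothOn).fint (C := R.cut) |>.trans
    (fint_add hv hD.hβ.smoothOn.delta hΛ.smoothOn.delta R.cut)
  change fint R.slice D.sympCurrent φ χ - fint R.cut (delta (D.β + Λ)) φ χ
    = fint R.slice D.sympCurrent φ χ - fint R.cut (delta D.β) φ χ - fint R.cut (delta Λ) φ χ
  rw [h φ hφ χ hχ]
  exact sub_add_eq_sub_sub _ _ _

theorem bct_h (G : Generator 𝓕 H) :
    (D.bct B Λ).h G = D.h G + fi G.ξN B - fI (hat G.ξ) Λ := by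
  funext φ χ
  change fpull H.ι (D.Q G.ξ) φ χ + (fi G.ξN D.ell φ χ + fi G.ξN B φ χ)
      - (fI (hat G.ξ) D.β φ χ + fI (hat G.ξ) Λ φ χ)
    = fpull H.ι (D.Q G.ξ) φ χ + fi G.ξN D.ell φ χ - fI (hat G.ξ) D.β φ χ + fi G.ξN B φ χ
      - fI (hat G.ξ) Λ φ χ
  abel

end PhaseData

end Formalism

end CovPhase

end

theorem mainTheorem3 {n N : ℕ} (ty : Fin N → ℕ × ℕ) {M 𝒩 : Type*}
    [TopologicalSpace M] [ChartedSpace (E (n + 2)) M]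
    [IsManifold (modelWithCornersSelf ℝ (E (n + 2))) ((⊤ : ℕ∞) : WithTop ℕ∞) M]
    [TopologicalSpace 𝒩] [ChartedSpace (E (n + 1)) 𝒩]
    [IsManifold (modelWithCornersSelf ℝ (E (n + 1))) ((⊤ : ℕ∞) : WithTop ℕ∞) 𝒩]
    (𝓕 : Set (Fields (n + 2) ty M)) (h𝓕 : ∀ φ ∈ 𝓕, IsConfig φ)
    (H : Hypersurface n M 𝒩) (R : Subregion H)
    (D : PhaseData n ty M 𝒩) (hD : D.IsValid 𝓕 H) :
    -- JKM transformations
    (∀ (a : FieldForm (n + 2) ty M 0 (Form (n + 2) (n + 1) M))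
        (ν : FieldForm (n + 2) ty M 1 (Form (n + 2) n M)), IsFieldForm 𝓕 a → IsFieldForm 𝓕 ν →
      -- the transformed quantities again satisfy the defining relations, with the same flux
      (D.jkm H a ν).IsValid 𝓕 H ∧
      -- induced transformations of the symplectic current, Noether current and potential
      (D.jkm H a ν).sympCurrent ≐[𝓕] D.sympCurrent + fd (delta ν) ∧
      (∀ ξ, IsSmoothGen 𝓕 ξ →
        (D.jkm H a ν).J ξ ≐[𝓕] D.J ξ + fd (fi ξ a + fI (hat ξ) ν) ∧
        (D.jkm H a ν).Q ξ ≐[𝓕] D.Q ξ + fi ξ a + fI (hat ξ) ν) ∧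
      -- the invariant quantities
      (D.jkm H a ν).Ω R ≐[𝓕] D.Ω R ∧
      (∀ G : Generator 𝓕 H, (D.jkm H a ν).h G ≐[𝓕] D.h G) ∧
      (∀ G : Generator 𝓕 H, (D.jkm H a ν).F G R ≐[𝓕] D.F G R) ∧
      (D.jkm H a ν).S R ≐[𝓕] D.S R + fint R.rest a ∧
      (fint R.rest a ≐[𝓕] 0 → (D.jkm H a ν).S R ≐[𝓕] D.S R) ∧
      (D.jkm H a ν).ellb H ≐[𝓕] D.ellb H) ∧
    -- boundary canonical transformations
    (∀ (B : FieldForm (n + 2) ty M 0 (Form (n + 1) (n + 1) 𝒩))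
        (Λ : FieldForm (n + 2) ty M 1 (Form (n + 1) n 𝒩)), IsFieldForm 𝓕 B → IsFieldForm 𝓕 Λ →
      (D.bct B Λ).IsValid 𝓕 H ∧
      (D.bct B Λ).S R ≐[𝓕] D.S R + fint R.bdry B ∧
      (D.bct B Λ).Ω R ≐[𝓕] D.Ω R - fint R.cut (delta Λ) ∧
      (∀ G : Generator 𝓕 H,
        (D.bct B Λ).h G ≐[𝓕] D.h G + fi G.ξN B - fI (hat G.ξ) Λ)) := by
  have hv : ∀ φ ∈ 𝓕, IsVariation φ := fun φ hφ => (h𝓕 φ hφ).1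
  refine ⟨fun a ν ha hν => ⟨PhaseData.jkm_isValid hv hD ha hν,
    (PhaseData.jkm_sympCurrent hv hD ha hν).feq, fun ξ hξ =>
      ⟨(PhaseData.jkm_J hv hD ha hν hξ).feq, fun φ _ χ _ => by rw [PhaseData.jkm_Q]⟩,
    (PhaseData.jkm_Ω hv hD ha hν R).feq, fun G φ _ χ _ => by rw [PhaseData.jkm_h],
    fun G φ _ χ _ => by rw [PhaseData.jkm_F], (PhaseData.jkm_S hv hD ha R).feq, fun h => ?_,
    fun φ _ χ _ => by rw [PhaseData.jkm_ellb]⟩,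
    fun B Λ hB hΛ => ⟨PhaseData.bct_isValid hv hD hB hΛ, (PhaseData.bct_S hv hD hB R).feq,
      (PhaseData.bct_Ω hv hD hΛ R).feq, fun G φ _ χ _ => by rw [PhaseData.bct_h]⟩⟩
  intro φ hφ χ hχ
  refine ((PhaseData.jkm_S hv hD ha R).feq φ hφ χ hχ).trans ?_
  change D.S R φ χ + fint R.rest a φ χ = D.S R φ χ
  rw [h φ hφ χ hχ]
  exact add_zero _
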